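/- **Language.** Names are variables $x$ and function identifiers $f/k$ ($f$ an atom, $k\in\mathbb N$). The syntax of sequential Core Erlang is - patterns $p ::= i \mid a \mid x \mid [p_1|p_2] \mid [\,] \mid \{p_1,\dots,p_n\} \mid {\sim}\{p_1^k\Rightarrow p_1^v,\dots,p_n^k\Rightarrow p_n^v\}{\sim}$, with $i$ an integer and $a$ an atom; - function collections $ext$: lists of definitions $f/k=\mathtt{fun}(x_1,\dots,x_k)\to e$; clauses $ps\ \mathtt{when}\ e^g\to e^b$, with $ps$ a list of patterns; - values $v ::= i \mid a \mid x \mid f/k \mid clos(ext,[x_1,\dots,x_n],e) \mid [v_1|v_2] \mid [\,] \mid \{v_1,\dots,v_n\} \mid {\sim}\{v_1^k\Rightarrow v_1^v,\dots,v_n^k\Rightarrow v_n^v\}{\sim}$; - expressions $e ::= v \mid \mathtt{fun}(x_1,\dots,x_n)\to e \mid \langle e_1,\dots,e_n\rangle \mid [e_1|e_2] \mid \{e_1,\dots,e_n\} \mid {\sim}\{e_1^k\Rightarrow e_1^v,\dots,e_n^k\Rightarrow e_n^v\}{\sim} \mid \mathtt{call}\ e_m{:}e_f(e_1,\dots,e_n)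 \mid \mathtt{primop}\ a(e_1,\dots,e_n) \mid \mathtt{apply}\ e(e_1,\dots,e_n) \mid \mathtt{case}\ e\ \mathtt{of}\ cl_1;\dots;cl_n\ \mathtt{end} \mid \mathtt{let}\ \langle x_1,\dots,x_n\rangle=e_1\ \mathtt{in}\ e_2 \mid \mathtt{do}\ e_1\ e_2 \mid \mathtt{letrec}\ ext\ \mathtt{in}\ e \mid \mathtt{try}\ e_1\ \mathtt{of}\ \langle x_1,\dots,x_k\rangle\to e_2\ \mathtt{catch}\ \langle x_{k+1},\dots,x_{k+n}\rangle\to e_3$. Exceptions are $\{c,v_r,v_d\}^X$ with class $c\in\{\mathtt{throw},\mathtt{exit},\mathtt{error}\}$. A *redex* $r$ is a value sequence $\langle v_1,\dots,v_n\rangle$, an exception, an expression or the hole $\Box$; *results* are value sequences and exceptions. Substitutions $\sigma$ map names to values and are applied in parallel and without capture. A term is closed if it has no free names. $names(ext)$ is the set of function identifiers that $ext$ binds, $vars(ps)$ is the set of variables of $ps$, and $mk(ext)$ maps the identifier of each definition $f/k=\mathtt{fun}(x_1,\dots,x_k)\to e$ of $ext$ to $clos(ext,[x_1,\dots,x_k],e)$.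 **Semantics.** A frame stack $K$ is a list of frames; the frames are $id(v_1,\dots,v_j,\Box,e_1,\dots,e_l)$ with $id$ one of $tuple$, $values$, $map$, $call(v_m,v_f)$, $primop(a)$, $app(v_f)$, and $[e_1|\Box]$, $[\Box|v_2]$, $\mathtt{call}\ \Box{:}e_f(\vec e)$, $\mathtt{call}\ v_m{:}\Box(\vec e)$, $\mathtt{apply}\ \Box(\vec e)$, $\mathtt{case}\ \Box\ \mathtt{of}\ \vec{cl}\ \mathtt{end}$, $\mathtt{case}\ \langle\vec v\rangle\ \mathtt{of}\ ps\ \mathtt{when}\ \Box\to e^b;\vec{cl}\ \mathtt{end}$, $\mathtt{let}\ \langle\vec x\rangle=\Box\ \mathtt{in}\ e_2$, $\mathtt{do}\ \Box\ e_2$, $\mathtt{try}\ \Box\ \mathtt{of}\ \langle\vec x\rangle\to e_2\ \mathtt{catch}\ \langle\vec y\rangle\to e_3$. A step $\langle K,r\rangle\to\langle K',r'\rangle$ is one of the following. - An expression that is neither a value, a $\mathtt{fun}$, a $\mathtt{letrec}$ nor the empty map pushes its frame. List cells continue with $e_2$; $\mathtt{apply}$, $\mathtt{call}$, $\mathtt{case}$,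 $\mathtt{let}$, $\mathtt{do}$, $\mathtt{try}$ continue with their first subexpression, non-empty maps with the first key (frame $map(\Box,e_1^v,e_2^k,e_2^v,\dots)$); tuples, value lists and $\mathtt{primop}$ push $id(\Box,e_1,\dots,e_n)$ and continue with $\Box$. In place, $\mathtt{fun}(\vec x)\to e$ becomes $\langle clos(\emptyset,[\vec x],e)\rangle$, $\mathtt{letrec}\ ext\ \mathtt{in}\ e$ becomes $e[mk(ext)]$, $v$ becomes $\langle v\rangle$, the empty map expression becomes the sequence of the empty map value. - A singleton $\langle v\rangle$ on $[e_1|\Box]$ gives $[\Box|v]$ with $e_1$, and on $[\Box|v_2]$ it pops the frame and gives $\langle[v|v_2]\rangle$; on $\mathtt{call}\ \Box{:}e_f(\vec e)$ it gives $\mathtt{call}\ v{:}\Box(\vec e)$ with $e_f$; on $\mathtt{call}\ v_m{:}\Box(\vec e)$ and $\mathtt{apply}\ \Box(\vec e)$ it gives $call(v_m,v)(\Box,\vec e)$ and $app(v)(\Box,\vec e)$ with $\Box$; on $\mathtt{do}\ \Box\ e_2$ it pops the frame and gives $e_2$. On a parameter frame, $\langle v\rangle$ is appended to the evaluated values, and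 the next expression is evaluated, or if there is none the frame is popped and the redex $eval(id,\vec v)$ results. If $id\ne map$, the redex $\Box$ on $id(\Box,e_1,e_2,\dots,e_n)$ gives $id(\Box,e_2,\dots,e_n)$ with $e_1$, and on $id(\vec v,\Box)$ it gives $eval(id,\vec v)$. - $\langle v_1,\dots,v_n\rangle$ on a $\mathtt{let}$ or $\mathtt{try}$ frame with $n$ variables $x_1,\dots,x_n$ pops it and gives $e_2[x_1\mapsto v_1,\dots,x_n\mapsto v_n]$. $\langle\vec v\rangle$ on $\mathtt{case}\ \Box\ \mathtt{of}\ ps\ \mathtt{when}\ e^g\to e^b;\vec{cl}$ drops the first clause if $ps$ does not match pairwise; if it matches with bindings $\mu$, it gives the frame $\mathtt{case}\ \langle\vec v\rangle\ \mathtt{of}\ ps\ \mathtt{when}\ \Box\to e^b[\mu];\vec{cl}$ with $e^g[\mu]$. There $\langle\mathtt{true}\rangle$ pops the frame and gives the body, and $\langle\mathtt{false}\rangle$ gives $\mathtt{case}\ \Box\ \mathtt{of}\ \vec{cl}$ with $\langle\vec v\rangle$. With no clause left, the frame is popped with $\{\mathtt{error},\mathtt{if\_clause},\{\}\}^X$.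 - $\{c,v_r,v_d\}^X$ on a $\mathtt{try}$ frame with exactly three catch variables $y_1,y_2,y_3$ pops it and gives $e_3[y_1\mapsto c,y_2\mapsto v_r,y_3\mapsto v_d]$; on any frame other than $\mathtt{try}$ frames it pops the frame. Here $eval(tuple,\vec v)=\langle\{\vec v\}\rangle$; $eval(values,\vec v)=\langle\vec v\rangle$; $eval(map,\vec v)$, for an even number of values, is the singleton of the map with the given associations (of several associations with equal keys the last one is kept, keys in term order); $eval(app(clos(ext,[x_1,\dots,x_n],e)),v_1,\dots,v_n)=e[mk(ext),x_1\mapsto v_1,\dots,x_n\mapsto v_n]$, and an application of another value or with another number of arguments gives an error exception; $eval(call(m,f),\vec v)$ and $eval(primop(a),\vec v)$ are given by a fixed set of Erlang built-in functions and primitive operations (integer arithmetic, Boolean connectives, equality, term order, lists, tuples, type tests, raising of exceptions), where equality and the term order compare closures by arity only, and unknown or wrong calls give error exceptions. Write $\langle K,r\rangle\Downarrow^n$ if $\langle K,r\rangle$ reduces in exactly $n$ steps to $\langle\varepsilon,res\rangle$ for a result $res$ and the empty stack $\varepsilon$, and $\langle K,r\rangle\Downarrow$ if this holds for some $n$. **Logical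 relations.** For $n\in\mathbb N$, the following relations between closed expressions ($\mathbb E_n$), frame stacks ($\mathbb K_n$), values ($\mathbb V_n$), exceptions ($\mathbb X_n$) and redexes ($\mathbb R_n$) are defined by mutual recursion. - $(e_1,e_2)\in\mathbb E_n$ iff for all $m\le n$ and $(K_1,K_2)\in\mathbb K_m$: $\langle K_1,e_1\rangle\Downarrow^m$ implies $\langle K_2,e_2\rangle\Downarrow$; and $(r_1,r_2)\in\mathbb R_n$ is the same condition for redexes. - $(K_1,K_2)\in\mathbb K_n$ iff for all $m\le n$: $\langle K_1,r_1\rangle\Downarrow^m$ implies $\langle K_2,r_2\rangle\Downarrow$ whenever $r_1,r_2$ are value sequences of the same length whose entries are pairwise in $\mathbb V_m$, or exceptions with $(r_1,r_2)\in\mathbb X_m$, or $r_1=r_2=\Box$. - $\mathbb V_n$ relates equal integers, equal atoms, $[\,]$ with $[\,]$, and list cells, tuples of the same size and maps of the same size componentwise. It relates $clos(ext,[x_1,\dots,x_l],e)$ and $clos(ext',[x_1',\dots,x_l'],e')$ iff for all $m<n$ and all $(v_1,v_1'),\dots,(v_l,v_l')\in\mathbb V_m$, $(e[mk(ext),x_1\mapsto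 v_1,\dots,x_l\mapsto v_l],\ e'[mk(ext'),x_1'\mapsto v_1',\dots,x_l'\mapsto v_l'])\in\mathbb E_m$. No other values are related. - $(\{c,v_r,v_d\}^X,\{c',v_r',v_d'\}^X)\in\mathbb X_n$ iff $c=c'$ and $(v_r,v_r'),(v_d,v_d')\in\mathbb V_n$. For a set $\Gamma$ of names, $(\sigma_1,\sigma_2)\in\mathbb G^\Gamma_n$ iff for all $x\in\Gamma$ the values $\sigma_1(x),\sigma_2(x)$ are closed and $(\sigma_1(x),\sigma_2(x))\in\mathbb V_n$. For $R\in\{\mathbb E,\mathbb V,\mathbb R\}$, $(t_1,t_2)\in R^\Gamma$ iff $(t_1[\sigma_1],t_2[\sigma_2])\in R_n$ for all $n$ and $(\sigma_1,\sigma_2)\in\mathbb G^\Gamma_n$. Finally $equiv\_ext(\Gamma,ext,ext')$ means that $ext$ and $ext'$ have the same length, and corresponding definitions have the same name and the same parameters $x_1,\dots,x_k$, and bodies $e,e'$ with $(e,e')\in\mathbb E^{\Gamma\cup names(ext)\cup\{x_1,\dots,x_k\}}$. **Theorem (Expression Compatibility).** For every set $\Gamma$ of names the following rules hold. *Expressions.*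 1. If $(e,e')\in\mathbb E^{\Gamma\cup\{x_1,\dots,x_n\}}$, then $(\mathtt{fun}(x_1,\dots,x_n)\to e,\ \mathtt{fun}(x_1,\dots,x_n)\to e')\in\mathbb E^\Gamma$. 2. If $(e_1,e_1'),(e_2,e_2')\in\mathbb E^\Gamma$, then $([e_1|e_2],[e_1'|e_2'])\in\mathbb E^\Gamma$. 3. If $(e,e'),(e_1,e_1'),\dots,(e_n,e_n')\in\mathbb E^\Gamma$, then $(\mathtt{apply}\ e(e_1,\dots,e_n),\ \mathtt{apply}\ e'(e_1',\dots,e_n'))\in\mathbb E^\Gamma$. 4. If $(e_m,e_m'),(e_f,e_f'),(e_1,e_1'),\dots,(e_n,e_n')\in\mathbb E^\Gamma$, then $(\mathtt{call}\ e_m{:}e_f(e_1,\dots,e_n),\ \mathtt{call}\ e_m'{:}e_f'(e_1',\dots,e_n'))\in\mathbb E^\Gamma$. 5. If $(e_i^k,e_i^{k\prime}),(e_i^v,e_i^{v\prime})\in\mathbb E^\Gamma$ for $1\le i\le n$, then the map expressions ${\sim}\{e_1^k\Rightarrow e_1^v,\dots,e_n^k\Rightarrow e_n^v\}{\sim}$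 and ${\sim}\{e_1^{k\prime}\Rightarrow e_1^{v\prime},\dots,e_n^{k\prime}\Rightarrow e_n^{v\prime}\}{\sim}$ are related by $\mathbb E^\Gamma$. 6. If $(e_1,e_1'),\dots,(e_n,e_n')\in\mathbb E^\Gamma$, then $(\{e_1,\dots,e_n\},\{e_1',\dots,e_n'\})\in\mathbb E^\Gamma$ and $(\langle e_1,\dots,e_n\rangle,\langle e_1',\dots,e_n'\rangle)\in\mathbb E^\Gamma$, and if moreover $a=a'$, then $(\mathtt{primop}\ a(e_1,\dots,e_n),\ \mathtt{primop}\ a'(e_1',\dots,e_n'))\in\mathbb E^\Gamma$. 7. If $(e,e')\in\mathbb E^{\Gamma\cup names(ext)}$ and $equiv\_ext(\Gamma,ext,ext')$, then $(\mathtt{letrec}\ ext\ \mathtt{in}\ e,\ \mathtt{letrec}\ ext'\ \mathtt{in}\ e')\in\mathbb E^\Gamma$. 8. If $(e_1,e_1')\in\mathbb E^\Gamma$ and $(e_2,e_2')\in\mathbb E^{\Gamma\cup\{x_1,\dots,x_n\}}$, then $(\mathtt{let}\ \langle x_1,\dots,x_n\rangle=e_1\ \mathtt{in}\ e_2,\ \mathtt{let}\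 \langle x_1,\dots,x_n\rangle=e_1'\ \mathtt{in}\ e_2')\in\mathbb E^\Gamma$. 9. If $(e_1,e_1'),(e_2,e_2')\in\mathbb E^\Gamma$, then $(\mathtt{do}\ e_1\ e_2,\ \mathtt{do}\ e_1'\ e_2')\in\mathbb E^\Gamma$. 10. If $(e,e')\in\mathbb E^\Gamma$ and $(e_i^g,e_i^{g\prime}),(e_i^b,e_i^{b\prime})\in\mathbb E^{\Gamma\cup vars(ps_i)}$ for $1\le i\le n$, then the expressions $\mathtt{case}\ e\ \mathtt{of}\ ps_1\ \mathtt{when}\ e_1^g\to e_1^b;\dots;ps_n\ \mathtt{when}\ e_n^g\to e_n^b\ \mathtt{end}$ and $\mathtt{case}\ e'\ \mathtt{of}\ ps_1\ \mathtt{when}\ e_1^{g\prime}\to e_1^{b\prime};\dots;ps_n\ \mathtt{when}\ e_n^{g\prime}\to e_n^{b\prime}\ \mathtt{end}$ are related by $\mathbb E^\Gamma$. 11. If $(e_1,e_1')\in\mathbb E^\Gamma$, $(e_2,e_2')\in\mathbb E^{\Gamma\cup\{x_1,\dots,x_k\}}$ and $(e_3,e_3')\in\mathbb E^{\Gamma\cup\{x_{k+1},\dots,x_{k+n}\}}$,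 then $\mathtt{try}\ e_1\ \mathtt{of}\ \langle x_1,\dots,x_k\rangle\to e_2\ \mathtt{catch}\ \langle x_{k+1},\dots,x_{k+n}\rangle\to e_3$ and $\mathtt{try}\ e_1'\ \mathtt{of}\ \langle x_1,\dots,x_k\rangle\to e_2'\ \mathtt{catch}\ \langle x_{k+1},\dots,x_{k+n}\rangle\to e_3'$ are related by $\mathbb E^\Gamma$. *Values, redexes and inclusions.* 12. $(x,x)\in\mathbb V^\Gamma$ for $x\in\Gamma$; $(f/k,f/k)\in\mathbb V^\Gamma$ for $f/k\in\Gamma$; $(a,a),(i,i),([\,],[\,])\in\mathbb V^\Gamma$ for all atoms $a$ and integers $i$. 13. If $(v_1,v_1'),(v_2,v_2')\in\mathbb V^\Gamma$, then $([v_1|v_2],[v_1'|v_2'])\in\mathbb V^\Gamma$. If $(v_1,v_1'),\dots,(v_n,v_n')\in\mathbb V^\Gamma$, then $(\{v_1,\dots,v_n\},\{v_1',\dots,v_n'\})\in\mathbb V^\Gamma$ and $(\langle v_1,\dots,v_n\rangle,\langle v_1',\dots,v_n'\rangle)\in\mathbb R^\Gamma$. If $(v_i^k,v_i^{k\prime}),(v_i^v,v_i^{v\prime})\in\mathbb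 V^\Gamma$ for $1\le i\le n$, then the map values ${\sim}\{v_1^k\Rightarrow v_1^v,\dots,v_n^k\Rightarrow v_n^v\}{\sim}$ and ${\sim}\{v_1^{k\prime}\Rightarrow v_1^{v\prime},\dots,v_n^{k\prime}\Rightarrow v_n^{v\prime}\}{\sim}$ are related by $\mathbb V^\Gamma$. 14. If $(e,e')\in\mathbb E^{\Gamma\cup names(ext)\cup\{x_1,\dots,x_n\}}$ and $equiv\_ext(\Gamma,ext,ext')$, then $(clos(ext,[x_1,\dots,x_n],e),\ clos(ext',[x_1,\dots,x_n],e'))\in\mathbb V^\Gamma$. 15. If $(v_r,v_r'),(v_d,v_d')\in\mathbb V^\Gamma$, then $(\{c,v_r,v_d\}^X,\{c,v_r',v_d'\}^X)\in\mathbb R^\Gamma$ for every class $c$. 16. If $(v,v')\in\mathbb V^\Gamma$ for values $v,v'$, then $(v,v')\in\mathbb E^\Gamma$. 17. For expressions $e,e'$: if $(e,e')\in\mathbb R^\Gamma$, then $(e,e')\in\mathbb E^\Gamma$; and if $(e,e')\in\mathbb E^\Gamma$, then $(e,e')\in\mathbb R^\Gamma$. -/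

import Mathlib

namespace CoreErlang

/-! ## Syntax -/

/-- Atoms, given by their text. -/
structure Atom where
  text : List Char
deriving DecidableEq

/-- Variables. -/
abbrev Var := String

/-- Names: variables `x` and function identifiers `f/k`. -/
inductive Name where
  | var (x : Var)
  | fid (f : Atom) (k : ℕ)
deriving DecidableEq

/-- Patterns. -/
inductive Pat where
  | int (i : ℤ)
  | atom (a : Atom)
  | var (x : Var)
  | cons (p₁ p₂ : Pat)
  | nil
  | tuple (ps : List Pat)
  | map (items : List (Pat × Pat))

mutual
/-- Expressions. -/
inductive Exp where
  | nonval (n : NonVal)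
  | val (v : Val)
/-- Values; names and (open) closures are values. -/
inductive Val where
  | int (i : ℤ)
  | atom (a : Atom)
  | var (x : Var)
  | fid (f : Atom) (k : ℕ)
  | clos (ext : List ClosItem) (xs : List Var) (e : Exp)
  | cons (v₁ v₂ : Val)
  | nil
  | tuple (vs : List Val)
  | map (items : List (Val × Val))
/-- Expressions that are not values. -/
inductive NonVal where
  /-- `fun(x₁, …, xₙ) → e` -/
  | lam (xs : List Var) (e : Exp)
  /-- the value list `<e₁, …, eₙ>` -/
  | values (es : List Exp)
  /-- `[e₁|e₂]` -/
  | cons (e₁ e₂ : Exp)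
  /-- `{e₁, …, eₙ}` -/
  | tuple (es : List Exp)
  /-- the map expression `~{k₁ ⇒ v₁, …, kₙ ⇒ vₙ}~` -/
  | map (items : List (Exp × Exp))
  /-- `call em:ef(e₁, …, eₙ)` -/
  | call (em ef : Exp) (es : List Exp)
  /-- `primop a(e₁, …, eₙ)` -/
  | primop (a : Atom) (es : List Exp)
  /-- `apply e(e₁, …, eₙ)` -/
  | app (e : Exp) (es : List Exp)
  /-- `case e of cl₁; …; clₙ end` -/
  | case (e : Exp) (cls : List Clause)
  /-- `let <x₁, …, xₙ> = e₁ in e₂` -/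
  | elet (xs : List Var) (e₁ e₂ : Exp)
  /-- `do e₁ e₂` -/
  | seq (e₁ e₂ : Exp)
  /-- `letrec ext in e` -/
  | letrec (ext : List ClosItem) (e : Exp)
  /-- `try e₁ of <xs> → e₂ catch <ys> → e₃` -/
  | etry (e₁ : Exp) (xs : List Var) (e₂ : Exp) (ys : List Var) (e₃ : Exp)
/-- A function definition `f/k = fun(x₁, …, xₖ) → e`; the arity `k` is the number of parameters. -/
inductive ClosItem where
  | mk (f : Atom) (xs : List Var) (e : Exp)
/-- A clause `ps when g → b`. -/
inductive Clause where
  | mk (ps : List Pat) (g b : Exp)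
end

/-- Exception classes. -/
inductive ExcClass where
  | throw
  | exit
  | error

/-- Exceptions `{c, vr, vd}ˣ`. -/
structure Exc where
  cls : ExcClass
  reason : Val
  details : Val

/-- Redexes: value sequences, exceptions, expressions and the hole. -/
inductive Redex where
  | vals (vs : List Val)
  | exc (x : Exc)
  | exp (e : Exp)
  | box

/-- Results: the redexes that are value sequences or exceptions. -/
def Redex.IsResult : Redex → Prop
  | .vals _ => True
  | .exc _ => True
  | _ => False

/-- A name, as a value. -/
def Name.toVal : Name → Val
  | .var x => .var x
  | .fid f k => .fid f k

namespace ClosItem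
def fname : ClosItem → Atom | .mk f _ _ => f
def params : ClosItem → List Var | .mk _ xs _ => xs
def body : ClosItem → Exp | .mk _ _ e => e
/-- The function identifier `f/k` that is bound by a definition. -/
def name (c : ClosItem) : Name := .fid c.fname c.params.length
end ClosItem

namespace Clause
def pats : Clause → List Pat | .mk ps _ _ => ps
def guard : Clause → Exp | .mk _ g _ => g
def body : Clause → Exp | .mk _ _ b => b
end Clause

/-! ## Free names and scoping -/

/-- The set of the names `x₁, …, xₙ`. -/
def varNames (xs : List Var) : Set Name := {n | ∃ x ∈ xs, n = .var x}

/-- The set of function identifiers that are bound by a list of function definitions. -/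
def namesOf (ext : List ClosItem) : Set Name := {n | ∃ c ∈ ext, n = c.name}

mutual
/-- The set of variables of a pattern. -/
def Pat.vars : Pat → Set Name
  | .int _ => ∅
  | .atom _ => ∅
  | .var x => {.var x}
  | .cons p₁ p₂ => p₁.vars ∪ p₂.vars
  | .nil => ∅
  | .tuple ps => Pat.varsList ps
  | .map items => Pat.varsItems items
/-- The set of variables of a list of patterns. -/
def Pat.varsList : List Pat → Set Name
  | [] => ∅
  | p :: ps => p.vars ∪ Pat.varsList ps
def Pat.varsItems : List (Pat × Pat) → Set Name
  | [] => ∅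
  | (p, q) :: l => p.vars ∪ q.vars ∪ Pat.varsItems l
end

mutual
/-- Free names of an expression. -/
def Exp.fv : Exp → Set Name
  | .nonval n => n.fv
  | .val v => v.fv
/-- Free names of a value. -/
def Val.fv : Val → Set Name
  | .int _ => ∅
  | .atom _ => ∅
  | .var x => {.var x}
  | .fid f k => {.fid f k}
  | .clos ext xs e => (ClosItem.fvList ext ∪ (e.fv \ varNames xs)) \ namesOf ext
  | .cons v₁ v₂ => v₁.fv ∪ v₂.fv
  | .nil => ∅
  | .tuple vs => Val.fvList vs
  | .map items => Val.fvItems items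
def NonVal.fv : NonVal → Set Name
  | .lam xs e => e.fv \ varNames xs
  | .values es => Exp.fvList es
  | .cons e₁ e₂ => e₁.fv ∪ e₂.fv
  | .tuple es => Exp.fvList es
  | .map items => Exp.fvItems items
  | .call em ef es => em.fv ∪ ef.fv ∪ Exp.fvList es
  | .primop _ es => Exp.fvList es
  | .app e es => e.fv ∪ Exp.fvList es
  | .case e cls => e.fv ∪ Clause.fvList cls
  | .elet xs e₁ e₂ => e₁.fv ∪ (e₂.fv \ varNames xs)
  | .seq e₁ e₂ => e₁.fv ∪ e₂.fv
  | .letrec ext e => (ClosItem.fvList ext ∪ e.fv) \ namesOf ext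
  | .etry e₁ xs e₂ ys e₃ => e₁.fv ∪ (e₂.fv \ varNames xs) ∪ (e₃.fv \ varNames ys)
def ClosItem.fv : ClosItem → Set Name
  | .mk _ xs e => e.fv \ varNames xs
def Clause.fv : Clause → Set Name
  | .mk ps g b => (g.fv ∪ b.fv) \ Pat.varsList ps
def Exp.fvList : List Exp → Set Name
  | [] => ∅
  | e :: es => e.fv ∪ Exp.fvList es
def Exp.fvItems : List (Exp × Exp) → Set Name
  | [] => ∅
  | (a, b) :: l => a.fv ∪ b.fv ∪ Exp.fvItems l
def Val.fvList : List Val → Set Name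
  | [] => ∅
  | v :: vs => v.fv ∪ Val.fvList vs
def Val.fvItems : List (Val × Val) → Set Name
  | [] => ∅
  | (a, b) :: l => a.fv ∪ b.fv ∪ Val.fvItems l
def ClosItem.fvList : List ClosItem → Set Name
  | [] => ∅
  | c :: cs => c.fv ∪ ClosItem.fvList cs
def Clause.fvList : List Clause → Set Name
  | [] => ∅
  | c :: cs => c.fv ∪ Clause.fvList cs
end

def Exc.fv (x : Exc) : Set Name := x.reason.fv ∪ x.details.fv

def Redex.fv : Redex → Set Name
  | .vals vs => Val.fvList vs
  | .exc x => x.fv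
  | .exp e => e.fv
  | .box => ∅

/-- A value is closed if it has no free names. -/
def Val.Closed (v : Val) : Prop := v.fv = ∅
def Exp.Closed (e : Exp) : Prop := e.fv = ∅
def Exc.Closed (x : Exc) : Prop := x.fv = ∅
def Redex.Closed (r : Redex) : Prop := r.fv = ∅

/-! ## Capture-avoiding parallel substitution -/

/-- Parallel substitutions map names to values. -/
abbrev Subst := Name → Val

/-- A renaming of bound names: variables become variables, and function identifiers keep their
arity. -/
structure Renaming where
  onVar : Var → Var
  onFid : Atom → ℕ → Atom

namespace Renaming
protected def id : Renaming := ⟨fun x => x, fun f _ => f⟩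
instance : Inhabited Renaming := ⟨Renaming.id⟩
def app (ρ : Renaming) : Name → Name
  | .var x => .var (ρ.onVar x)
  | .fid f k => .fid (ρ.onFid f k) k
end Renaming

/-- Renaming the binders in `B` by `ρ` is safe for the application of `σ` to a body with the free
names `F`: binders stay apart, and no free name of a value that `σ` inserts is captured. -/
def Renaming.Safe (σ : Subst) (B F : Set Name) (ρ : Renaming) : Prop :=
  Set.InjOn ρ.app B ∧ ∀ y ∈ F \ B, ∀ z ∈ (σ y).fv, z ∉ ρ.app '' B

open Classical in
/-- The renaming of the binders in `B` that is used when `σ` goes under them: no renaming, unless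
this would capture a name. -/
noncomputable def Subst.renaming (σ : Subst) (B F : Set Name) : Renaming :=
  if Renaming.id.Safe σ B F then Renaming.id else Classical.epsilon (Renaming.Safe σ B F)

open Classical in
/-- The substitution `σ` below the binders in `B`, renamed by `ρ`. -/
noncomputable def Subst.under (σ : Subst) (B : Set Name) (ρ : Renaming) : Subst :=
  fun n => if n ∈ B then (ρ.app n).toVal else σ n

mutual
/-- Renaming of the variables of a pattern. -/
def Pat.rename (ρ : Renaming) : Pat → Pat
  | .int i => .int i
  | .atom a => .atom a
  | .var x => .var (ρ.onVar x)
  | .cons p₁ p₂ => .cons (p₁.rename ρ) (p₂.rename ρ)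
  | .nil => .nil
  | .tuple ps => .tuple (Pat.renameList ρ ps)
  | .map items => .map (Pat.renameItems ρ items)
def Pat.renameList (ρ : Renaming) : List Pat → List Pat
  | [] => []
  | p :: ps => p.rename ρ :: Pat.renameList ρ ps
def Pat.renameItems (ρ : Renaming) : List (Pat × Pat) → List (Pat × Pat)
  | [] => []
  | (p, q) :: l => (p.rename ρ, q.rename ρ) :: Pat.renameItems ρ l
end

mutual
/-- `e[σ]` -/
noncomputable def Exp.subst (σ : Subst) : Exp → Exp
  | .nonval n => .nonval (n.subst σ)
  | .val v => .val (v.subst σ)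
/-- `v[σ]` -/
noncomputable def Val.subst (σ : Subst) : Val → Val
  | .int i => .int i
  | .atom a => .atom a
  | .var x => σ (.var x)
  | .fid f k => σ (.fid f k)
  | .clos ext xs e =>
      let ρ := σ.renaming (namesOf ext) (ClosItem.fvList ext ∪ (e.fv \ varNames xs))
      let σ' := σ.under (namesOf ext) ρ
      let ρ' := σ'.renaming (varNames xs) e.fv
      .clos (ClosItem.substList ρ σ' ext) (xs.map ρ'.onVar) (e.subst (σ'.under (varNames xs) ρ'))
  | .cons v₁ v₂ => .cons (v₁.subst σ) (v₂.subst σ)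
  | .nil => .nil
  | .tuple vs => .tuple (Val.substList σ vs)
  | .map items => .map (Val.substItems σ items)
noncomputable def NonVal.subst (σ : Subst) : NonVal → NonVal
  | .lam xs e =>
      let ρ := σ.renaming (varNames xs) e.fv
      .lam (xs.map ρ.onVar) (e.subst (σ.under (varNames xs) ρ))
  | .values es => .values (Exp.substList σ es)
  | .cons e₁ e₂ => .cons (e₁.subst σ) (e₂.subst σ)
  | .tuple es => .tuple (Exp.substList σ es)
  | .map items => .map (Exp.substItems σ items)
  | .call em ef es => .call (em.subst σ) (ef.subst σ) (Exp.substList σ es)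
  | .primop a es => .primop a (Exp.substList σ es)
  | .app e es => .app (e.subst σ) (Exp.substList σ es)
  | .case e cls => .case (e.subst σ) (Clause.substList σ cls)
  | .elet xs e₁ e₂ =>
      let ρ := σ.renaming (varNames xs) e₂.fv
      .elet (xs.map ρ.onVar) (e₁.subst σ) (e₂.subst (σ.under (varNames xs) ρ))
  | .seq e₁ e₂ => .seq (e₁.subst σ) (e₂.subst σ)
  | .letrec ext e =>
      let ρ := σ.renaming (namesOf ext) (ClosItem.fvList ext ∪ e.fv)
      let σ' := σ.under (namesOf ext) ρ
      .letrec (ClosItem.substList ρ σ' ext) (e.subst σ')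
  | .etry e₁ xs e₂ ys e₃ =>
      let ρ := σ.renaming (varNames xs) e₂.fv
      let ρ' := σ.renaming (varNames ys) e₃.fv
      .etry (e₁.subst σ) (xs.map ρ.onVar) (e₂.subst (σ.under (varNames xs) ρ))
        (ys.map ρ'.onVar) (e₃.subst (σ.under (varNames ys) ρ'))
/-- A definition of a recursive collection: its identifier is renamed by `τ`, and `σ` is applied to
its function. -/
noncomputable def ClosItem.subst (τ : Renaming) (σ : Subst) : ClosItem → ClosItem
  | .mk f xs e =>
      let ρ := σ.renaming (varNames xs) e.fv
      .mk (τ.onFid f xs.length) (xs.map ρ.onVar) (e.subst (σ.under (varNames xs) ρ))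
noncomputable def Clause.subst (σ : Subst) : Clause → Clause
  | .mk ps g b =>
      let ρ := σ.renaming (Pat.varsList ps) (g.fv ∪ b.fv)
      .mk (Pat.renameList ρ ps) (g.subst (σ.under (Pat.varsList ps) ρ))
        (b.subst (σ.under (Pat.varsList ps) ρ))
noncomputable def Exp.substList (σ : Subst) : List Exp → List Exp
  | [] => []
  | e :: es => e.subst σ :: Exp.substList σ es
noncomputable def Exp.substItems (σ : Subst) : List (Exp × Exp) → List (Exp × Exp)
  | [] => []
  | (a, b) :: l => (a.subst σ, b.subst σ) :: Exp.substItems σ l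
noncomputable def Val.substList (σ : Subst) : List Val → List Val
  | [] => []
  | v :: vs => v.subst σ :: Val.substList σ vs
noncomputable def Val.substItems (σ : Subst) : List (Val × Val) → List (Val × Val)
  | [] => []
  | (a, b) :: l => (a.subst σ, b.subst σ) :: Val.substItems σ l
noncomputable def ClosItem.substList (τ : Renaming) (σ : Subst) : List ClosItem → List ClosItem
  | [] => []
  | c :: cs => c.subst τ σ :: ClosItem.substList τ σ cs
noncomputable def Clause.substList (σ : Subst) : List Clause → List Clause
  | [] => []
  | c :: cs => c.subst σ :: Clause.substList σ cs
end

noncomputable def Exc.subst (σ : Subst) (x : Exc) : Exc :=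
  ⟨x.cls, x.reason.subst σ, x.details.subst σ⟩

noncomputable def Redex.subst (σ : Subst) : Redex → Redex
  | .vals vs => .vals (Val.substList σ vs)
  | .exc x => .exc (x.subst σ)
  | .exp e => .exp (e.subst σ)
  | .box => .box

/-- The substitution `n₁ ↦ v₁, …, nₖ ↦ vₖ`; every other name stays as it is. -/
def Subst.ofList (l : List (Name × Val)) : Subst := fun n => (l.lookup n).getD n.toVal

/-- The bindings `x₁ ↦ v₁, …, xₙ ↦ vₙ`. -/
def bindVars (xs : List Var) (vs : List Val) : List (Name × Val) := (xs.map Name.var).zip vs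

/-- Every definition of the collection, as the binding of its identifier to a closure that carries
the whole collection. -/
def mkClosList (ext : List ClosItem) : List (Name × Val) :=
  ext.map fun c => (c.name, .clos ext c.params c.body)

/-! ## Pattern matching -/

mutual
/-- The variable bindings of a successful match; `none` if the value does not match. -/
def Pat.bindings : Pat → Val → Option (List (Name × Val))
  | .int i, v => match v with
    | .int j => if i = j then some [] else none
    | _ => none
  | .atom a, v => match v with
    | .atom b => if a = b then some [] else none
    | _ => none
  | .var x, v => some [(.var x, v)]
  | .cons p₁ p₂, v => match v with
    | .cons v₁ v₂ => do return (← p₁.bindings v₁) ++ (← p₂.bindings v₂)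
    | _ => none
  | .nil, v => match v with
    | .nil => some []
    | _ => none
  | .tuple ps, v => match v with
    | .tuple vs => Pat.bindingsList ps vs
    | _ => none
  | .map items, v => match v with
    | .map vs => Pat.bindingsItems items vs
    | _ => none
/-- Pairwise matching of a list of patterns with a value sequence. -/
def Pat.bindingsList : List Pat → List Val → Option (List (Name × Val))
  | [], vs => match vs with
    | [] => some []
    | _ => none
  | p :: ps, vs => match vs with
    | v :: vs => do return (← p.bindings v) ++ (← Pat.bindingsList ps vs)
    | _ => none
def Pat.bindingsItems : List (Pat × Pat) → List (Val × Val) → Option (List (Name × Val))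
  | [], vs => match vs with
    | [] => some []
    | _ => none
  | (p, q) :: ps, vs => match vs with
    | (v, w) :: vs => do
        return (← p.bindings v) ++ (← q.bindings w) ++ (← Pat.bindingsItems ps vs)
    | _ => none
end

/-! ## Built-in functions and primitive operations -/

/-- The letters of the atoms below. -/
def ch (i : ℕ) : Char := Char.ofNat (97 + i)

namespace Letter
def a := ch 0
def b := ch 1
def c := ch 2
def d := ch 3
def e := ch 4
def f := ch 5
def g := ch 6
def h := ch 7
def i := ch 8
def l := ch 11
def m := ch 12
def n := ch 13
def o := ch 14
def p := ch 15
def q := ch 16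
def r := ch 17
def s := ch 18
def t := ch 19
def u := ch 20
def v := ch 21
def w := ch 22
def x := ch 23
def y := ch 24
def z := ch 25
/-- underscore -/
def us := Char.ofNat 95
def plus := Char.ofNat 43
def minus := Char.ofNat 45
def star := Char.ofNat 42
def slash := Char.ofNat 47
def colon := Char.ofNat 58
def lt := Char.ofNat 60
def eq := Char.ofNat 61
def gt := Char.ofNat 62
end Letter

namespace Atom
open Letter
def true : Atom := ⟨[t, r, u, e]⟩
def false : Atom := ⟨[f, a, l, s, e]⟩
def throw : Atom := ⟨[t, h, r, o, w]⟩
def exit : Atom := ⟨[e, x, i, t]⟩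
def error : Atom := ⟨[e, r, r, o, r]⟩
def ifClause : Atom := ⟨[i, f, us, c, l, a, u, s, e]⟩
def badarg : Atom := ⟨[b, a, d, a, r, g]⟩
def badarith : Atom := ⟨[b, a, d, a, r, i, t, h]⟩
def badfun : Atom := ⟨[b, a, d, f, u, n]⟩
def badarity : Atom := ⟨[b, a, d, a, r, i, t, y]⟩
def undef : Atom := ⟨[u, n, d, e, f]⟩
def matchFail : Atom := ⟨[m, a, t, c, h, us, f, a, i, l]⟩
def raise : Atom := ⟨[r, a, i, s, e]⟩
def erlang : Atom := ⟨[e, r, l, a, n, g]⟩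
def add : Atom := ⟨[plus]⟩
def sub : Atom := ⟨[minus]⟩
def mul : Atom := ⟨[star]⟩
def div : Atom := ⟨[d, i, v]⟩
def rem : Atom := ⟨[r, e, m]⟩
def bsl : Atom := ⟨[b, s, l]⟩
def bsr : Atom := ⟨[b, s, r]⟩
def abs : Atom := ⟨[a, b, s]⟩
def and : Atom := ⟨[a, n, d]⟩
def or : Atom := ⟨[o, r]⟩
def xor : Atom := ⟨[x, o, r]⟩
def not : Atom := ⟨[n, o, t]⟩
def equal : Atom := ⟨[eq, eq]⟩
def exactEqual : Atom := ⟨[eq, colon, eq]⟩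
def notEqual : Atom := ⟨[slash, eq]⟩
def exactNotEqual : Atom := ⟨[eq, slash, eq]⟩
def less : Atom := ⟨[lt]⟩
def lessEqual : Atom := ⟨[eq, lt]⟩
def greater : Atom := ⟨[gt]⟩
def greaterEqual : Atom := ⟨[gt, eq]⟩
def append : Atom := ⟨[plus, plus]⟩
def subtract : Atom := ⟨[minus, minus]⟩
def tupleToList : Atom := ⟨[t, u, p, l, e, us, t, o, us, l, i, s, t]⟩
def listToTuple : Atom := ⟨[l, i, s, t, us, t, o, us, t, u, p, l, e]⟩
def length : Atom := ⟨[l, e, n, g, t, h]⟩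
def tupleSize : Atom := ⟨[t, u, p, l, e, us, s, i, z, e]⟩
def hd : Atom := ⟨[h, d]⟩
def tl : Atom := ⟨[t, l]⟩
def element : Atom := ⟨[e, l, e, m, e, n, t]⟩
def setelement : Atom := ⟨[s, e, t, e, l, e, m, e, n, t]⟩
def isNumber : Atom := ⟨[i, s, us, n, u, m, b, e, r]⟩
def isInteger : Atom := ⟨[i, s, us, i, n, t, e, g, e, r]⟩
def isAtom : Atom := ⟨[i, s, us, a, t, o, m]⟩
def isBoolean : Atom := ⟨[i, s, us, b, o, o, l, e, a, n]⟩
def isList : Atom := ⟨[i, s, us, l, i, s, t]⟩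
def isTuple : Atom := ⟨[i, s, us, t, u, p, l, e]⟩
def isMap : Atom := ⟨[i, s, us, m, a, p]⟩
def isFunction : Atom := ⟨[i, s, us, f, u, n, c, t, i, o, n]⟩
end Atom

/-- The class of an exception, as an atom. -/
def ExcClass.toAtom : ExcClass → Atom
  | .throw => .throw
  | .exit => .exit
  | .error => .error

/-- The exception of class `error` with a reason that is an atom. -/
def errorExc (a : Atom) (details : Val) : Exc := ⟨.error, .atom a, details⟩

/-- Position of the kinds of values in the term order: numbers, atoms, functions, tuples, maps, the
empty list, non-empty lists. (Names come last; they do not occur in evaluated values.) -/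
def Val.rank : Val → ℕ
  | .int _ => 0
  | .atom _ => 1
  | .clos .. => 2
  | .tuple _ => 3
  | .map _ => 4
  | .nil => 5
  | .cons .. => 6
  | .var _ => 7
  | .fid .. => 8

def charCodes (l : List Char) : List ℕ := l.map Char.toNat

mutual
/-- The term order on values. Functions are compared by their arity only: the language has no means
to look into a function. Tuples and maps are compared by size first, then maps by their keys, then by
their values. -/
def Val.cmp : Val → Val → Ordering
  | .int i, w => match w with
    | .int j => compare i j
    | w => compare 0 w.rank
  | .atom a, w => match w with
    | .atom b => compare (charCodes a.text) (charCodes b.text)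
    | w => compare 1 w.rank
  | .clos _ xs _, w => match w with
    | .clos _ ys _ => compare xs.length ys.length
    | w => compare 2 w.rank
  | .tuple vs, w => match w with
    | .tuple ws => (compare vs.length ws.length).then (Val.cmpList vs ws)
    | w => compare 3 w.rank
  | .map l, w => match w with
    | .map l' =>
        ((compare l.length l'.length).then (Val.cmpKeys l l')).then (Val.cmpValues l l')
    | w => compare 4 w.rank
  | .nil, w => compare 5 w.rank
  | .cons v₁ v₂, w => match w with
    | .cons w₁ w₂ => (v₁.cmp w₁).then (v₂.cmp w₂)
    | w => compare 6 w.rank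
  | .var x, w => match w with
    | .var y => compare x y
    | w => compare 7 w.rank
  | .fid f k, w => match w with
    | .fid g j => (compare (charCodes f.text) (charCodes g.text)).then (compare k j)
    | w => compare 8 w.rank
def Val.cmpList : List Val → List Val → Ordering
  | [], _ => .eq
  | v :: vs, ws => match ws with
    | [] => .eq
    | w :: ws => (v.cmp w).then (Val.cmpList vs ws)
def Val.cmpKeys : List (Val × Val) → List (Val × Val) → Ordering
  | [], _ => .eq
  | (v, _) :: vs, ws => match ws with
    | [] => .eq
    | (w, _) :: ws => (v.cmp w).then (Val.cmpKeys vs ws)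
def Val.cmpValues : List (Val × Val) → List (Val × Val) → Ordering
  | [], _ => .eq
  | (_, v) :: vs, ws => match ws with
    | [] => .eq
    | (_, w) :: ws => (v.cmp w).then (Val.cmpValues vs ws)
end

/-- Built-in equality. -/
def Val.eqb (v w : Val) : Bool := v.cmp w == .eq

/-- Insertion into a map, whose keys are kept in increasing order; a present key is kept. -/
def mapInsert (k v : Val) : List (Val × Val) → List (Val × Val)
  | [] => [(k, v)]
  | (k', v') :: l => match k.cmp k' with
    | .lt => (k, v) :: (k', v') :: l
    | .eq => (k', v') :: l
    | .gt => (k', v') :: mapInsert k v l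

/-- The map with the given associations: keys are put into increasing order, so that a map has one
representation, and of several associations with equal keys the last one counts. -/
def mkMap : List (Val × Val) → List (Val × Val)
  | [] => []
  | (k, v) :: l => mapInsert k v (mkMap l)

/-- `v₁, v₂, v₃, v₄, …` as `(v₁, v₂), (v₃, v₄), …`; `none` if the length is odd. -/
def toPairs : List Val → Option (List (Val × Val))
  | [] => some []
  | [_] => none
  | k :: v :: l => (toPairs l).map ((k, v) :: ·)

/-- The elements of a proper list. -/
def Val.elems : Val → Option (List Val)
  | .nil => some []
  | .cons v w => w.elems.map (v :: ·)
  | _ => none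

/-- The list with the elements `vs` and the tail `w`. -/
def Val.ofElems (vs : List Val) (w : Val) : Val := vs.foldr .cons w

def Val.ofBool (b : Bool) : Val := .atom (if b then .true else .false)

def Val.toBool : Val → Option Bool
  | .atom a => if a = .true then some true else if a = .false then some false else none
  | _ => none

/-- `vs` without the first element that equals `w`. -/
def removeFirst (w : Val) : List Val → List Val
  | [] => []
  | v :: vs => if v.eqb w then vs else v :: removeFirst w vs

/-- A single value, or the exception `{error, a, {f, args}}ˣ` if there is none. -/
def resultOr (a f : Atom) (args : List Val) : Option Val → Redex
  | some v => .vals [v]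
  | none => .exc (errorExc a (.tuple (.atom f :: args)))

/-- The exception for a call of an unknown function. -/
def undefCall (f : Atom) : Redex := .exc (errorExc .undef (.atom f))

/-- Integer operations. -/
def arith (f : Atom) (op : ℤ → ℤ → Option ℤ) (v w : Val) : Redex :=
  resultOr .badarith f [v, w] <| match v, w with
    | .int i, .int j => (op i j).map .int
    | _, _ => none

/-- Arithmetic shift to the left by `j` bits (to the right if `j` is negative). -/
def shiftL (i j : ℤ) : ℤ := if 0 ≤ j then i * 2 ^ j.toNat else i / 2 ^ (-j).toNat

def boolOp (f : Atom) (op : Bool → Bool → Bool) (v w : Val) : Redex :=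
  resultOr .badarg f [v, w] <| match v.toBool, w.toBool with
    | some a, some b => some (.ofBool (op a b))
    | _, _ => none

/-- A value sequence with a single truth value. -/
def truth (b : Bool) : Redex := .vals [.ofBool b]

/-- Unary functions of the module `erlang`. -/
def evalBif1 (f : Atom) (v : Val) : Redex :=
  if f = .abs then
    resultOr .badarg f [v] (match v with | .int i => some (.int |i|) | _ => none)
  else if f = .sub then
    resultOr .badarith f [v] (match v with | .int i => some (.int (-i)) | _ => none)
  else if f = .add then
    resultOr .badarith f [v] (match v with | .int i => some (.int i) | _ => none)
  else if f = .not then resultOr .badarg f [v] (v.toBool.map fun b => .ofBool (!b))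
  else if f = .tupleToList then
    resultOr .badarg f [v] (match v with | .tuple vs => some (.ofElems vs .nil) | _ => none)
  else if f = .listToTuple then resultOr .badarg f [v] (v.elems.map .tuple)
  else if f = .length then resultOr .badarg f [v] (v.elems.map fun vs => .int vs.length)
  else if f = .tupleSize then
    resultOr .badarg f [v] (match v with | .tuple vs => some (.int vs.length) | _ => none)
  else if f = .hd then
    resultOr .badarg f [v] (match v with | .cons v₁ _ => some v₁ | _ => none)
  else if f = .tl then
    resultOr .badarg f [v] (match v with | .cons _ v₂ => some v₂ | _ => none)
  else if f = .isNumber ∨ f = .isInteger then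
    truth (match v with | .int _ => true | _ => false)
  else if f = .isAtom then truth (match v with | .atom _ => true | _ => false)
  else if f = .isBoolean then truth v.toBool.isSome
  else if f = .isList then truth (match v with | .nil => true | .cons .. => true | _ => false)
  else if f = .isTuple then truth (match v with | .tuple _ => true | _ => false)
  else if f = .isMap then truth (match v with | .map _ => true | _ => false)
  else if f = .isFunction then truth (match v with | .clos .. => true | _ => false)
  else if f = .error then .exc ⟨.error, v, .nil⟩
  else if f = .exit then .exc ⟨.exit, v, .nil⟩
  else if f = .throw then .exc ⟨.throw, v, .nil⟩
  else undefCall f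

/-- Binary functions of the module `erlang`. -/
def evalBif2 (f : Atom) (v w : Val) : Redex :=
  if f = .add then arith f (fun i j => some (i + j)) v w
  else if f = .sub then arith f (fun i j => some (i - j)) v w
  else if f = .mul then arith f (fun i j => some (i * j)) v w
  else if f = .div then arith f (fun i j => if j = 0 then none else some (i.tdiv j)) v w
  else if f = .rem then arith f (fun i j => if j = 0 then none else some (i.tmod j)) v w
  else if f = .bsl then arith f (fun i j => some (shiftL i j)) v w
  else if f = .bsr then arith f (fun i j => some (shiftL i (-j))) v w
  else if f = .and then boolOp f (fun a b => a && b) v w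
  else if f = .or then boolOp f (fun a b => a || b) v w
  else if f = .xor then boolOp f (fun a b => a ^^ b) v w
  else if f = .equal ∨ f = .exactEqual then truth (v.eqb w)
  else if f = .notEqual ∨ f = .exactNotEqual then truth (!v.eqb w)
  else if f = .less then truth (v.cmp w == .lt)
  else if f = .lessEqual then truth (v.cmp w != .gt)
  else if f = .greater then truth (v.cmp w == .gt)
  else if f = .greaterEqual then truth (v.cmp w != .lt)
  else if f = .append then resultOr .badarg f [v, w] (v.elems.map fun vs => .ofElems vs w)
  else if f = .subtract then
    resultOr .badarg f [v, w] (match v.elems, w.elems with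
      | some vs, some ws => some (.ofElems (ws.foldl (fun l x => removeFirst x l) vs) .nil)
      | _, _ => none)
  else if f = .element then
    resultOr .badarg f [v, w] (match v, w with
      | .int i, .tuple vs => if 1 ≤ i then vs[i.toNat - 1]? else none
      | _, _ => none)
  else if f = .isFunction then
    resultOr .badarg f [v, w] (match w with
      | .int j => if j < 0 then none else some (.ofBool (match v with
          | .clos _ xs _ => decide ((xs.length : ℤ) = j)
          | _ => false))
      | _ => none)
  else if f = .error then .exc ⟨.error, v, w⟩
  else undefCall f

/-- Ternary functions of the module `erlang`. -/
def evalBif3 (f : Atom) (u v w : Val) : Redex :=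
  if f = .setelement then
    resultOr .badarg f [u, v, w] (match u, v with
      | .int i, .tuple vs =>
          if 1 ≤ i ∧ i ≤ vs.length then some (.tuple (vs.set (i.toNat - 1) w)) else none
      | _, _ => none)
  else undefCall f

/-- Built-in functions. -/
def evalCall (m f : Atom) (vs : List Val) : Redex :=
  if m = .erlang then
    match vs with
    | [u] => evalBif1 f u
    | [u, v] => evalBif2 f u v
    | [u, v, w] => evalBif3 f u v w
    | _ => undefCall f
  else undefCall f

/-- Primitive operations. -/
def evalPrimop (a : Atom) (vs : List Val) : Redex :=
  match vs with
  | [v] => if a = .matchFail then .exc ⟨.error, v, .nil⟩ else undefCall a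
  | [v, w] => if a = .raise then .exc ⟨.error, w, v⟩ else undefCall a
  | _ => undefCall a

/-! ## Frame stack semantics -/

/-- Identifiers of parameter list frames. -/
inductive FrameId where
  | tuple
  | values
  | call (vm vf : Val)
  | primop (a : Atom)
  | map
  | app (vf : Val)

/-- Frames; the hole is left implicit. -/
inductive Frame where
  /-- `id(v₁, …, vₖ, □, e₁, …, eₙ)` -/
  | params (id : FrameId) (vs : List Val) (es : List Exp)
  /-- `[e₁|□]` -/
  | consTail (e₁ : Exp)
  /-- `[□|v₂]` -/
  | consHead (v₂ : Val)
  /-- `call □:ef(e₁, …, eₙ)` -/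
  | callMod (ef : Exp) (es : List Exp)
  /-- `call vm:□(e₁, …, eₙ)` -/
  | callFun (vm : Val) (es : List Exp)
  /-- `apply □(e₁, …, eₙ)` -/
  | app (es : List Exp)
  /-- `case □ of cl₁; …; clₙ end` -/
  | case (cls : List Clause)
  /-- `case vs of ps when □ → b; cl₂; …; clₙ end`, where the match is already substituted in `b` -/
  | guard (vs : List Val) (ps : List Pat) (b : Exp) (cls : List Clause)
  /-- `let <xs> = □ in e₂` -/
  | elet (xs : List Var) (e₂ : Exp)
  /-- `do □ e₂` -/
  | seq (e₂ : Exp)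
  /-- `try □ of <xs> → e₂ catch <ys> → e₃` -/
  | etry (xs : List Var) (e₂ : Exp) (ys : List Var) (e₃ : Exp)

/-- Frame stacks; the head of the list is the top of the stack. -/
abbrev FrameStack := List Frame

def Frame.IsTry : Frame → Prop
  | .etry .. => True
  | _ => False

def FrameId.fv : FrameId → Set Name
  | .call vm vf => vm.fv ∪ vf.fv
  | .app vf => vf.fv
  | _ => ∅

/-- Free names of a frame. In a guard frame the pattern binds nothing, for the match is already
substituted. -/
def Frame.fv : Frame → Set Name
  | .params id vs es => id.fv ∪ Val.fvList vs ∪ Exp.fvList es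
  | .consTail e₁ => e₁.fv
  | .consHead v₂ => v₂.fv
  | .callMod ef es => ef.fv ∪ Exp.fvList es
  | .callFun vm es => vm.fv ∪ Exp.fvList es
  | .app es => Exp.fvList es
  | .case cls => Clause.fvList cls
  | .guard vs _ b cls => Val.fvList vs ∪ b.fv ∪ Clause.fvList cls
  | .elet xs e₂ => e₂.fv \ varNames xs
  | .seq e₂ => e₂.fv
  | .etry xs e₂ ys e₃ => (e₂.fv \ varNames xs) ∪ (e₃.fv \ varNames ys)

/-- A frame stack is closed if all of its frames are. -/
def ClosedStack (K : FrameStack) : Prop := ∀ F ∈ K, F.fv = ∅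

/-- The redex that results from a frame identifier and a list of values. It is undefined only for
maps, when a key comes without a value. -/
noncomputable def eval : FrameId → List Val → Option Redex
  | .tuple, vs => some (.vals [.tuple vs])
  | .values, vs => some (.vals vs)
  | .map, vs => (toPairs vs).map fun l => .vals [.map (mkMap l)]
  | .primop a, vs => some (evalPrimop a vs)
  | .call (.atom m) (.atom f), vs => some (evalCall m f vs)
  | .call vm vf, _ => some (.exc (errorExc .badfun (.tuple [vm, vf])))
  | .app (.clos ext xs e), vs =>
      if xs.length = vs.length then
        some (.exp (e.subst (.ofList (mkClosList ext ++ bindVars xs vs))))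
      else some (.exc (errorExc .badarity (.clos ext xs e)))
  | .app vf, _ => some (.exc (errorExc .badfun vf))

/-- One reduction step `⟨K, r⟩ ⟶ ⟨K', r'⟩`. -/
inductive Step : FrameStack → Redex → FrameStack → Redex → Prop
  -- deconstruction of an expression
  | sConsTail (K e₁ e₂) :
      Step K (.exp (.nonval (.cons e₁ e₂))) (.consTail e₁ :: K) (.exp e₂)
  | sLet (K xs e₁ e₂) :
      Step K (.exp (.nonval (.elet xs e₁ e₂))) (.elet xs e₂ :: K) (.exp e₁)
  | sSeq (K e₁ e₂) :
      Step K (.exp (.nonval (.seq e₁ e₂))) (.seq e₂ :: K) (.exp e₁)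
  | sApp (K e es) :
      Step K (.exp (.nonval (.app e es))) (.app es :: K) (.exp e)
  | sCallMod (K em ef es) :
      Step K (.exp (.nonval (.call em ef es))) (.callMod ef es :: K) (.exp em)
  | sPrimOp (K a es) :
      Step K (.exp (.nonval (.primop a es))) (.params (.primop a) [] es :: K) .box
  | sVals (K es) :
      Step K (.exp (.nonval (.values es))) (.params .values [] es :: K) .box
  | sTuple (K es) :
      Step K (.exp (.nonval (.tuple es))) (.params .tuple [] es :: K) .box
  | sMap (K ek ev) (items : List (Exp × Exp)) :
      Step K (.exp (.nonval (.map ((ek, ev) :: items))))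
        (.params .map [] (ev :: items.flatMap fun p => [p.1, p.2]) :: K) (.exp ek)
  | sCase (K e cls) :
      Step K (.exp (.nonval (.case e cls))) (.case cls :: K) (.exp e)
  | sTry (K e₁ xs e₂ ys e₃) :
      Step K (.exp (.nonval (.etry e₁ xs e₂ ys e₃))) (.etry xs e₂ ys e₃ :: K) (.exp e₁)
  -- modification of the top frame
  | sConsHead (K e₁ v₂) :
      Step (.consTail e₁ :: K) (.vals [v₂]) (.consHead v₂ :: K) (.exp e₁)
  | sCallFun (K ef es vm) :
      Step (.callMod ef es :: K) (.vals [vm]) (.callFun vm es :: K) (.exp ef)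
  | sCallParam (K vm es vf) :
      Step (.callFun vm es :: K) (.vals [vf]) (.params (.call vm vf) [] es :: K) .box
  | sAppParam (K es v) :
      Step (.app es :: K) (.vals [v]) (.params (.app v) [] es :: K) .box
  | sCaseFail (K ps g b cls vs) (h : Pat.bindingsList ps vs = none) :
      Step (.case (.mk ps g b :: cls) :: K) (.vals vs) (.case cls :: K) (.vals vs)
  | sCaseSuccess (K ps g b cls vs l) (h : Pat.bindingsList ps vs = some l) :
      Step (.case (.mk ps g b :: cls) :: K) (.vals vs)
        (.guard vs ps (b.subst (.ofList l)) cls :: K) (.exp (g.subst (.ofList l)))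
  | sCaseFalse (K vs ps b cls) :
      Step (.guard vs ps b cls :: K) (.vals [.atom .false]) (.case cls :: K) (.vals vs)
  | sParams₀ (K id e es) (h : id ≠ .map) :
      Step (.params id [] (e :: es) :: K) .box (.params id [] es :: K) (.exp e)
  | sParams (K id vs v e es) :
      Step (.params id vs (e :: es) :: K) (.vals [v]) (.params id (vs ++ [v]) es :: K) (.exp e)
  -- removal of the top frame, and reduction in place
  | pMap₀ (K) :
      Step K (.exp (.nonval (.map []))) K (.vals [.map []])
  | pFun (K xs e) :
      Step K (.exp (.nonval (.lam xs e))) K (.vals [.clos [] xs e])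
  | pLetRec (K ext e) :
      Step K (.exp (.nonval (.letrec ext e))) K (.exp (e.subst (.ofList (mkClosList ext))))
  | pValue (K v) :
      Step K (.exp (.val v)) K (.vals [v])
  | pParams₀ (K id vs r) (h : id ≠ .map) (hr : eval id vs = some r) :
      Step (.params id vs [] :: K) .box K r
  | pParams (K id vs v r) (hr : eval id (vs ++ [v]) = some r) :
      Step (.params id vs [] :: K) (.vals [v]) K r
  | pCons (K v₁ v₂) :
      Step (.consHead v₂ :: K) (.vals [v₁]) K (.vals [.cons v₁ v₂])
  | pCaseTrue (K vs ps b cls) :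
      Step (.guard vs ps b cls :: K) (.vals [.atom .true]) K (.exp b)
  | pLet (K xs e₂ vs) (h : xs.length = vs.length) :
      Step (.elet xs e₂ :: K) (.vals vs) K (.exp (e₂.subst (.ofList (bindVars xs vs))))
  | pSeq (K e₂ v) :
      Step (.seq e₂ :: K) (.vals [v]) K (.exp e₂)
  -- exceptions
  | excCase (K vs) :
      Step (.case [] :: K) (.vals vs) K (.exc (errorExc .ifClause (.tuple [])))
  | pTry (K xs e₂ ys e₃ vs) (h : xs.length = vs.length) :
      Step (.etry xs e₂ ys e₃ :: K) (.vals vs) K (.exp (e₂.subst (.ofList (bindVars xs vs))))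
  | excTry (K xs e₂ y₁ y₂ y₃ e₃) (x : Exc) :
      Step (.etry xs e₂ [y₁, y₂, y₃] e₃ :: K) (.exc x) K
        (.exp (e₃.subst (.ofList
          (bindVars [y₁, y₂, y₃] [.atom x.cls.toAtom, x.reason, x.details]))))
  | excProp (K) (F : Frame) (x : Exc) (h : ¬ F.IsTry) :
      Step (F :: K) (.exc x) K (.exc x)

/-- `⟨K, r⟩ ⟶ⁿ ⟨K', r'⟩`: exactly `n` reduction steps. -/
inductive Steps : ℕ → FrameStack → Redex → FrameStack → Redex → Prop
  | refl (K r) : Steps 0 K r K r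
  | step {n K r K' r' K'' r''} (h : Step K r K' r') (t : Steps n K' r' K'' r'') :
      Steps (n + 1) K r K'' r''

/-- `⟨K, r⟩ ⇓ⁿ` -/
def TermIn (K : FrameStack) (r : Redex) (n : ℕ) : Prop :=
  ∃ res : Redex, res.IsResult ∧ Steps n K r [] res

/-- `⟨K, r⟩ ⇓` -/
def Terminates (K : FrameStack) (r : Redex) : Prop := ∃ n, TermIn K r n

/-! ## Logical relations for closed terms

The relations for stacks and expressions are first defined from an arbitrary step-indexed relation
`V` on values; then the relation `𝕍` is defined by recursion on the step index. -/

/-- `𝕏ₙ`, from a relation on values. -/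
def ExcRelOf (V : ℕ → Val → Val → Prop) (n : ℕ) (x y : Exc) : Prop :=
  x.cls = y.cls ∧ V n x.reason y.reason ∧ V n x.details y.details

/-- `𝕂ₙ`, from a relation on values. -/
def StackRelOf (V : ℕ → Val → Val → Prop) (n : ℕ) (K₁ K₂ : FrameStack) : Prop :=
  ClosedStack K₁ ∧ ClosedStack K₂ ∧
  (∀ m ≤ n, ∀ vs vs' : List Val, List.Forall₂ (V m) vs vs' →
    TermIn K₁ (.vals vs) m → Terminates K₂ (.vals vs')) ∧
  (∀ m ≤ n, ∀ x y : Exc, ExcRelOf V m x y →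
    TermIn K₁ (.exc x) m → Terminates K₂ (.exc y)) ∧
  (∀ m ≤ n, TermIn K₁ .box m → Terminates K₂ .box)

/-- `𝔼ₙ`, from a relation on values. -/
def ExpRelOf (V : ℕ → Val → Val → Prop) (n : ℕ) (e₁ e₂ : Exp) : Prop :=
  e₁.Closed ∧ e₂.Closed ∧
  ∀ m ≤ n, ∀ K₁ K₂ : FrameStack, StackRelOf V m K₁ K₂ →
    TermIn K₁ (.exp e₁) m → Terminates K₂ (.exp e₂)

/-- The clause for closures: they take the same number of parameters, and at every step index below
`n` their bodies are related for related arguments. -/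
def ClosRelOf (V : ℕ → Val → Val → Prop) (n : ℕ)
    (ext : List ClosItem) (xs : List Var) (e : Exp)
    (ext' : List ClosItem) (xs' : List Var) (e' : Exp) : Prop :=
  xs.length = xs'.length ∧
  ∀ m < n, ∀ vs vs' : List Val, vs.length = xs.length → List.Forall₂ (V m) vs vs' →
    ExpRelOf V m (e.subst (.ofList (mkClosList ext ++ bindVars xs vs)))
      (e'.subst (.ofList (mkClosList ext' ++ bindVars xs' vs')))

mutual
/-- The clauses of `𝕍ₙ` by the form of the values, where `V` serves for the indices below `n`. -/
def ValRelBody (V : ℕ → Val → Val → Prop) (n : ℕ) : Val → Val → Prop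
  | .int i, w => match w with
    | .int j => i = j
    | _ => False
  | .atom a, w => match w with
    | .atom b => a = b
    | _ => False
  | .nil, w => match w with
    | .nil => True
    | _ => False
  | .cons v₁ v₂, w => match w with
    | .cons w₁ w₂ => ValRelBody V n v₁ w₁ ∧ ValRelBody V n v₂ w₂
    | _ => False
  | .tuple vs, w => match w with
    | .tuple ws => ValRelBodyList V n vs ws
    | _ => False
  | .map l, w => match w with
    | .map l' => ValRelBodyItems V n l l'
    | _ => False
  | .clos ext xs e, w => match w with
    | .clos ext' xs' e' => ClosRelOf V n ext xs e ext' xs' e'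
    | _ => False
  | .var _, _ => False
  | .fid _ _, _ => False
def ValRelBodyList (V : ℕ → Val → Val → Prop) (n : ℕ) : List Val → List Val → Prop
  | [], ws => ws = []
  | v :: vs, ws => match ws with
    | [] => False
    | w :: ws => ValRelBody V n v w ∧ ValRelBodyList V n vs ws
def ValRelBodyItems (V : ℕ → Val → Val → Prop) (n : ℕ) :
    List (Val × Val) → List (Val × Val) → Prop
  | [], ws => ws = []
  | (k, v) :: vs, ws => match ws with
    | [] => False
    | (k', v') :: ws => ValRelBody V n k k' ∧ ValRelBody V n v v' ∧ ValRelBodyItems V n vs ws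
end

/-- `𝕍ₙ`, on closed values. -/
def ValRel (n : ℕ) (v w : Val) : Prop :=
  v.Closed ∧ w.Closed ∧ ValRelBody (fun m v' w' => ∃ _ : m < n, ValRel m v' w') n v w
termination_by n

/-- `𝕏ₙ` -/
def ExcRel (n : ℕ) (x y : Exc) : Prop := ExcRelOf ValRel n x y

/-- `𝕂ₙ` -/
def StackRel (n : ℕ) (K₁ K₂ : FrameStack) : Prop := StackRelOf ValRel n K₁ K₂

/-- `𝔼ₙ` -/
def ExpRel (n : ℕ) (e₁ e₂ : Exp) : Prop := ExpRelOf ValRel n e₁ e₂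

/-- `ℝₙ` -/
def RedexRel (n : ℕ) (r₁ r₂ : Redex) : Prop :=
  r₁.Closed ∧ r₂.Closed ∧
  ∀ m ≤ n, ∀ K₁ K₂ : FrameStack, StackRel m K₁ K₂ → TermIn K₁ r₁ m → Terminates K₂ r₂

/-! ## Logical relations for open terms -/

/-- `𝔾ₙ^Γ`: pairs of substitutions that map the names in `Γ` to related closed values. -/
def SubstRel (Γ : Set Name) (n : ℕ) (σ₁ σ₂ : Subst) : Prop :=
  (∀ x ∈ Γ, (σ₁ x).Closed) ∧ (∀ x ∈ Γ, (σ₂ x).Closed) ∧ ∀ x ∈ Γ, ValRel n (σ₁ x) (σ₂ x)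

/-- `𝕍^Γ` -/
def OpenValRel (Γ : Set Name) (v₁ v₂ : Val) : Prop :=
  ∀ n σ₁ σ₂, SubstRel Γ n σ₁ σ₂ → ValRel n (v₁.subst σ₁) (v₂.subst σ₂)

/-- `𝔼^Γ` -/
def OpenExpRel (Γ : Set Name) (e₁ e₂ : Exp) : Prop :=
  ∀ n σ₁ σ₂, SubstRel Γ n σ₁ σ₂ → ExpRel n (e₁.subst σ₁) (e₂.subst σ₂)

/-- `ℝ^Γ` -/
def OpenRedexRel (Γ : Set Name) (r₁ r₂ : Redex) : Prop :=
  ∀ n σ₁ σ₂, SubstRel Γ n σ₁ σ₂ → RedexRel n (r₁.subst σ₁) (r₂.subst σ₂)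

/-- Equivalence of function collections: they bind the same names, and corresponding functions have
the same parameters and related bodies. -/
def EquivExt (Γ : Set Name) (ext ext' : List ClosItem) : Prop :=
  List.Forall₂ (fun c c' => c.name = c'.name ∧ c.params = c'.params ∧
    OpenExpRel (Γ ∪ namesOf ext ∪ varNames c.params) c.body c'.body) ext ext'

/-- Pairwise related expressions. -/
abbrev OpenExpsRel (Γ : Set Name) (es es' : List Exp) : Prop :=
  List.Forall₂ (OpenExpRel Γ) es es'

/-- Pairwise related values. -/
abbrev OpenValsRel (Γ : Set Name) (vs vs' : List Val) : Prop :=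
  List.Forall₂ (OpenValRel Γ) vs vs'

end CoreErlang

open CoreErlang

namespace CoreErlang

/-! ## Substitution of closed values

If every value that a substitution inserts is closed, no binder is ever renamed. -/

-- Once related substitutions are applied, each rule becomes a claim about closed terms, and this
-- claim is settled by a single machine step. If the left configuration terminates in `m + 1` steps,
-- its first step pushes, modifies or pops a frame or reduces in place. The right configuration can
-- answer with the same rule, and the rest of the left run has `m` steps, so it is governed by the
-- relations at index `m`, which are weaker than those given. Steps are counted on the left only, so
-- the answering steps cost nothing. Each constructor therefore needs two facts: related parts make
-- related frames on related stacks (`StackRel.push`), and the first step of the expression leads to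
-- related configurations (`ExpRel.of_step`).
--
-- Three things are left to the step itself. Built-in functions, the term order and pattern matching
-- inspect only what related values share; in particular a closure is seen only through its arity
-- (`Val.cmp_congr`, `evalCall_rel`, `Pat.bindings_rel`). Application opens a closure, whose body is
-- related only strictly below the index of the closure; the step that performs the application pays
-- for this (`FrameIdRel.eval`). Recursive closures refer to themselves; as their bodies matter only
-- at smaller indices, strong induction on the index resolves the circularity (`ValRel.clos`).
--
-- The passage from open to closed terms rests on substitution. Binders are renamed by an arbitrary
-- choice, which would make instances hard to compare. But every substitution in play either keeps a
-- free name or replaces it by a closed value; such tame substitutions never rename, have the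
-- expected free names (`Exp.fv_subst`) and compose (`Exp.subst_subst`). Thus an instance under `Γ`
-- followed by the bindings made at run time is one parallel instance under the enlarged set of
-- names, which is what `OpenExpRel.body` says. Tameness also needs that related terms have no free
-- names outside `Γ`, as substitutions are unconstrained there; this follows from the closedness
-- built into the relations (`OpenExpRel.fv_subset`).

@[simp] theorem Renaming.app_id (n : Name) : Renaming.id.app n = n := by cases n <;> rfl

@[simp] theorem Renaming.map_onVar_id (xs : List Var) : xs.map Renaming.id.onVar = xs :=
  List.map_id xs

@[simp] theorem Name.fv_toVal (n : Name) : n.toVal.fv = {n} := by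
  cases n <;> simp [Name.toVal, Val.fv]

@[simp] theorem Name.subst_toVal (n : Name) (σ : Subst) : n.toVal.subst σ = σ n := by
  cases n <;> simp [Name.toVal, Val.subst]

mutual
@[simp] theorem Pat.rename_id : ∀ p : Pat, p.rename Renaming.id = p
  | .int _ => rfl
  | .atom _ => rfl
  | .var _ => rfl
  | .cons p q => by simp [Pat.rename, Pat.rename_id p, Pat.rename_id q]
  | .nil => rfl
  | .tuple ps => by simp [Pat.rename, Pat.renameList_id ps]
  | .map l => by simp [Pat.rename, Pat.renameItems_id l]
@[simp] theorem Pat.renameList_id : ∀ ps : List Pat, Pat.renameList Renaming.id ps = ps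
  | [] => rfl
  | p :: ps => by simp [Pat.renameList, Pat.rename_id p, Pat.renameList_id ps]
@[simp] theorem Pat.renameItems_id : ∀ l : List (Pat × Pat), Pat.renameItems Renaming.id l = l
  | [] => rfl
  | (p, q) :: l => by
    simp [Pat.renameItems, Pat.rename_id p, Pat.rename_id q, Pat.renameItems_id l]
end

/-- On the names in `F`, the substitution is the identity or inserts closed values. -/
def Subst.Tame (σ : Subst) (F : Set Name) : Prop := ∀ y ∈ F, σ y = y.toVal ∨ (σ y).Closed

/-- The substitution `σ` below the binders in `B`, which are not renamed. -/
noncomputable def Subst.mask (σ : Subst) (B : Set Name) : Subst := σ.under B Renaming.id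

/-- The names in `F` for which `σ` does not insert closed values. -/
def Subst.keep (σ : Subst) (F : Set Name) : Set Name := {n ∈ F | ¬ (σ n).Closed}

namespace Subst
variable {σ τ υ : Subst} {B F G : Set Name}

theorem mask_of_mem {n : Name} (h : n ∈ B) : σ.mask B n = n.toVal := by
  simp [mask, under, h]

theorem mask_of_notMem {n : Name} (h : n ∉ B) : σ.mask B n = σ n := by
  simp [mask, under, h]

theorem mask_mask (σ : Subst) (B G : Set Name) : (σ.mask B).mask G = σ.mask (B ∪ G) := by
  funext n
  by_cases hG : n ∈ G
  · rw [mask_of_mem hG, mask_of_mem (Or.inr hG)]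
  · by_cases hB : n ∈ B
    · rw [mask_of_notMem hG, mask_of_mem hB, mask_of_mem (Or.inl hB)]
    · rw [mask_of_notMem hG, mask_of_notMem hB, mask_of_notMem (by simp [hB, hG])]

theorem Tame.mono (h : σ.Tame F) (hG : G ⊆ F) : σ.Tame G := fun y hy => h y (hG hy)

theorem tame_union : σ.Tame (F ∪ G) ↔ σ.Tame F ∧ σ.Tame G :=
  ⟨fun h => ⟨h.mono Set.subset_union_left, h.mono Set.subset_union_right⟩,
    fun h y hy => hy.elim (h.1 y) (h.2 y)⟩

/-- The mask sends the names in `B` to themselves, so only the names that stay free outside the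
binder have to be controlled. This carries tameness from a binding term to its body. -/
theorem Tame.mask (h : σ.Tame (F \ B)) : (σ.mask B).Tame F := by
  intro y hy
  by_cases hB : y ∈ B
  · exact Or.inl (mask_of_mem hB)
  · rw [mask_of_notMem hB]
    exact h y ⟨hy, hB⟩

/-- The identity is a safe renaming: a value inserted for a free name outside `B` is either that
name, which is not in `B`, or closed, so nothing can be captured. The arbitrary choice in `renaming`
is never reached. -/
theorem Tame.renaming_eq_id (h : σ.Tame (F \ B)) : σ.renaming B F = Renaming.id := by
  refine if_pos ⟨fun x _ y _ hxy => by simpa using hxy, ?_⟩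
  intro y hy z hz hzB
  have hzB : z ∈ B := by simpa using hzB
  rcases h y hy with hc | hc
  · rw [hc, Name.fv_toVal] at hz
    exact hy.2 (hz ▸ hzB)
  · rw [hc] at hz
    exact hz

theorem keep_union (σ : Subst) (F G : Set Name) : σ.keep (F ∪ G) = σ.keep F ∪ σ.keep G := by
  ext n
  simp only [keep, Set.mem_union, Set.mem_ofPred_eq, or_and_right]

@[simp] theorem keep_empty (σ : Subst) : σ.keep ∅ = ∅ := by
  simp [keep]

/-- The mask changes the substitution only on `B`, which the difference removes. This is the step at
every binder in the computation of free names. -/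
theorem keep_mask_diff (σ : Subst) (B F : Set Name) : (σ.mask B).keep F \ B = σ.keep (F \ B) := by
  ext n
  by_cases hB : n ∈ B
  · simp [keep, hB]
  · simp [keep, hB, mask_of_notMem hB]

/-- A name that is mapped to itself counts as kept, because a name is not a closed value; a closed
value contributes nothing. -/
theorem Tame.fv_eq_keep {n : Name} (h : σ.Tame {n}) : (σ n).fv = σ.keep {n} := by
  rcases h n rfl with hc | hc
  · ext m
    simp only [hc, Name.fv_toVal, keep, Set.mem_singleton_iff, Set.mem_ofPred_eq]
    refine ⟨fun hm => ⟨hm, ?_⟩, fun hm => hm.1⟩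
    subst hm
    simp [hc, Val.Closed]
  · rw [show (σ n).fv = ∅ from hc, eq_comm, Set.eq_empty_iff_forall_notMem]
    rintro m ⟨hm, hm'⟩
    rw [Set.mem_singleton_iff] at hm
    subst hm
    exact hm' hc

end Subst

open Subst

/-! ### The equations of substitution for tame substitutions -/

section Equations
variable {σ : Subst}

theorem Val.subst_clos {ext : List ClosItem} {xs : List Var} {e : Exp}
    (h : σ.Tame (Val.clos ext xs e).fv) :
    (Val.clos ext xs e).subst σ =
      .clos (ClosItem.substList Renaming.id (σ.mask (namesOf ext)) ext) xs
        (e.subst ((σ.mask (namesOf ext)).mask (varNames xs))) := by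
  rw [Val.fv] at h
  have h' : (σ.mask (namesOf ext)).Tame (e.fv \ varNames xs) := (tame_union.1 h.mask).2
  -- The second renaming is computed for the substitution that is already below the function
  -- identifiers. It appears there as `under`, so the hypothesis is brought to that form.
  rw [mask] at h'
  simp only [Val.subst, h.renaming_eq_id, h'.renaming_eq_id, Renaming.map_onVar_id, mask]

theorem NonVal.subst_lam {xs : List Var} {e : Exp} (h : σ.Tame (NonVal.lam xs e).fv) :
    (NonVal.lam xs e).subst σ = .lam xs (e.subst (σ.mask (varNames xs))) := by
  rw [NonVal.fv] at h
  simp only [NonVal.subst, h.renaming_eq_id, Renaming.map_onVar_id, mask]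

theorem NonVal.subst_elet {xs : List Var} {e₁ e₂ : Exp} (h : σ.Tame (e₂.fv \ varNames xs)) :
    (NonVal.elet xs e₁ e₂).subst σ =
      .elet xs (e₁.subst σ) (e₂.subst (σ.mask (varNames xs))) := by
  simp only [NonVal.subst, h.renaming_eq_id, Renaming.map_onVar_id, mask]

theorem NonVal.subst_letrec {ext : List ClosItem} {e : Exp}
    (h : σ.Tame (NonVal.letrec ext e).fv) :
    (NonVal.letrec ext e).subst σ =
      .letrec (ClosItem.substList Renaming.id (σ.mask (namesOf ext)) ext)
        (e.subst (σ.mask (namesOf ext))) := by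
  rw [NonVal.fv] at h
  simp only [NonVal.subst, h.renaming_eq_id, mask]

theorem NonVal.subst_etry {xs ys : List Var} {e₁ e₂ e₃ : Exp}
    (h : σ.Tame (e₂.fv \ varNames xs)) (h' : σ.Tame (e₃.fv \ varNames ys)) :
    (NonVal.etry e₁ xs e₂ ys e₃).subst σ =
      .etry (e₁.subst σ) xs (e₂.subst (σ.mask (varNames xs))) ys
        (e₃.subst (σ.mask (varNames ys))) := by
  simp only [NonVal.subst, h.renaming_eq_id, h'.renaming_eq_id, Renaming.map_onVar_id, mask]

theorem ClosItem.subst_mk {f : Atom} {xs : List Var} {e : Exp}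
    (h : σ.Tame (ClosItem.mk f xs e).fv) :
    (ClosItem.mk f xs e).subst Renaming.id σ = .mk f xs (e.subst (σ.mask (varNames xs))) := by
  rw [ClosItem.fv] at h
  simp only [ClosItem.subst, h.renaming_eq_id, Renaming.map_onVar_id, mask]
  rfl

theorem Clause.subst_mk {ps : List Pat} {g b : Exp} (h : σ.Tame (Clause.mk ps g b).fv) :
    (Clause.mk ps g b).subst σ =
      .mk ps (g.subst (σ.mask (Pat.varsList ps))) (b.subst (σ.mask (Pat.varsList ps))) := by
  rw [Clause.fv] at h
  simp only [Clause.subst, h.renaming_eq_id, Pat.renameList_id, mask]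

/-- The arity is the number of parameters, which no renaming of parameters changes; hence no
tameness is needed. -/
theorem ClosItem.name_subst_id (σ : Subst) (c : ClosItem) :
    (c.subst Renaming.id σ).name = c.name := by
  cases c
  simp [ClosItem.subst, ClosItem.name, ClosItem.fname, ClosItem.params, Renaming.id]

theorem ClosItem.substList_eq_map (τ : Renaming) (σ : Subst) :
    ∀ ext : List ClosItem, ClosItem.substList τ σ ext = ext.map (ClosItem.subst τ σ)
  | [] => rfl
  | c :: ext => by simp [ClosItem.substList, ClosItem.substList_eq_map τ σ ext]

theorem namesOf_eq (ext : List ClosItem) : namesOf ext = {n | n ∈ ext.map ClosItem.name} := by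
  ext n
  simp [namesOf, eq_comm]

@[simp] theorem namesOf_substList_id (σ : Subst) (ext : List ClosItem) :
    namesOf (ClosItem.substList Renaming.id σ ext) = namesOf ext := by
  rw [namesOf_eq, namesOf_eq, ClosItem.substList_eq_map, List.map_map]
  congr! 4
  exact funext (ClosItem.name_subst_id σ)

end Equations

/-! ### Free names of an instance -/

mutual
-- Structural induction: without renaming, a binder masks its names in the body and then removes
-- them from the free names, and the two operations fit together by `keep_mask_diff`. The result
-- yields closedness of instances and tells where a second substitution has to be tame.
theorem Exp.fv_subst {σ : Subst} : ∀ e : Exp, σ.Tame e.fv → (e.subst σ).fv = σ.keep e.fv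
  | .nonval n, h => by simpa only [Exp.subst, Exp.fv] using NonVal.fv_subst n h
  | .val v, h => by simpa only [Exp.subst, Exp.fv] using Val.fv_subst v h
theorem Val.fv_subst {σ : Subst} : ∀ v : Val, σ.Tame v.fv → (v.subst σ).fv = σ.keep v.fv
  | .int _, _ => by simp [Val.subst, Val.fv]
  | .atom _, _ => by simp [Val.subst, Val.fv]
  | .nil, _ => by simp [Val.subst, Val.fv]
  | .var x, h => by
    rw [Val.fv] at h
    rw [Val.subst, h.fv_eq_keep, Val.fv]
  | .fid f k, h => by
    rw [Val.fv] at h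
    rw [Val.subst, h.fv_eq_keep, Val.fv]
  | .clos ext xs e, h => by
    rw [Val.subst_clos h]
    rw [Val.fv] at h
    have h₁ := tame_union.1 h.mask
    -- A closure binds twice: `keep_mask_diff` is used for the parameters of the body first, then
    -- for the function identifiers around everything.
    rw [Val.fv, namesOf_substList_id, ClosItem.fvList_substList ext h₁.1,
      Exp.fv_subst e h₁.2.mask, keep_mask_diff, ← keep_union, keep_mask_diff, Val.fv]
  | .cons v w, h => by
    rw [Val.fv, tame_union] at h
    rw [Val.subst, Val.fv, Val.fv_subst v h.1, Val.fv_subst w h.2, Val.fv, keep_union]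
  | .tuple vs, h => by
    rw [Val.fv] at h
    rw [Val.subst, Val.fv, Val.fvList_substList vs h, Val.fv]
  | .map l, h => by
    rw [Val.fv] at h
    rw [Val.subst, Val.fv, Val.fvItems_substItems l h, Val.fv]
theorem NonVal.fv_subst {σ : Subst} : ∀ n : NonVal, σ.Tame n.fv → (n.subst σ).fv = σ.keep n.fv
  | .lam xs e, h => by
    rw [NonVal.subst_lam h]
    rw [NonVal.fv] at h
    rw [NonVal.fv, Exp.fv_subst e h.mask, keep_mask_diff, NonVal.fv]
  | .values es, h => by
    rw [NonVal.fv] at h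
    rw [NonVal.subst, NonVal.fv, Exp.fvList_substList es h, NonVal.fv]
  | .cons e₁ e₂, h => by
    rw [NonVal.fv, tame_union] at h
    rw [NonVal.subst, NonVal.fv, Exp.fv_subst e₁ h.1, Exp.fv_subst e₂ h.2, NonVal.fv, keep_union]
  | .tuple es, h => by
    rw [NonVal.fv] at h
    rw [NonVal.subst, NonVal.fv, Exp.fvList_substList es h, NonVal.fv]
  | .map l, h => by
    rw [NonVal.fv] at h
    rw [NonVal.subst, NonVal.fv, Exp.fvItems_substItems l h, NonVal.fv]
  | .call em ef es, h => by
    rw [NonVal.fv, tame_union, tame_union] at h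
    rw [NonVal.subst, NonVal.fv, Exp.fv_subst em h.1.1, Exp.fv_subst ef h.1.2,
      Exp.fvList_substList es h.2, NonVal.fv, keep_union, keep_union]
  | .primop _ es, h => by
    rw [NonVal.fv] at h
    rw [NonVal.subst, NonVal.fv, Exp.fvList_substList es h, NonVal.fv]
  | .app e es, h => by
    rw [NonVal.fv, tame_union] at h
    rw [NonVal.subst, NonVal.fv, Exp.fv_subst e h.1, Exp.fvList_substList es h.2, NonVal.fv,
      keep_union]
  | .case e cls, h => by
    rw [NonVal.fv, tame_union] at h
    rw [NonVal.subst, NonVal.fv, Exp.fv_subst e h.1, Clause.fvList_substList cls h.2, NonVal.fv,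
      keep_union]
  | .elet xs e₁ e₂, h => by
    rw [NonVal.fv, tame_union] at h
    rw [NonVal.subst_elet h.2, NonVal.fv, Exp.fv_subst e₁ h.1, Exp.fv_subst e₂ h.2.mask,
      keep_mask_diff, NonVal.fv, keep_union]
  | .seq e₁ e₂, h => by
    rw [NonVal.fv, tame_union] at h
    rw [NonVal.subst, NonVal.fv, Exp.fv_subst e₁ h.1, Exp.fv_subst e₂ h.2, NonVal.fv, keep_union]
  | .letrec ext e, h => by
    rw [NonVal.subst_letrec h]
    rw [NonVal.fv] at h
    have h₁ := tame_union.1 h.mask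
    rw [NonVal.fv, namesOf_substList_id, ClosItem.fvList_substList ext h₁.1,
      Exp.fv_subst e h₁.2, ← keep_union, keep_mask_diff, NonVal.fv]
  | .etry e₁ xs e₂ ys e₃, h => by
    rw [NonVal.fv, tame_union, tame_union] at h
    rw [NonVal.subst_etry h.1.2 h.2, NonVal.fv, Exp.fv_subst e₁ h.1.1, Exp.fv_subst e₂ h.1.2.mask,
      Exp.fv_subst e₃ h.2.mask, keep_mask_diff, keep_mask_diff, NonVal.fv, keep_union, keep_union]
theorem ClosItem.fv_subst {σ : Subst} :
    ∀ c : ClosItem, σ.Tame c.fv → (c.subst Renaming.id σ).fv = σ.keep c.fv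
  | .mk f xs e, h => by
    rw [ClosItem.subst_mk h]
    rw [ClosItem.fv] at h
    rw [ClosItem.fv, Exp.fv_subst e h.mask, keep_mask_diff, ClosItem.fv]
theorem Clause.fv_subst {σ : Subst} : ∀ c : Clause, σ.Tame c.fv → (c.subst σ).fv = σ.keep c.fv
  | .mk ps g b, h => by
    rw [Clause.subst_mk h]
    rw [Clause.fv] at h
    have h₁ := tame_union.1 h.mask
    rw [Clause.fv, Exp.fv_subst g h₁.1, Exp.fv_subst b h₁.2, ← keep_union, keep_mask_diff,
      Clause.fv]
theorem Exp.fvList_substList {σ : Subst} : ∀ es : List Exp, σ.Tame (Exp.fvList es) →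
    Exp.fvList (Exp.substList σ es) = σ.keep (Exp.fvList es)
  | [], _ => by simp [Exp.substList, Exp.fvList]
  | e :: es, h => by
    rw [Exp.fvList, tame_union] at h
    rw [Exp.substList, Exp.fvList, Exp.fv_subst e h.1, Exp.fvList_substList es h.2, Exp.fvList,
      keep_union]
theorem Exp.fvItems_substItems {σ : Subst} : ∀ l : List (Exp × Exp), σ.Tame (Exp.fvItems l) →
    Exp.fvItems (Exp.substItems σ l) = σ.keep (Exp.fvItems l)
  | [], _ => by simp [Exp.substItems, Exp.fvItems]
  | (a, b) :: l, h => by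
    rw [Exp.fvItems, tame_union, tame_union] at h
    rw [Exp.substItems, Exp.fvItems, Exp.fv_subst a h.1.1, Exp.fv_subst b h.1.2,
      Exp.fvItems_substItems l h.2, Exp.fvItems, keep_union, keep_union]
theorem Val.fvList_substList {σ : Subst} : ∀ vs : List Val, σ.Tame (Val.fvList vs) →
    Val.fvList (Val.substList σ vs) = σ.keep (Val.fvList vs)
  | [], _ => by simp [Val.substList, Val.fvList]
  | v :: vs, h => by
    rw [Val.fvList, tame_union] at h
    rw [Val.substList, Val.fvList, Val.fv_subst v h.1, Val.fvList_substList vs h.2, Val.fvList,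
      keep_union]
theorem Val.fvItems_substItems {σ : Subst} : ∀ l : List (Val × Val), σ.Tame (Val.fvItems l) →
    Val.fvItems (Val.substItems σ l) = σ.keep (Val.fvItems l)
  | [], _ => by simp [Val.substItems, Val.fvItems]
  | (a, b) :: l, h => by
    rw [Val.fvItems, tame_union, tame_union] at h
    rw [Val.substItems, Val.fvItems, Val.fv_subst a h.1.1, Val.fv_subst b h.1.2,
      Val.fvItems_substItems l h.2, Val.fvItems, keep_union, keep_union]
theorem ClosItem.fvList_substList {σ : Subst} :
    ∀ ext : List ClosItem, σ.Tame (ClosItem.fvList ext) →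
      ClosItem.fvList (ClosItem.substList Renaming.id σ ext) = σ.keep (ClosItem.fvList ext)
  | [], _ => by simp [ClosItem.substList, ClosItem.fvList]
  | c :: ext, h => by
    rw [ClosItem.fvList, tame_union] at h
    rw [ClosItem.substList, ClosItem.fvList, ClosItem.fv_subst c h.1,
      ClosItem.fvList_substList ext h.2, ClosItem.fvList, keep_union]
theorem Clause.fvList_substList {σ : Subst} : ∀ cls : List Clause, σ.Tame (Clause.fvList cls) →
    Clause.fvList (Clause.substList σ cls) = σ.keep (Clause.fvList cls)
  | [], _ => by simp [Clause.substList, Clause.fvList]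
  | c :: cls, h => by
    rw [Clause.fvList, tame_union] at h
    rw [Clause.substList, Clause.fvList, Clause.fv_subst c h.1, Clause.fvList_substList cls h.2,
      Clause.fvList, keep_union]
end

/-! ### Substitutions that are the identity on the free names -/

/-- The substitution is the identity on `F`. -/
def Subst.IdOn (σ : Subst) (F : Set Name) : Prop := ∀ y ∈ F, σ y = y.toVal

namespace Subst
variable {σ : Subst} {B F G : Set Name}

theorem IdOn.tame (h : σ.IdOn F) : σ.Tame F := fun y hy => Or.inl (h y hy)

theorem idOn_union : σ.IdOn (F ∪ G) ↔ σ.IdOn F ∧ σ.IdOn G :=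
  ⟨fun h => ⟨fun y hy => h y (Or.inl hy), fun y hy => h y (Or.inr hy)⟩,
    fun h y hy => hy.elim (h.1 y) (h.2 y)⟩

theorem IdOn.mask (h : σ.IdOn (F \ B)) : (σ.mask B).IdOn F := by
  intro y hy
  by_cases hB : y ∈ B
  · exact mask_of_mem hB
  · rw [mask_of_notMem hB]
    exact h y ⟨hy, hB⟩

end Subst

mutual
-- A substitution that fixes the free names is tame, so no binder is renamed and the term is rebuilt
-- literally. For closed values the hypothesis is vacuous, which is the case used in composition.
theorem Exp.subst_eq_self {σ : Subst} : ∀ e : Exp, σ.IdOn e.fv → e.subst σ = e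
  | .nonval n, h => by
    rw [Exp.fv] at h
    rw [Exp.subst, NonVal.subst_eq_self n h]
  | .val v, h => by
    rw [Exp.fv] at h
    rw [Exp.subst, Val.subst_eq_self v h]
theorem Val.subst_eq_self {σ : Subst} : ∀ v : Val, σ.IdOn v.fv → v.subst σ = v
  | .int _, _ => by rw [Val.subst]
  | .atom _, _ => by rw [Val.subst]
  | .nil, _ => by rw [Val.subst]
  | .var x, h => by
    rw [Val.fv] at h
    rw [Val.subst, h _ rfl, Name.toVal]
  | .fid f k, h => by
    rw [Val.fv] at h
    rw [Val.subst, h _ rfl, Name.toVal]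
  | .clos ext xs e, h => by
    rw [Val.subst_clos h.tame]
    rw [Val.fv] at h
    have h₁ := idOn_union.1 h.mask
    rw [ClosItem.substList_eq_self ext h₁.1, Exp.subst_eq_self e h₁.2.mask]
  | .cons v w, h => by
    rw [Val.fv, idOn_union] at h
    rw [Val.subst, Val.subst_eq_self v h.1, Val.subst_eq_self w h.2]
  | .tuple vs, h => by
    rw [Val.fv] at h
    rw [Val.subst, Val.substList_eq_self vs h]
  | .map l, h => by
    rw [Val.fv] at h
    rw [Val.subst, Val.substItems_eq_self l h]
theorem NonVal.subst_eq_self {σ : Subst} : ∀ n : NonVal, σ.IdOn n.fv → n.subst σ = n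
  | .lam xs e, h => by
    rw [NonVal.subst_lam h.tame]
    rw [NonVal.fv] at h
    rw [Exp.subst_eq_self e h.mask]
  | .values es, h => by
    rw [NonVal.fv] at h
    rw [NonVal.subst, Exp.substList_eq_self es h]
  | .cons e₁ e₂, h => by
    rw [NonVal.fv, idOn_union] at h
    rw [NonVal.subst, Exp.subst_eq_self e₁ h.1, Exp.subst_eq_self e₂ h.2]
  | .tuple es, h => by
    rw [NonVal.fv] at h
    rw [NonVal.subst, Exp.substList_eq_self es h]
  | .map l, h => by
    rw [NonVal.fv] at h
    rw [NonVal.subst, Exp.substItems_eq_self l h]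
  | .call em ef es, h => by
    rw [NonVal.fv, idOn_union, idOn_union] at h
    rw [NonVal.subst, Exp.subst_eq_self em h.1.1, Exp.subst_eq_self ef h.1.2,
      Exp.substList_eq_self es h.2]
  | .primop _ es, h => by
    rw [NonVal.fv] at h
    rw [NonVal.subst, Exp.substList_eq_self es h]
  | .app e es, h => by
    rw [NonVal.fv, idOn_union] at h
    rw [NonVal.subst, Exp.subst_eq_self e h.1, Exp.substList_eq_self es h.2]
  | .case e cls, h => by
    rw [NonVal.fv, idOn_union] at h
    rw [NonVal.subst, Exp.subst_eq_self e h.1, Clause.substList_eq_self cls h.2]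
  | .elet xs e₁ e₂, h => by
    rw [NonVal.fv, idOn_union] at h
    rw [NonVal.subst_elet h.2.tame, Exp.subst_eq_self e₁ h.1, Exp.subst_eq_self e₂ h.2.mask]
  | .seq e₁ e₂, h => by
    rw [NonVal.fv, idOn_union] at h
    rw [NonVal.subst, Exp.subst_eq_self e₁ h.1, Exp.subst_eq_self e₂ h.2]
  | .letrec ext e, h => by
    rw [NonVal.subst_letrec h.tame]
    rw [NonVal.fv] at h
    have h₁ := idOn_union.1 h.mask
    rw [ClosItem.substList_eq_self ext h₁.1, Exp.subst_eq_self e h₁.2]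
  | .etry e₁ xs e₂ ys e₃, h => by
    rw [NonVal.fv, idOn_union, idOn_union] at h
    rw [NonVal.subst_etry h.1.2.tame h.2.tame, Exp.subst_eq_self e₁ h.1.1,
      Exp.subst_eq_self e₂ h.1.2.mask, Exp.subst_eq_self e₃ h.2.mask]
theorem ClosItem.subst_eq_self {σ : Subst} :
    ∀ c : ClosItem, σ.IdOn c.fv → c.subst Renaming.id σ = c
  | .mk f xs e, h => by
    rw [ClosItem.subst_mk h.tame]
    rw [ClosItem.fv] at h
    rw [Exp.subst_eq_self e h.mask]
theorem Clause.subst_eq_self {σ : Subst} : ∀ c : Clause, σ.IdOn c.fv → c.subst σ = c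
  | .mk ps g b, h => by
    rw [Clause.subst_mk h.tame]
    rw [Clause.fv] at h
    have h₁ := idOn_union.1 h.mask
    rw [Exp.subst_eq_self g h₁.1, Exp.subst_eq_self b h₁.2]
theorem Exp.substList_eq_self {σ : Subst} :
    ∀ es : List Exp, σ.IdOn (Exp.fvList es) → Exp.substList σ es = es
  | [], _ => by rw [Exp.substList]
  | e :: es, h => by
    rw [Exp.fvList, idOn_union] at h
    rw [Exp.substList, Exp.subst_eq_self e h.1, Exp.substList_eq_self es h.2]
theorem Exp.substItems_eq_self {σ : Subst} :
    ∀ l : List (Exp × Exp), σ.IdOn (Exp.fvItems l) → Exp.substItems σ l = l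
  | [], _ => by rw [Exp.substItems]
  | (a, b) :: l, h => by
    rw [Exp.fvItems, idOn_union, idOn_union] at h
    rw [Exp.substItems, Exp.subst_eq_self a h.1.1, Exp.subst_eq_self b h.1.2,
      Exp.substItems_eq_self l h.2]
theorem Val.substList_eq_self {σ : Subst} :
    ∀ vs : List Val, σ.IdOn (Val.fvList vs) → Val.substList σ vs = vs
  | [], _ => by rw [Val.substList]
  | v :: vs, h => by
    rw [Val.fvList, idOn_union] at h
    rw [Val.substList, Val.subst_eq_self v h.1, Val.substList_eq_self vs h.2]
theorem Val.substItems_eq_self {σ : Subst} :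
    ∀ l : List (Val × Val), σ.IdOn (Val.fvItems l) → Val.substItems σ l = l
  | [], _ => by rw [Val.substItems]
  | (a, b) :: l, h => by
    rw [Val.fvItems, idOn_union, idOn_union] at h
    rw [Val.substItems, Val.subst_eq_self a h.1.1, Val.subst_eq_self b h.1.2,
      Val.substItems_eq_self l h.2]
theorem ClosItem.substList_eq_self {σ : Subst} : ∀ ext : List ClosItem,
    σ.IdOn (ClosItem.fvList ext) → ClosItem.substList Renaming.id σ ext = ext
  | [], _ => by rw [ClosItem.substList]
  | c :: ext, h => by
    rw [ClosItem.fvList, idOn_union] at h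
    rw [ClosItem.substList, ClosItem.subst_eq_self c h.1, ClosItem.substList_eq_self ext h.2]
theorem Clause.substList_eq_self {σ : Subst} :
    ∀ cls : List Clause, σ.IdOn (Clause.fvList cls) → Clause.substList σ cls = cls
  | [], _ => by rw [Clause.substList]
  | c :: cls, h => by
    rw [Clause.fvList, idOn_union] at h
    rw [Clause.substList, Clause.subst_eq_self c h.1, Clause.substList_eq_self cls h.2]
end

theorem Val.Closed.subst_eq {v : Val} (h : v.Closed) (σ : Subst) : v.subst σ = v :=
  Val.subst_eq_self v fun y hy => by
    rw [show v.fv = ∅ from h] at hy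
    exact hy.elim

/-! ### Composition -/

/-- On `F`, the substitution `υ` is `σ` followed by `τ`, where `σ` leaves names alone or inserts
closed values, and so does `υ`. -/
def Subst.Composes (σ τ υ : Subst) (F : Set Name) : Prop :=
  ∀ y ∈ F, (σ y = y.toVal ∧ τ y = υ y ∧ (υ y = y.toVal ∨ (υ y).Closed)) ∨
    ((σ y).Closed ∧ υ y = σ y)

namespace Subst
variable {σ τ υ : Subst} {B F G : Set Name}

theorem Composes.tame (h : Composes σ τ υ F) : σ.Tame F :=
  fun y hy => (h y hy).imp (fun h => h.1) (fun h => h.1)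

theorem Composes.tame_comp (h : Composes σ τ υ F) : υ.Tame F :=
  fun y hy => (h y hy).elim (fun h => h.2.2) (fun h => Or.inr (h.2 ▸ h.1))

/-- Only names that `σ` leaves alone survive in the instance, and on these `τ` agrees with the tame
`υ`. -/
theorem Composes.tame_keep (h : Composes σ τ υ F) : τ.Tame (σ.keep F) := by
  rintro y ⟨hy, hc⟩
  rcases h y hy with ⟨_, h₂, h₃⟩ | h'
  · rwa [h₂]
  · exact (hc h'.1).elim

theorem composes_union :
    Composes σ τ υ (F ∪ G) ↔ Composes σ τ υ F ∧ Composes σ τ υ G :=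
  ⟨fun h => ⟨fun y hy => h y (Or.inl hy), fun y hy => h y (Or.inr hy)⟩,
    fun h y hy => hy.elim (h.1 y) (h.2 y)⟩

/-- On `B` all three masked substitutions are the identity. For this reason `Composes` also admits
names that `υ` keeps, although at top level one may think of `υ` as closing. -/
theorem Composes.mask (h : Composes σ τ υ (F \ B)) :
    Composes (σ.mask B) (τ.mask B) (υ.mask B) F := by
  intro y hy
  by_cases hB : y ∈ B
  · simp [mask_of_mem hB]
  · simpa only [mask_of_notMem hB] using h y ⟨hy, hB⟩

theorem Composes.subst_eq {n : Name} (h : Composes σ τ υ {n}) : (σ n).subst τ = υ n := by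
  rcases h n rfl with ⟨h₁, h₂, _⟩ | ⟨h₁, h₂⟩
  · rw [h₁, Name.subst_toVal, h₂]
  · rw [h₁.subst_eq, h₂]

end Subst

mutual
-- Induction with masks pushed below binders. Three substitutions must be free of renaming at a
-- binder: `σ` and `υ` on the term, and `τ` on the instance by `σ`, whose free names are known from
-- `Exp.fv_subst`.
theorem Exp.subst_subst {σ τ υ : Subst} :
    ∀ e : Exp, Composes σ τ υ e.fv → (e.subst σ).subst τ = e.subst υ
  | .nonval n, h => by
    rw [Exp.fv] at h
    rw [Exp.subst, Exp.subst, Exp.subst, NonVal.subst_subst n h]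
  | .val v, h => by
    rw [Exp.fv] at h
    rw [Exp.subst, Exp.subst, Exp.subst, Val.subst_subst v h]
theorem Val.subst_subst {σ τ υ : Subst} :
    ∀ v : Val, Composes σ τ υ v.fv → (v.subst σ).subst τ = v.subst υ
  | .int _, _ => by simp only [Val.subst]
  | .atom _, _ => by simp only [Val.subst]
  | .nil, _ => by simp only [Val.subst]
  | .var x, h => by
    rw [Val.fv] at h
    rw [Val.subst, Val.subst, h.subst_eq]
  | .fid f k, h => by
    rw [Val.fv] at h
    rw [Val.subst, Val.subst, h.subst_eq]
  | .clos ext xs e, h => by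
    -- Tameness of `τ` on the names kept by `σ` is turned into tameness on the free names of the
    -- instance, so that the second substitution can be computed at this binder.
    have h₀ := h.tame_keep
    rw [← Val.fv_subst _ h.tame, Val.subst_clos h.tame] at h₀
    rw [Val.subst_clos h.tame, Val.subst_clos h.tame_comp, Val.subst_clos h₀,
      namesOf_substList_id]
    rw [Val.fv] at h
    have h₁ := composes_union.1 h.mask
    rw [ClosItem.substList_substList ext h₁.1, Exp.subst_subst e h₁.2.mask]
  | .cons v w, h => by
    rw [Val.fv, composes_union] at h
    rw [Val.subst, Val.subst, Val.subst, Val.subst_subst v h.1, Val.subst_subst w h.2]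
  | .tuple vs, h => by
    rw [Val.fv] at h
    rw [Val.subst, Val.subst, Val.subst, Val.substList_substList vs h]
  | .map l, h => by
    rw [Val.fv] at h
    rw [Val.subst, Val.subst, Val.subst, Val.substItems_substItems l h]
theorem NonVal.subst_subst {σ τ υ : Subst} :
    ∀ n : NonVal, Composes σ τ υ n.fv → (n.subst σ).subst τ = n.subst υ
  | .lam xs e, h => by
    have h₀ := h.tame_keep
    rw [← NonVal.fv_subst _ h.tame, NonVal.subst_lam h.tame] at h₀
    rw [NonVal.subst_lam h.tame, NonVal.subst_lam h.tame_comp, NonVal.subst_lam h₀]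
    rw [NonVal.fv] at h
    rw [Exp.subst_subst e h.mask]
  | .values es, h => by
    rw [NonVal.fv] at h
    rw [NonVal.subst, NonVal.subst, NonVal.subst, Exp.substList_substList es h]
  | .cons e₁ e₂, h => by
    rw [NonVal.fv, composes_union] at h
    rw [NonVal.subst, NonVal.subst, NonVal.subst, Exp.subst_subst e₁ h.1, Exp.subst_subst e₂ h.2]
  | .tuple es, h => by
    rw [NonVal.fv] at h
    rw [NonVal.subst, NonVal.subst, NonVal.subst, Exp.substList_substList es h]
  | .map l, h => by
    rw [NonVal.fv] at h
    rw [NonVal.subst, NonVal.subst, NonVal.subst, Exp.substItems_substItems l h]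
  | .call em ef es, h => by
    rw [NonVal.fv, composes_union, composes_union] at h
    rw [NonVal.subst, NonVal.subst, NonVal.subst, Exp.subst_subst em h.1.1,
      Exp.subst_subst ef h.1.2, Exp.substList_substList es h.2]
  | .primop _ es, h => by
    rw [NonVal.fv] at h
    rw [NonVal.subst, NonVal.subst, NonVal.subst, Exp.substList_substList es h]
  | .app e es, h => by
    rw [NonVal.fv, composes_union] at h
    rw [NonVal.subst, NonVal.subst, NonVal.subst, Exp.subst_subst e h.1,
      Exp.substList_substList es h.2]
  | .case e cls, h => by
    rw [NonVal.fv, composes_union] at h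
    rw [NonVal.subst, NonVal.subst, NonVal.subst, Exp.subst_subst e h.1,
      Clause.substList_substList cls h.2]
  | .elet xs e₁ e₂, h => by
    rw [NonVal.fv, composes_union] at h
    -- Only the body lies below the binder, so tameness of `τ` is transferred for the body alone.
    have h₀ : τ.Tame ((e₂.subst (σ.mask (varNames xs))).fv \ varNames xs) := by
      rw [Exp.fv_subst _ h.2.mask.tame, keep_mask_diff]
      exact h.2.tame_keep
    rw [NonVal.subst_elet h.2.tame, NonVal.subst_elet h.2.tame_comp, NonVal.subst_elet h₀,
      Exp.subst_subst e₁ h.1, Exp.subst_subst e₂ h.2.mask]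
  | .seq e₁ e₂, h => by
    rw [NonVal.fv, composes_union] at h
    rw [NonVal.subst, NonVal.subst, NonVal.subst, Exp.subst_subst e₁ h.1, Exp.subst_subst e₂ h.2]
  | .letrec ext e, h => by
    have h₀ := h.tame_keep
    rw [← NonVal.fv_subst _ h.tame, NonVal.subst_letrec h.tame] at h₀
    rw [NonVal.subst_letrec h.tame, NonVal.subst_letrec h.tame_comp, NonVal.subst_letrec h₀,
      namesOf_substList_id]
    rw [NonVal.fv] at h
    have h₁ := composes_union.1 h.mask
    rw [ClosItem.substList_substList ext h₁.1, Exp.subst_subst e h₁.2]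
  | .etry e₁ xs e₂ ys e₃, h => by
    rw [NonVal.fv, composes_union, composes_union] at h
    have h₂ : τ.Tame ((e₂.subst (σ.mask (varNames xs))).fv \ varNames xs) := by
      rw [Exp.fv_subst _ h.1.2.mask.tame, keep_mask_diff]
      exact h.1.2.tame_keep
    have h₃ : τ.Tame ((e₃.subst (σ.mask (varNames ys))).fv \ varNames ys) := by
      rw [Exp.fv_subst _ h.2.mask.tame, keep_mask_diff]
      exact h.2.tame_keep
    rw [NonVal.subst_etry h.1.2.tame h.2.tame, NonVal.subst_etry h.1.2.tame_comp h.2.tame_comp,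
      NonVal.subst_etry h₂ h₃, Exp.subst_subst e₁ h.1.1, Exp.subst_subst e₂ h.1.2.mask,
      Exp.subst_subst e₃ h.2.mask]
theorem ClosItem.subst_subst {σ τ υ : Subst} : ∀ c : ClosItem, Composes σ τ υ c.fv →
    (c.subst Renaming.id σ).subst Renaming.id τ = c.subst Renaming.id υ
  | .mk f xs e, h => by
    have h₀ := h.tame_keep
    rw [← ClosItem.fv_subst _ h.tame, ClosItem.subst_mk h.tame] at h₀
    rw [ClosItem.subst_mk h.tame, ClosItem.subst_mk h.tame_comp, ClosItem.subst_mk h₀]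
    rw [ClosItem.fv] at h
    rw [Exp.subst_subst e h.mask]
theorem Clause.subst_subst {σ τ υ : Subst} :
    ∀ c : Clause, Composes σ τ υ c.fv → (c.subst σ).subst τ = c.subst υ
  | .mk ps g b, h => by
    have h₀ := h.tame_keep
    rw [← Clause.fv_subst _ h.tame, Clause.subst_mk h.tame] at h₀
    rw [Clause.subst_mk h.tame, Clause.subst_mk h.tame_comp, Clause.subst_mk h₀]
    rw [Clause.fv] at h
    have h₁ := composes_union.1 h.mask
    rw [Exp.subst_subst g h₁.1, Exp.subst_subst b h₁.2]
theorem Exp.substList_substList {σ τ υ : Subst} :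
    ∀ es : List Exp, Composes σ τ υ (Exp.fvList es) →
      Exp.substList τ (Exp.substList σ es) = Exp.substList υ es
  | [], _ => by simp only [Exp.substList]
  | e :: es, h => by
    rw [Exp.fvList, composes_union] at h
    rw [Exp.substList, Exp.substList, Exp.substList, Exp.subst_subst e h.1,
      Exp.substList_substList es h.2]
theorem Exp.substItems_substItems {σ τ υ : Subst} :
    ∀ l : List (Exp × Exp), Composes σ τ υ (Exp.fvItems l) →
      Exp.substItems τ (Exp.substItems σ l) = Exp.substItems υ l
  | [], _ => by simp only [Exp.substItems]
  | (a, b) :: l, h => by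
    rw [Exp.fvItems, composes_union, composes_union] at h
    rw [Exp.substItems, Exp.substItems, Exp.substItems, Exp.subst_subst a h.1.1,
      Exp.subst_subst b h.1.2, Exp.substItems_substItems l h.2]
theorem Val.substList_substList {σ τ υ : Subst} :
    ∀ vs : List Val, Composes σ τ υ (Val.fvList vs) →
      Val.substList τ (Val.substList σ vs) = Val.substList υ vs
  | [], _ => by simp only [Val.substList]
  | v :: vs, h => by
    rw [Val.fvList, composes_union] at h
    rw [Val.substList, Val.substList, Val.substList, Val.subst_subst v h.1,
      Val.substList_substList vs h.2]
theorem Val.substItems_substItems {σ τ υ : Subst} :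
    ∀ l : List (Val × Val), Composes σ τ υ (Val.fvItems l) →
      Val.substItems τ (Val.substItems σ l) = Val.substItems υ l
  | [], _ => by simp only [Val.substItems]
  | (a, b) :: l, h => by
    rw [Val.fvItems, composes_union, composes_union] at h
    rw [Val.substItems, Val.substItems, Val.substItems, Val.subst_subst a h.1.1,
      Val.subst_subst b h.1.2, Val.substItems_substItems l h.2]
theorem ClosItem.substList_substList {σ τ υ : Subst} :
    ∀ ext : List ClosItem, Composes σ τ υ (ClosItem.fvList ext) →
      ClosItem.substList Renaming.id τ (ClosItem.substList Renaming.id σ ext) =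
        ClosItem.substList Renaming.id υ ext
  | [], _ => by simp only [ClosItem.substList]
  | c :: ext, h => by
    rw [ClosItem.fvList, composes_union] at h
    rw [ClosItem.substList, ClosItem.substList, ClosItem.substList, ClosItem.subst_subst c h.1,
      ClosItem.substList_substList ext h.2]
theorem Clause.substList_substList {σ τ υ : Subst} :
    ∀ cls : List Clause, Composes σ τ υ (Clause.fvList cls) →
      Clause.substList τ (Clause.substList σ cls) = Clause.substList υ cls
  | [], _ => by simp only [Clause.substList]
  | c :: cls, h => by
    rw [Clause.fvList, composes_union] at h
    rw [Clause.substList, Clause.substList, Clause.substList, Clause.subst_subst c h.1,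
      Clause.substList_substList cls h.2]
end

/-! ## The relation on values -/

section Congruence
variable {V V' : ℕ → Val → Val → Prop} {n : ℕ}

theorem ExcRelOf.congr (h : V n = V' n) : ExcRelOf V n = ExcRelOf V' n := by
  funext x y
  simp only [ExcRelOf, h]

theorem StackRelOf.congr (h : ∀ m ≤ n, V m = V' m) : StackRelOf V n = StackRelOf V' n := by
  funext K₁ K₂
  refine propext (and_congr Iff.rfl (and_congr Iff.rfl (and_congr ?_ (and_congr ?_ Iff.rfl))))
  · exact forall₂_congr fun m hm => by rw [h m hm]
  · exact forall₂_congr fun m hm => by rw [ExcRelOf.congr (h m hm)]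

theorem ExpRelOf.congr (h : ∀ m ≤ n, V m = V' m) : ExpRelOf V n = ExpRelOf V' n := by
  funext e₁ e₂
  refine propext (and_congr Iff.rfl (and_congr Iff.rfl ?_))
  exact forall₂_congr fun m hm => by rw [StackRelOf.congr fun k hk => h k (hk.trans hm)]

/-- Arguments and bodies of closures are compared at indices strictly below `n` only. This
strictness is what makes the recursion on the index well founded. -/
theorem ClosRelOf.congr (h : ∀ m < n, V m = V' m) : ClosRelOf V n = ClosRelOf V' n := by
  funext ext xs e ext' xs' e'
  refine propext (and_congr Iff.rfl (forall₂_congr fun m hm => ?_))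
  rw [h m hm, ExpRelOf.congr fun k hk => h k (hk.trans_lt hm)]

mutual
theorem ValRelBody.congr (h : ∀ m < n, V m = V' m) :
    ∀ v w : Val, ValRelBody V n v w = ValRelBody V' n v w
  | .int _, w => by cases w <;> simp only [ValRelBody]
  | .atom _, w => by cases w <;> simp only [ValRelBody]
  | .nil, w => by cases w <;> simp only [ValRelBody]
  | .var _, w => by simp only [ValRelBody]
  | .fid _ _, w => by simp only [ValRelBody]
  | .clos ext xs e, w => by cases w <;> simp only [ValRelBody, ClosRelOf.congr h]
  | .cons v₁ v₂, w => by
    cases w <;> simp only [ValRelBody, ValRelBody.congr h v₁, ValRelBody.congr h v₂]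
  | .tuple vs, w => by cases w <;> simp only [ValRelBody, ValRelBodyList.congr h vs]
  | .map l, w => by cases w <;> simp only [ValRelBody, ValRelBodyItems.congr h l]
theorem ValRelBodyList.congr (h : ∀ m < n, V m = V' m) :
    ∀ vs ws : List Val, ValRelBodyList V n vs ws = ValRelBodyList V' n vs ws
  | [], ws => by simp only [ValRelBodyList]
  | v :: vs, ws => by
    cases ws <;> simp only [ValRelBodyList, ValRelBody.congr h v, ValRelBodyList.congr h vs]
theorem ValRelBodyItems.congr (h : ∀ m < n, V m = V' m) :
    ∀ l l' : List (Val × Val), ValRelBodyItems V n l l' = ValRelBodyItems V' n l l'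
  | [], l' => by simp only [ValRelBodyItems]
  | (k, v) :: l, l' => by
    cases l' <;> simp only [ValRelBodyItems, ValRelBody.congr h k, ValRelBody.congr h v,
      ValRelBodyItems.congr h l]
end

end Congruence

/-- The guard `m < n` in the recursive definition is harmless, because `ValRelBody` never consults
its relation at other indices. From here on the definition can be read as an equation. -/
theorem valRel_iff {n : ℕ} {v w : Val} :
    ValRel n v w ↔ v.Closed ∧ w.Closed ∧ ValRelBody ValRel n v w := by
  rw [ValRel, ValRelBody.congr]
  intro m hm
  funext v w
  exact propext ⟨fun h => h.2, fun h => ⟨hm, h⟩⟩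

theorem ValRel.closed_left {n : ℕ} {v w : Val} (h : ValRel n v w) : v.Closed :=
  (valRel_iff.1 h).1

theorem ValRel.closed_right {n : ℕ} {v w : Val} (h : ValRel n v w) : w.Closed :=
  (valRel_iff.1 h).2.1

theorem ValRel.body {n : ℕ} {v w : Val} (h : ValRel n v w) : ValRelBody ValRel n v w :=
  (valRel_iff.1 h).2.2

-- Monotonicity in the step index

section Mono
variable {V : ℕ → Val → Val → Prop} {m n : ℕ}

mutual
-- The index enters only through closures, where it bounds a universal quantifier; a smaller bound
-- asks for less.
theorem ValRelBody.mono (h : m ≤ n) : ∀ v w : Val, ValRelBody V n v w → ValRelBody V m v w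
  | .int _, w => by cases w <;> simp only [ValRelBody, imp_self]
  | .atom _, w => by cases w <;> simp only [ValRelBody, imp_self]
  | .nil, w => by cases w <;> simp only [ValRelBody, imp_self]
  | .var _, w => by simp only [ValRelBody, imp_self]
  | .fid _ _, w => by simp only [ValRelBody, imp_self]
  | .clos ext xs e, w => by
    cases w <;> simp only [ValRelBody, imp_self]
    exact fun H => ⟨H.1, fun k hk => H.2 k (hk.trans_le h)⟩
  | .cons v₁ v₂, w => by
    cases w <;> simp only [ValRelBody, imp_self]
    exact And.imp (ValRelBody.mono h v₁ _) (ValRelBody.mono h v₂ _)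
  | .tuple vs, w => by
    cases w <;> simp only [ValRelBody, imp_self]
    exact ValRelBodyList.mono h vs _
  | .map l, w => by
    cases w <;> simp only [ValRelBody, imp_self]
    exact ValRelBodyItems.mono h l _
theorem ValRelBodyList.mono (h : m ≤ n) :
    ∀ vs ws : List Val, ValRelBodyList V n vs ws → ValRelBodyList V m vs ws
  | [], ws => by simp only [ValRelBodyList, imp_self]
  | v :: vs, ws => by
    cases ws <;> simp only [ValRelBodyList, imp_self]
    exact And.imp (ValRelBody.mono h v _) (ValRelBodyList.mono h vs _)
theorem ValRelBodyItems.mono (h : m ≤ n) :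
    ∀ l l' : List (Val × Val), ValRelBodyItems V n l l' → ValRelBodyItems V m l l'
  | [], l' => by simp only [ValRelBodyItems, imp_self]
  | (k, v) :: l, l' => by
    cases l' <;> simp only [ValRelBodyItems, imp_self]
    exact And.imp (ValRelBody.mono h k _)
      (And.imp (ValRelBody.mono h v _) (ValRelBodyItems.mono h l _))
end

end Mono

theorem ValRel.mono {m n : ℕ} {v w : Val} (h : ValRel n v w) (hm : m ≤ n) : ValRel m v w :=
  valRel_iff.2 ⟨h.closed_left, h.closed_right, h.body.mono hm⟩

theorem valsRel_mono {m n : ℕ} {vs ws : List Val} (h : List.Forall₂ (ValRel n) vs ws)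
    (hm : m ≤ n) : List.Forall₂ (ValRel m) vs ws :=
  h.imp fun _ _ h => h.mono hm

/-- Associations with related keys and related values. -/
def ItemRel (n : ℕ) (p q : Val × Val) : Prop := ValRel n p.1 q.1 ∧ ValRel n p.2 q.2

/-! ### Relatedness by the form of the value -/

section Forms
variable {n : ℕ}

theorem valRel_int {i : ℤ} {w : Val} : ValRel n (.int i) w ↔ w = .int i := by
  cases w <;> simp [valRel_iff, ValRelBody, Val.Closed, Val.fv, eq_comm]

theorem valRel_atom {a : Atom} {w : Val} : ValRel n (.atom a) w ↔ w = .atom a := by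
  cases w <;> simp [valRel_iff, ValRelBody, Val.Closed, Val.fv, eq_comm]

theorem valRel_nil {w : Val} : ValRel n .nil w ↔ w = .nil := by
  cases w <;> simp [valRel_iff, ValRelBody, Val.Closed, Val.fv]

theorem valRel_cons {v₁ v₂ w : Val} : ValRel n (.cons v₁ v₂) w ↔
    ∃ w₁ w₂, w = .cons w₁ w₂ ∧ ValRel n v₁ w₁ ∧ ValRel n v₂ w₂ := by
  cases w <;> simp [valRel_iff, ValRelBody, Val.Closed, Val.fv]
  tauto

/-- Closedness of a list is closedness of its entries, so the conditions of `ValRel` on entries and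
on the whole regroup. It allows work with `List.Forall₂` in place of the recursive relation on
lists. -/
theorem forall₂_valRel_iff : ∀ {vs ws : List Val}, List.Forall₂ (ValRel n) vs ws ↔
    Val.fvList vs = ∅ ∧ Val.fvList ws = ∅ ∧ ValRelBodyList ValRel n vs ws
  | [], [] => by simp [ValRelBodyList, Val.fvList]
  | [], w :: ws => by simp [ValRelBodyList]
  | v :: vs, [] => by simp [ValRelBodyList]
  | v :: vs, w :: ws => by
    rw [List.forall₂_cons, forall₂_valRel_iff (vs := vs), valRel_iff]
    simp only [Val.fvList, ValRelBodyList,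
      Val.Closed, Set.union_empty_iff]
    tauto

theorem forall₂_itemRel_iff : ∀ {l l' : List (Val × Val)}, List.Forall₂ (ItemRel n) l l' ↔
    Val.fvItems l = ∅ ∧ Val.fvItems l' = ∅ ∧ ValRelBodyItems ValRel n l l'
  | [], [] => by simp [ValRelBodyItems, Val.fvItems]
  | [], w :: ws => by simp [ValRelBodyItems]
  | v :: vs, [] => by simp [ValRelBodyItems]
  | v :: vs, w :: ws => by
    rw [List.forall₂_cons, forall₂_itemRel_iff (l := vs), ItemRel, valRel_iff, valRel_iff]
    simp only [Val.fvItems,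
      ValRelBodyItems, Val.Closed, Set.union_empty_iff]
    tauto

theorem valRel_tuple {vs : List Val} {w : Val} : ValRel n (.tuple vs) w ↔
    ∃ ws, w = .tuple ws ∧ List.Forall₂ (ValRel n) vs ws := by
  cases w <;> simp [valRel_iff, ValRelBody, Val.Closed, Val.fv, forall₂_valRel_iff]

theorem valRel_map {l : List (Val × Val)} {w : Val} : ValRel n (.map l) w ↔
    ∃ l', w = .map l' ∧ List.Forall₂ (ItemRel n) l l' := by
  cases w <;> simp [valRel_iff, ValRelBody, Val.Closed, Val.fv, forall₂_itemRel_iff]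

theorem valRel_clos {ext : List ClosItem} {xs : List Var} {e : Exp} {w : Val} :
    ValRel n (.clos ext xs e) w ↔ ∃ ext' xs' e', w = .clos ext' xs' e' ∧
      (Val.clos ext xs e).Closed ∧ (Val.clos ext' xs' e').Closed ∧
      ClosRelOf ValRel n ext xs e ext' xs' e' := by
  cases w <;> simp [valRel_iff, ValRelBody, Val.Closed, Val.fv]

theorem not_valRel_var {x : Var} {w : Val} : ¬ ValRel n (.var x) w := by
  simp [valRel_iff, ValRelBody]

theorem not_valRel_fid {f : Atom} {k : ℕ} {w : Val} : ¬ ValRel n (.fid f k) w := by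
  simp [valRel_iff, ValRelBody]

theorem ValRel.int (i : ℤ) : ValRel n (.int i) (.int i) := valRel_int.2 rfl

theorem ValRel.atom (a : Atom) : ValRel n (.atom a) (.atom a) := valRel_atom.2 rfl

theorem ValRel.nil : ValRel n .nil .nil := valRel_nil.2 rfl

theorem ValRel.cons {v₁ v₂ w₁ w₂ : Val} (h₁ : ValRel n v₁ w₁) (h₂ : ValRel n v₂ w₂) :
    ValRel n (.cons v₁ v₂) (.cons w₁ w₂) :=
  valRel_cons.2 ⟨_, _, rfl, h₁, h₂⟩

theorem ValRel.tuple {vs ws : List Val} (h : List.Forall₂ (ValRel n) vs ws) :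
    ValRel n (.tuple vs) (.tuple ws) :=
  valRel_tuple.2 ⟨_, rfl, h⟩

theorem ValRel.map {l l' : List (Val × Val)} (h : List.Forall₂ (ItemRel n) l l') :
    ValRel n (.map l) (.map l') :=
  valRel_map.2 ⟨_, rfl, h⟩

theorem ValRel.ofBool (b : Bool) : ValRel n (.ofBool b) (.ofBool b) := ValRel.atom _

/-- Two related values are of the same form, and their parts are related. -/
inductive ValRelCases (n : ℕ) : Val → Val → Prop
  | int (i) : ValRelCases n (.int i) (.int i)
  | atom (a) : ValRelCases n (.atom a) (.atom a)
  | nil : ValRelCases n .nil .nil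
  | cons {v₁ v₂ w₁ w₂} (h₁ : ValRel n v₁ w₁) (h₂ : ValRel n v₂ w₂) :
    ValRelCases n (.cons v₁ v₂) (.cons w₁ w₂)
  | tuple {vs ws} (h : List.Forall₂ (ValRel n) vs ws) : ValRelCases n (.tuple vs) (.tuple ws)
  | map {l l'} (h : List.Forall₂ (ItemRel n) l l') : ValRelCases n (.map l) (.map l')
  | clos {ext xs e ext' xs' e'} (h : ClosRelOf ValRel n ext xs e ext' xs' e') :
    ValRelCases n (.clos ext xs e) (.clos ext' xs' e')

theorem ValRel.cases {v w : Val} (h : ValRel n v w) : ValRelCases n v w := by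
  cases v with
  | int i => rw [valRel_int.1 h]; exact .int i
  | atom a => rw [valRel_atom.1 h]; exact .atom a
  | var x => exact (not_valRel_var h).elim
  | fid f k => exact (not_valRel_fid h).elim
  | nil => rw [valRel_nil.1 h]; exact .nil
  | cons v₁ v₂ =>
    obtain ⟨_, _, rfl, h₁, h₂⟩ := valRel_cons.1 h
    exact .cons h₁ h₂
  | tuple vs =>
    obtain ⟨_, rfl, h'⟩ := valRel_tuple.1 h
    exact .tuple h'
  | map l =>
    obtain ⟨_, rfl, h'⟩ := valRel_map.1 h
    exact .map h'
  | clos ext xs e =>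
    obtain ⟨_, _, _, rfl, _, _, h⟩ := valRel_clos.1 h
    exact .clos h

end Forms

/-! ### The term order -/

mutual
-- The order reads constructors, integers, atoms, sizes and arities, and related values agree in all
-- of these. The arity is part of the closure relation even at index `0`, so the comparison is
-- determined without running any function body.
theorem Val.cmp_congr {n : ℕ} : ∀ (v : Val) {v' w w' : Val}, ValRel n v v' → ValRel n w w' →
    v.cmp w = v'.cmp w'
  | .int i, v', w, w', hv, hw => by
    cases hv.cases; cases hw.cases <;> simp [Val.cmp, Val.rank]
  | .atom i, v', w, w', hv, hw => by
    cases hv.cases; cases hw.cases <;> simp [Val.cmp, Val.rank]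
  | .var x, _, _, _, hv, _ => (not_valRel_var hv).elim
  | .fid _ _, _, _, _, hv, _ => (not_valRel_fid hv).elim
  | .nil, v', w, w', hv, hw => by
    cases hv.cases; cases hw.cases <;> simp [Val.cmp, Val.rank]
  | .clos ext xs e, v', w, w', hv, hw => by
    cases hv.cases with | clos h =>
    cases hw.cases with
    | clos h' => simp [Val.cmp, h.1, h'.1]
    | _ => simp [Val.cmp, Val.rank]
  | .cons v₁ v₂, v', w, w', hv, hw => by
    cases hv.cases with | cons h₁ h₂ =>
    cases hw.cases with
    | cons h₁' h₂' => simp only [Val.cmp, Val.cmp_congr v₁ h₁ h₁', Val.cmp_congr v₂ h₂ h₂']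
    | _ => simp [Val.cmp, Val.rank]
  | .tuple vs, v', w, w', hv, hw => by
    cases hv.cases with | tuple h =>
    cases hw.cases with
    | tuple h' => simp only [Val.cmp, Val.cmpList_congr vs h h', h.length_eq, h'.length_eq]
    | _ => simp [Val.cmp, Val.rank]
  | .map l, v', w, w', hv, hw => by
    cases hv.cases with | map h =>
    cases hw.cases with
    | map h' =>
      simp only [Val.cmp, Val.cmpKeys_congr l h h', Val.cmpValues_congr l h h', h.length_eq,
        h'.length_eq]
    | _ => simp [Val.cmp, Val.rank]
theorem Val.cmpList_congr {n : ℕ} : ∀ (vs : List Val) {vs' ws ws' : List Val},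
    List.Forall₂ (ValRel n) vs vs' → List.Forall₂ (ValRel n) ws ws' →
    Val.cmpList vs ws = Val.cmpList vs' ws'
  | [], _, _, _, h, _ => by cases h; simp only [Val.cmpList]
  | v :: vs, _, _, _, h, h' => by
    cases h with | cons h₁ h₂ =>
    cases h' with
    | nil => simp only [Val.cmpList]
    | cons h₁' h₂' => simp only [Val.cmpList, Val.cmp_congr v h₁ h₁', Val.cmpList_congr vs h₂ h₂']
theorem Val.cmpKeys_congr {n : ℕ} : ∀ (l : List (Val × Val)) {l₁ l₂ l₃ : List (Val × Val)},
    List.Forall₂ (ItemRel n) l l₁ → List.Forall₂ (ItemRel n) l₂ l₃ →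
    Val.cmpKeys l l₂ = Val.cmpKeys l₁ l₃
  | [], _, _, _, h, _ => by cases h; simp only [Val.cmpKeys]
  | (k, v) :: l, (k', v') :: _, _, _, h, h' => by
    cases h with | cons h₁ h₂ =>
    cases h' with
    | nil => simp only [Val.cmpKeys]
    | @cons a b _ _ h₁' h₂' =>
      obtain ⟨a, a'⟩ := a
      obtain ⟨b, b'⟩ := b
      simp only [Val.cmpKeys, Val.cmp_congr k h₁.1 h₁'.1, Val.cmpKeys_congr l h₂ h₂']
theorem Val.cmpValues_congr {n : ℕ} : ∀ (l : List (Val × Val)) {l₁ l₂ l₃ : List (Val × Val)},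
    List.Forall₂ (ItemRel n) l l₁ → List.Forall₂ (ItemRel n) l₂ l₃ →
    Val.cmpValues l l₂ = Val.cmpValues l₁ l₃
  | [], _, _, _, h, _ => by cases h; simp only [Val.cmpValues]
  | (k, v) :: l, (k', v') :: _, _, _, h, h' => by
    cases h with | cons h₁ h₂ =>
    cases h' with
    | nil => simp only [Val.cmpValues]
    | @cons a b _ _ h₁' h₂' =>
      obtain ⟨a, a'⟩ := a
      obtain ⟨b, b'⟩ := b
      simp only [Val.cmpValues, Val.cmp_congr v h₁.2 h₁'.2, Val.cmpValues_congr l h₂ h₂']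
end

theorem ValRel.cmp_eq {n : ℕ} {v v' w w' : Val} (hv : ValRel n v v') (hw : ValRel n w w') :
    v.cmp w = v'.cmp w' :=
  Val.cmp_congr v hv hw

theorem ValRel.eqb_eq {n : ℕ} {v v' w w' : Val} (hv : ValRel n v v') (hw : ValRel n w w') :
    v.eqb w = v'.eqb w' := by
  rw [Val.eqb, Val.eqb, hv.cmp_eq hw]

/-! ## Built-in functions on related values -/

/-- Related results and related expressions. -/
inductive OutcomeRel (n : ℕ) : Redex → Redex → Prop
  | vals {vs ws} (h : List.Forall₂ (ValRel n) vs ws) : OutcomeRel n (.vals vs) (.vals ws)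
  | exc {x y} (h : ExcRel n x y) : OutcomeRel n (.exc x) (.exc y)
  | exp {e e'} (h : ExpRel n e e') : OutcomeRel n (.exp e) (.exp e')

section Builtins
variable {n : ℕ}

theorem OutcomeRel.val {v w : Val} (h : ValRel n v w) : OutcomeRel n (.vals [v]) (.vals [w]) :=
  .vals (.cons h .nil)

theorem ExcRel.mk {c : ExcClass} {v v' w w' : Val} (hv : ValRel n v v') (hw : ValRel n w w') :
    ExcRel n ⟨c, v, w⟩ ⟨c, v', w'⟩ :=
  ⟨rfl, hv, hw⟩

theorem ExcRel.mono {m n : ℕ} {x y : Exc} (h : ExcRel n x y) (hm : m ≤ n) : ExcRel m x y :=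
  ⟨h.1, h.2.1.mono hm, h.2.2.mono hm⟩

theorem ExcRel.errorExc (a : Atom) {v w : Val} (h : ValRel n v w) :
    ExcRel n (errorExc a v) (errorExc a w) :=
  .mk (.atom a) h

theorem undefCall_rel (f : Atom) : OutcomeRel n (undefCall f) (undefCall f) :=
  .exc (.errorExc _ (.atom f))

theorem truth_rel {b c : Bool} (h : b = c) : OutcomeRel n (truth b) (truth c) :=
  .val (h ▸ .ofBool b)

theorem resultOr_rel (a f : Atom) {args args' : List Val} {o o' : Option Val}
    (ha : List.Forall₂ (ValRel n) args args') (h : Option.Rel (ValRel n) o o') :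
    OutcomeRel n (resultOr a f args o) (resultOr a f args' o') := by
  cases h with
  | none => exact .exc (.errorExc _ (.tuple (.cons (.atom f) ha)))
  | some h => exact .val h

theorem optionRel_map {α β γ δ : Type*} {R : α → β → Prop} {S : γ → δ → Prop} {o : Option α}
    {o' : Option β} {f : α → γ} {g : β → δ} (h : Option.Rel R o o')
    (hf : ∀ a b, R a b → S (f a) (g b)) : Option.Rel S (o.map f) (o'.map g) := by
  cases h with
  | none => exact .none
  | some h => exact .some (hf _ _ h)

theorem ValRel.toBool_eq {v w : Val} (h : ValRel n v w) : v.toBool = w.toBool := by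
  cases h.cases <;> simp only [Val.toBool]

theorem ValRel.elems_rel : ∀ {v w : Val}, ValRel n v w →
    Option.Rel (List.Forall₂ (ValRel n)) v.elems w.elems
  | .cons v₁ v₂, w, h => by
    obtain ⟨w₁, w₂, rfl, h₁, h₂⟩ := valRel_cons.1 h
    exact optionRel_map (ValRel.elems_rel h₂) fun _ _ h => .cons h₁ h
  | .nil, w, h => by cases h.cases; exact .some .nil
  | .int _, w, h => by cases h.cases; exact .none
  | .atom _, w, h => by cases h.cases; exact .none
  | .tuple _, w, h => by cases h.cases; exact .none
  | .map _, w, h => by cases h.cases; exact .none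
  | .clos _ _ _, w, h => by cases h.cases; exact .none
  | .var _, w, h => (not_valRel_var h).elim
  | .fid _ _, w, h => (not_valRel_fid h).elim

theorem ofElems_rel {vs ws : List Val} {v w : Val} (h : List.Forall₂ (ValRel n) vs ws)
    (hv : ValRel n v w) : ValRel n (.ofElems vs v) (.ofElems ws w) := by
  induction h with
  | nil => exact hv
  | cons h _ ih => exact .cons h ih

theorem removeFirst_rel {v w : Val} {vs ws : List Val} (hv : ValRel n v w)
    (h : List.Forall₂ (ValRel n) vs ws) :
    List.Forall₂ (ValRel n) (removeFirst v vs) (removeFirst w ws) := by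
  induction h with
  | nil => exact .nil
  | cons h hs ih =>
    -- The equality test has the same outcome on both sides, so both lists lose the entry at the
    -- same position.
    rw [removeFirst, removeFirst, h.eqb_eq hv]
    split_ifs
    · exact hs
    · exact .cons h ih

theorem foldl_removeFirst_rel {us us' vs vs' : List Val} (hu : List.Forall₂ (ValRel n) us us')
    (hv : List.Forall₂ (ValRel n) vs vs') :
    List.Forall₂ (ValRel n) (us.foldl (fun l x => removeFirst x l) vs)
      (us'.foldl (fun l x => removeFirst x l) vs') := by
  induction hu generalizing vs vs' with
  | nil => exact hv
  | cons h _ ih => exact ih (removeFirst_rel h hv)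

theorem arith_rel (f : Atom) (op : ℤ → ℤ → Option ℤ) {v v' w w' : Val} (hv : ValRel n v v')
    (hw : ValRel n w w') : OutcomeRel n (arith f op v w) (arith f op v' w') := by
  refine resultOr_rel _ _ (.cons hv (.cons hw .nil)) ?_
  cases hv.cases with
  | int i =>
    cases hw.cases with
    | int j =>
      dsimp only
      cases op i j with
      | none => exact .none
      | some k => exact .some (.int k)
    | _ => exact .none
  | _ => exact .none

theorem boolOp_rel (f : Atom) (op : Bool → Bool → Bool) {v v' w w' : Val} (hv : ValRel n v v')
    (hw : ValRel n w w') : OutcomeRel n (boolOp f op v w) (boolOp f op v' w') := by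
  refine resultOr_rel _ _ (.cons hv (.cons hw .nil)) ?_
  rw [hv.toBool_eq, hw.toBool_eq]
  cases v'.toBool <;> cases w'.toBool <;> constructor
  exact .ofBool _

theorem get?_rel {vs ws : List Val} (h : List.Forall₂ (ValRel n) vs ws) :
    ∀ i : ℕ, Option.Rel (ValRel n) vs[i]? ws[i]? := by
  induction h with
  | nil => exact fun _ => .none
  | cons h _ ih =>
    rintro (_ | i)
    · exact .some h
    · simpa using ih i

theorem set_rel {vs ws : List Val} {v w : Val} (h : List.Forall₂ (ValRel n) vs ws)
    (hv : ValRel n v w) : ∀ i : ℕ, List.Forall₂ (ValRel n) (vs.set i v) (ws.set i w) := by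
  induction h with
  | nil => exact fun _ => .nil
  | cons h hs ih =>
    rintro (_ | i)
    · exact .cons hv hs
    · exact .cons h (ih i)

theorem ite_rel {p : Prop} [Decidable p] {r s r' s' : Redex} (hr : p → OutcomeRel n r r')
    (hs : ¬ p → OutcomeRel n s s') :
    OutcomeRel n (if p then r else s) (if p then r' else s') := by
  split_ifs with h
  · exact hr h
  · exact hs h

theorem evalBif1_rel (f : Atom) {v w : Val} (h : ValRel n v w) :
    OutcomeRel n (evalBif1 f v) (evalBif1 f w) := by
  have ha : List.Forall₂ (ValRel n) [v] [w] := .cons h .nil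
  unfold evalBif1
  -- Both sides test the same atom `f`, so the two chains of conditionals are split in parallel,
  -- leaving one goal for each group of built-in functions.
  repeat' refine ite_rel (fun _ => ?_) (fun _ => ?_)
  · refine resultOr_rel _ _ ha ?_
    cases h.cases <;> constructor; exact .int _
  · refine resultOr_rel _ _ ha ?_
    cases h.cases <;> constructor; exact .int _
  · refine resultOr_rel _ _ ha ?_
    cases h.cases <;> constructor; exact .int _
  · refine resultOr_rel _ _ ha ?_
    rw [h.toBool_eq]
    cases w.toBool <;> constructor; exact .ofBool _
  · refine resultOr_rel _ _ ha ?_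
    cases h.cases <;> constructor
    exact ofElems_rel ‹_› .nil
  · refine resultOr_rel _ _ ha ?_
    exact optionRel_map h.elems_rel fun _ _ h => .tuple h
  · refine resultOr_rel _ _ ha ?_
    exact optionRel_map h.elems_rel fun _ _ h => h.length_eq ▸ .int _
  · refine resultOr_rel _ _ ha ?_
    cases h.cases with
    | tuple h' => exact .some (h'.length_eq ▸ .int _)
    | _ => exact .none
  · refine resultOr_rel _ _ ha ?_
    cases h.cases <;> constructor; assumption
  · refine resultOr_rel _ _ ha ?_
    cases h.cases <;> constructor; assumption
  · exact truth_rel (by cases h.cases <;> rfl)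
  · exact truth_rel (by cases h.cases <;> rfl)
  · exact truth_rel (by rw [h.toBool_eq])
  · exact truth_rel (by cases h.cases <;> rfl)
  · exact truth_rel (by cases h.cases <;> rfl)
  · exact truth_rel (by cases h.cases <;> rfl)
  · exact truth_rel (by cases h.cases <;> rfl)
  · exact .exc (.mk h .nil)
  · exact .exc (.mk h .nil)
  · exact .exc (.mk h .nil)
  · exact undefCall_rel f

theorem evalBif2_rel (f : Atom) {v v' w w' : Val} (hv : ValRel n v v') (hw : ValRel n w w') :
    OutcomeRel n (evalBif2 f v w) (evalBif2 f v' w') := by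
  have ha : List.Forall₂ (ValRel n) [v, w] [v', w'] := .cons hv (.cons hw .nil)
  unfold evalBif2
  repeat' refine ite_rel (fun _ => ?_) (fun _ => ?_)
  · exact arith_rel f _ hv hw
  · exact arith_rel f _ hv hw
  · exact arith_rel f _ hv hw
  · exact arith_rel f _ hv hw
  · exact arith_rel f _ hv hw
  · exact arith_rel f _ hv hw
  · exact arith_rel f _ hv hw
  · exact boolOp_rel f _ hv hw
  · exact boolOp_rel f _ hv hw
  · exact boolOp_rel f _ hv hw
  · exact truth_rel (hv.eqb_eq hw)
  · exact truth_rel (by rw [hv.eqb_eq hw])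
  · exact truth_rel (by rw [hv.cmp_eq hw])
  · exact truth_rel (by rw [hv.cmp_eq hw])
  · exact truth_rel (by rw [hv.cmp_eq hw])
  · exact truth_rel (by rw [hv.cmp_eq hw])
  · refine resultOr_rel _ _ ha ?_
    exact optionRel_map hv.elems_rel fun _ _ h => ofElems_rel h hw
  · refine resultOr_rel _ _ ha ?_
    have hv' := hv.elems_rel
    have hw' := hw.elems_rel
    generalize v.elems = o₁, v'.elems = o₁' at hv'
    generalize w.elems = o₂, w'.elems = o₂' at hw'
    cases hv' with
    | none => exact .none
    | some h =>
      cases hw' with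
      | none => exact .none
      | some h' => exact .some (ofElems_rel (foldl_removeFirst_rel h' h) .nil)
  · refine resultOr_rel _ _ ha ?_
    cases hv.cases with
    | int i =>
      cases hw.cases with
      | tuple h =>
        dsimp only
        split_ifs
        · exact get?_rel h _
        · exact .none
      | _ => exact .none
    | _ => exact .none
  · refine resultOr_rel _ _ ha ?_
    cases hw.cases with
    | int j =>
      dsimp only
      split_ifs
      · exact .none
      · cases hv.cases with
        | clos h =>
          dsimp only
          rw [h.1]
          exact .some (.ofBool _)
        | _ => exact .some (.ofBool _)
    | _ => exact .none
  · exact .exc (.mk hv hw)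
  · exact undefCall_rel f

theorem evalBif3_rel (f : Atom) {u u' v v' w w' : Val} (hu : ValRel n u u') (hv : ValRel n v v')
    (hw : ValRel n w w') : OutcomeRel n (evalBif3 f u v w) (evalBif3 f u' v' w') := by
  unfold evalBif3
  refine ite_rel (fun _ => ?_) (fun _ => undefCall_rel f)
  refine resultOr_rel _ _ (.cons hu (.cons hv (.cons hw .nil))) ?_
  cases hu.cases with
  | int i =>
    cases hv.cases with
    | tuple h =>
      dsimp only
      -- Related tuples have the same size, so the bound on the position holds on both sides or on
      -- neither.
      rw [h.length_eq]
      split_ifs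
      · exact .some (.tuple (set_rel h hw _))
      · exact .none
    | _ => exact .none
  | _ => exact .none

theorem evalCall_rel (m f : Atom) {vs ws : List Val} (h : List.Forall₂ (ValRel n) vs ws) :
    OutcomeRel n (evalCall m f vs) (evalCall m f ws) := by
  unfold evalCall
  refine ite_rel (fun _ => ?_) (fun _ => undefCall_rel f)
  rcases h with _ | ⟨h₁, _ | ⟨h₂, _ | ⟨h₃, _ | ⟨_, _⟩⟩⟩⟩
  · exact undefCall_rel f
  · exact evalBif1_rel f h₁
  · exact evalBif2_rel f h₁ h₂
  · exact evalBif3_rel f h₁ h₂ h₃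
  · exact undefCall_rel f

theorem evalPrimop_rel (a : Atom) {vs ws : List Val} (h : List.Forall₂ (ValRel n) vs ws) :
    OutcomeRel n (evalPrimop a vs) (evalPrimop a ws) := by
  unfold evalPrimop
  rcases h with _ | ⟨h₁, _ | ⟨h₂, _ | ⟨_, _⟩⟩⟩
  · exact undefCall_rel a
  · exact ite_rel (fun _ => .exc (.mk h₁ .nil)) (fun _ => undefCall_rel a)
  · exact ite_rel (fun _ => .exc (.mk h₂ h₁)) (fun _ => undefCall_rel a)
  · exact undefCall_rel a

/-! ### Maps -/

/-- Comparing the new key with a present one gives the same ordering on both sides, so both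
insertions take the same branch. -/
theorem mapInsert_rel {k k' v v' : Val} (hk : ValRel n k k') (hv : ValRel n v v')
    {l l' : List (Val × Val)} (h : List.Forall₂ (ItemRel n) l l') :
    List.Forall₂ (ItemRel n) (mapInsert k v l) (mapInsert k' v' l') := by
  induction h with
  | nil => exact .cons ⟨hk, hv⟩ .nil
  | @cons p q _ _ h hs ih =>
    obtain ⟨p₁, p₂⟩ := p
    obtain ⟨q₁, q₂⟩ := q
    rw [mapInsert, mapInsert, hk.cmp_eq h.1]
    cases k'.cmp q₁
    · exact .cons ⟨hk, hv⟩ (.cons h hs)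
    · exact .cons h hs
    · exact .cons h ih

theorem mkMap_rel {l l' : List (Val × Val)} (h : List.Forall₂ (ItemRel n) l l') :
    List.Forall₂ (ItemRel n) (mkMap l) (mkMap l') := by
  induction h with
  | nil => exact .nil
  | cons h _ ih => exact mapInsert_rel h.1 h.2 ih

theorem toPairs_rel : ∀ {vs ws : List Val}, List.Forall₂ (ValRel n) vs ws →
    Option.Rel (List.Forall₂ (ItemRel n)) (toPairs vs) (toPairs ws)
  | _, _, .nil => .some .nil
  | _, _, .cons _ .nil => .none
  | _, _, .cons h₁ (.cons h₂ h) => by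
    exact optionRel_map (toPairs_rel h) fun _ _ h => .cons ⟨h₁, h₂⟩ h

/-! ### Frame identifiers -/

/-- Related frame identifiers. -/
inductive FrameIdRel (n : ℕ) : FrameId → FrameId → Prop
  | tuple : FrameIdRel n .tuple .tuple
  | values : FrameIdRel n .values .values
  | map : FrameIdRel n .map .map
  | call {vm vm' vf vf'} (hm : ValRel n vm vm') (hf : ValRel n vf vf') :
    FrameIdRel n (.call vm vf) (.call vm' vf')
  | primop (a) : FrameIdRel n (.primop a) (.primop a)
  | app {v v'} (h : ValRel n v v') : FrameIdRel n (.app v) (.app v')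

theorem FrameIdRel.mono {m n : ℕ} {id id' : FrameId} (h : FrameIdRel n id id') (hm : m ≤ n) :
    FrameIdRel m id id' := by
  cases h with
  | tuple => exact .tuple
  | values => exact .values
  | map => exact .map
  | call h₁ h₂ => exact .call (h₁.mono hm) (h₂.mono hm)
  | primop a => exact .primop a
  | app h => exact .app (h.mono hm)

theorem FrameIdRel.closed {id id' : FrameId} (h : FrameIdRel n id id') :
    id.fv = ∅ ∧ id'.fv = ∅ := by
  cases h with
  | call h₁ h₂ =>
    simp only [FrameId.fv, Set.union_empty_iff]
    exact ⟨⟨h₁.closed_left, h₂.closed_left⟩, h₁.closed_right, h₂.closed_right⟩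
  | app h => exact ⟨h.closed_left, h.closed_right⟩
  | _ => exact ⟨rfl, rfl⟩

theorem FrameIdRel.ne_map {id id' : FrameId} (h : FrameIdRel n id id') (hid : id ≠ .map) :
    id' ≠ .map := by
  cases h <;> simp_all

/-- Evaluation of a parameter frame takes one step, in which related closures become related
expressions. -/
theorem FrameIdRel.eval {id id' : FrameId} {vs ws : List Val} {r : Redex}
    (h : FrameIdRel (n + 1) id id') (hv : List.Forall₂ (ValRel (n + 1)) vs ws)
    (hr : eval id vs = some r) : ∃ r', eval id' ws = some r' ∧ OutcomeRel n r r' := by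
  have hv' : List.Forall₂ (ValRel n) vs ws := valsRel_mono hv n.le_succ
  -- The weaker relation is saved before the case split: error exceptions carry the values of the
  -- identifier, and they are needed at index `n`.
  have hid := h.mono n.le_succ
  cases h with
  | tuple =>
    cases hr
    exact ⟨_, rfl, .val (.tuple hv')⟩
  | values =>
    cases hr
    exact ⟨_, rfl, .vals hv'⟩
  | map =>
    rw [CoreErlang.eval, Option.map_eq_some_iff] at hr
    obtain ⟨l, hl, rfl⟩ := hr
    have := toPairs_rel hv'
    rw [hl] at this
    rw [CoreErlang.eval]
    generalize toPairs ws = o at this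
    cases this with | some h => exact ⟨_, rfl, .val (.map (mkMap_rel h))⟩
  | primop a =>
    cases hr
    exact ⟨_, rfl, evalPrimop_rel a hv'⟩
  | call hm hf =>
    cases hid with | call hm' hf' =>
    have hx := (ExcRel.errorExc .badfun (.tuple (.cons hm' (.cons hf' .nil))))
    cases hm.cases with
    | atom m =>
      cases hf.cases with
      | atom f =>
        cases hr
        exact ⟨_, rfl, evalCall_rel m f hv'⟩
      | _ =>
        cases hr
        exact ⟨_, rfl, .exc hx⟩
    | _ =>
      cases hr
      exact ⟨_, rfl, .exc hx⟩
  | app h =>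
    cases hid with | app h' =>
    have hx := ExcRel.errorExc .badfun h'
    have hx' := ExcRel.errorExc .badarity h'
    cases h.cases with
    | clos hc =>
      rw [CoreErlang.eval] at hr ⊢
      -- Related closures have the same arity and the argument lists the same length, so the arity
      -- test is the same on both sides.
      rw [← hc.1, ← hv.length_eq]
      split_ifs at hr ⊢ with hl
      · cases hr
        -- The closures are related at `n + 1`, so their bodies are related at `n` and at no larger
        -- index that is guaranteed. This is the place where the index has to drop.
        exact ⟨_, rfl, .exp (hc.2 n n.lt_succ_self _ _ hl.symm hv')⟩
      · cases hr
        exact ⟨_, rfl, .exc hx'⟩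
    | _ =>
      cases hr
      exact ⟨_, rfl, .exc hx⟩

/-! ### Pattern matching -/

/-- Bindings of the same names to related values. -/
abbrev BindRel (n : ℕ) : List (Name × Val) → List (Name × Val) → Prop :=
  List.Forall₂ fun p q => p.1 = q.1 ∧ ValRel n p.2 q.2

theorem BindRel.append {l₁ l₁' l₂ l₂' : List (Name × Val)} (h₁ : BindRel n l₁ l₁')
    (h₂ : BindRel n l₂ l₂') : BindRel n (l₁ ++ l₂) (l₁' ++ l₂') :=
  List.rel_append h₁ h₂

theorem bind_append_rel {o₁ o₁' o₂ o₂' : Option (List (Name × Val))}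
    (h₁ : Option.Rel (BindRel n) o₁ o₁') (h₂ : Option.Rel (BindRel n) o₂ o₂') :
    Option.Rel (BindRel n) (do return (← o₁) ++ (← o₂)) (do return (← o₁') ++ (← o₂')) := by
  cases h₁ with
  | none => exact .none
  | some h₁ =>
    cases h₂ with
    | none => exact .none
    | some h₂ => exact .some (h₁.append h₂)

mutual
-- A pattern inspects only integers, atoms, constructors and lengths; a closure can be met by a
-- variable pattern alone. Hence matching fails on both sides, or succeeds on both with related
-- bindings.
theorem Pat.bindings_rel : ∀ (p : Pat) {v w : Val}, ValRel n v w →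
    Option.Rel (BindRel n) (p.bindings v) (p.bindings w)
  | .int i, _, _, h => by
    cases h.cases with
    | int j =>
      simp only [Pat.bindings]
      split_ifs
      · exact .some .nil
      · exact .none
    | _ => exact .none
  | .atom a, _, _, h => by
    cases h.cases with
    | atom j =>
      simp only [Pat.bindings]
      split_ifs
      · exact .some .nil
      · exact .none
    | _ => exact .none
  | .var x, _, _, h => .some (.cons ⟨rfl, h⟩ .nil)
  | .nil, _, _, h => by
    cases h.cases with
    | nil => exact .some .nil
    | _ => exact .none
  | .cons p₁ p₂, _, _, h => by
    cases h.cases with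
    | cons h₁ h₂ => exact bind_append_rel (Pat.bindings_rel p₁ h₁) (Pat.bindings_rel p₂ h₂)
    | _ => exact .none
  | .tuple ps, _, _, h => by
    cases h.cases with
    | tuple h' => exact Pat.bindingsList_rel ps h'
    | _ => exact .none
  | .map l, _, _, h => by
    cases h.cases with
    | map h' => exact Pat.bindingsItems_rel l h'
    | _ => exact .none
theorem Pat.bindingsList_rel : ∀ (ps : List Pat) {vs ws : List Val},
    List.Forall₂ (ValRel n) vs ws →
      Option.Rel (BindRel n) (Pat.bindingsList ps vs) (Pat.bindingsList ps ws)
  | [], _, _, .nil => .some .nil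
  | [], _, _, .cons _ _ => .none
  | _ :: _, _, _, .nil => .none
  | p :: ps, _, _, .cons h₁ h₂ =>
    bind_append_rel (Pat.bindings_rel p h₁) (Pat.bindingsList_rel ps h₂)
theorem Pat.bindingsItems_rel : ∀ (ps : List (Pat × Pat)) {l l' : List (Val × Val)},
    List.Forall₂ (ItemRel n) l l' →
      Option.Rel (BindRel n) (Pat.bindingsItems ps l) (Pat.bindingsItems ps l')
  | [], _, _, .nil => .some .nil
  | [], _, _, .cons _ _ => .none
  | (_, _) :: _, _, _, .nil => .none
  | (p, q) :: ps, (v, w) :: l, (v', w') :: l', .cons h₁ h₂ => by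
    -- An association contributes the bindings of its key and of its value; the three-fold
    -- concatenation is regrouped as two binary ones.
    have := bind_append_rel
      (bind_append_rel (Pat.bindings_rel p h₁.1) (Pat.bindings_rel q h₁.2))
      (Pat.bindingsItems_rel ps h₂)
    simpa [Pat.bindingsItems, Option.bind_assoc] using this
end

end Builtins

-- Names bound by parameter lists, function collections and matches

/-- The names that a list of bindings binds. -/
def boundNames (l : List (Name × Val)) : Set Name := {y | y ∈ l.map Prod.fst}

theorem boundNames_append (l l' : List (Name × Val)) :
    boundNames (l ++ l') = boundNames l ∪ boundNames l' := by
  ext y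
  simp [boundNames]

/-- Equal lengths matter: `zip` would silently drop surplus parameters. -/
theorem boundNames_bindVars {xs : List Var} {vs : List Val} (h : xs.length = vs.length) :
    boundNames (bindVars xs vs) = varNames xs := by
  ext y
  rw [boundNames, bindVars, List.map_fst_zip (by simp [h])]
  simp [varNames, eq_comm]

theorem boundNames_mkClosList (ext : List ClosItem) :
    boundNames (mkClosList ext) = namesOf ext := by
  ext y
  simp [boundNames, mkClosList, namesOf, eq_comm]

theorem bind_append_eq_some {o₁ o₂ : Option (List (Name × Val))} {l : List (Name × Val)}
    (h : (do return (← o₁) ++ (← o₂) : Option (List (Name × Val))) = some l) :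
    ∃ l₁ l₂, o₁ = some l₁ ∧ o₂ = some l₂ ∧ boundNames l = boundNames l₁ ∪ boundNames l₂ := by
  cases o₁ with
  | none => cases h
  | some l₁ =>
    cases o₂ with
    | none => cases h
    | some l₂ =>
      cases h
      exact ⟨_, _, rfl, rfl, boundNames_append _ _⟩

mutual
-- A successful match binds the variables of the pattern and nothing else, so its bindings close
-- guards and bodies that are open in exactly these variables.
theorem Pat.boundNames_bindings : ∀ (p : Pat) {v : Val} {l : List (Name × Val)},
    p.bindings v = some l → boundNames l = p.vars
  | .int i, v, l, h => by
    cases v <;> simp only [Pat.bindings, reduceCtorEq] at h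
    split_ifs at h
    cases h
    simp [boundNames, Pat.vars]
  | .atom a, v, l, h => by
    cases v <;> simp only [Pat.bindings, reduceCtorEq] at h
    split_ifs at h
    cases h
    simp [boundNames, Pat.vars]
  | .var x, v, l, h => by
    cases h
    simp [boundNames, Pat.vars]
  | .nil, v, l, h => by
    cases v <;> simp only [Pat.bindings, reduceCtorEq] at h
    cases h
    simp [boundNames, Pat.vars]
  | .cons p₁ p₂, v, l, h => by
    cases v <;> simp only [Pat.bindings, reduceCtorEq] at h
    obtain ⟨l₁, l₂, h₁, h₂, hl⟩ := bind_append_eq_some h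
    rw [hl, Pat.boundNames_bindings p₁ h₁, Pat.boundNames_bindings p₂ h₂, Pat.vars]
  | .tuple ps, v, l, h => by
    cases v <;> simp only [Pat.bindings, reduceCtorEq] at h
    rw [Pat.boundNames_bindingsList ps h, Pat.vars]
  | .map ps, v, l, h => by
    cases v <;> simp only [Pat.bindings, reduceCtorEq] at h
    rw [Pat.boundNames_bindingsItems ps h, Pat.vars]
theorem Pat.boundNames_bindingsList : ∀ (ps : List Pat) {vs : List Val} {l : List (Name × Val)},
    Pat.bindingsList ps vs = some l → boundNames l = Pat.varsList ps
  | [], [], l, h => by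
    cases h
    simp [boundNames, Pat.varsList]
  | [], _ :: _, l, h => by cases h
  | _ :: _, [], l, h => by cases h
  | p :: ps, v :: vs, l, h => by
    obtain ⟨l₁, l₂, h₁, h₂, hl⟩ := bind_append_eq_some h
    rw [hl, Pat.boundNames_bindings p h₁, Pat.boundNames_bindingsList ps h₂, Pat.varsList]
theorem Pat.boundNames_bindingsItems : ∀ (ps : List (Pat × Pat)) {vs : List (Val × Val)}
    {l : List (Name × Val)}, Pat.bindingsItems ps vs = some l → boundNames l = Pat.varsItems ps
  | [], [], l, h => by
    cases h
    simp [boundNames, Pat.varsItems]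
  | [], _ :: _, l, h => by cases h
  | (_, _) :: _, [], l, h => by cases h
  | (p, q) :: ps, (v, w) :: vs, l, h => by
    obtain ⟨l₀, l₃, h₀, h₃, hl⟩ := bind_append_eq_some
      (o₁ := do return (← p.bindings v) ++ (← q.bindings w)) (o₂ := Pat.bindingsItems ps vs)
      (by simpa [Pat.bindingsItems, Option.bind_assoc] using h)
    obtain ⟨l₁, l₂, h₁, h₂, hl'⟩ := bind_append_eq_some h₀
    rw [hl, hl', Pat.boundNames_bindings p h₁, Pat.boundNames_bindings q h₂,
      Pat.boundNames_bindingsItems ps h₃, Pat.varsItems]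
end

/-! ## Termination -/

/-- A run of length `0` ends in a result on the empty stack. This is excluded, so there is a first
step, and one unit of the index can be spent. -/
theorem TermIn.exists_step {K : FrameStack} {r : Redex} {n : ℕ} (h : TermIn K r n)
    (hK : K = [] → ¬ r.IsResult) :
    ∃ m K' r', n = m + 1 ∧ Step K r K' r' ∧ TermIn K' r' m := by
  obtain ⟨res, hres, h⟩ := h
  cases h with
  | refl => exact (hK rfl hres).elim
  | step h t => exact ⟨_, _, _, rfl, h, res, hres, t⟩

/-- The right-hand side of the relations carries no step count, so an answering step may be added
freely. -/
theorem Step.terminates {K K' : FrameStack} {r r' : Redex} (h : Step K r K' r')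
    (ht : Terminates K' r') : Terminates K r := by
  obtain ⟨n, res, hres, t⟩ := ht
  exact ⟨n + 1, res, hres, .step h t⟩

/-! ## Related stacks and related closed expressions -/

theorem StackRel.mono {m n : ℕ} {K₁ K₂ : FrameStack} (h : StackRel n K₁ K₂) (hm : m ≤ n) :
    StackRel m K₁ K₂ :=
  ⟨h.1, h.2.1, fun k hk => h.2.2.1 k (hk.trans hm), fun k hk => h.2.2.2.1 k (hk.trans hm),
    fun k hk => h.2.2.2.2 k (hk.trans hm)⟩

theorem ExpRel.mono {m n : ℕ} {e e' : Exp} (h : ExpRel n e e') (hm : m ≤ n) : ExpRel m e e' :=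
  ⟨h.1, h.2.1, fun k hk => h.2.2 k (hk.trans hm)⟩

theorem expsRel_mono {m n : ℕ} {es es' : List Exp} (h : List.Forall₂ (ExpRel n) es es')
    (hm : m ≤ n) : List.Forall₂ (ExpRel m) es es' :=
  h.imp fun _ _ h => h.mono hm

section Closed
variable {n : ℕ} {K₁ K₂ : FrameStack}

theorem StackRel.vals (h : StackRel n K₁ K₂) {vs vs' : List Val}
    (hv : List.Forall₂ (ValRel n) vs vs') (ht : TermIn K₁ (.vals vs) n) :
    Terminates K₂ (.vals vs') :=
  h.2.2.1 n le_rfl vs vs' hv ht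

theorem StackRel.exc (h : StackRel n K₁ K₂) {x y : Exc} (hx : ExcRel n x y)
    (ht : TermIn K₁ (.exc x) n) : Terminates K₂ (.exc y) :=
  h.2.2.2.1 n le_rfl x y hx ht

theorem StackRel.box (h : StackRel n K₁ K₂) (ht : TermIn K₁ .box n) : Terminates K₂ .box :=
  h.2.2.2.2 n le_rfl ht

theorem StackRel.exp (h : StackRel n K₁ K₂) {e e' : Exp} (he : ExpRel n e e')
    (ht : TermIn K₁ (.exp e) n) : Terminates K₂ (.exp e') :=
  he.2.2 n le_rfl K₁ K₂ h ht

theorem StackRel.outcome (h : StackRel n K₁ K₂) {r r' : Redex} (hr : OutcomeRel n r r')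
    (ht : TermIn K₁ r n) : Terminates K₂ r' := by
  cases hr with
  | vals hv => exact h.vals hv ht
  | exc hx => exact h.exc hx ht
  | exp he => exact h.exp he ht

/-- Frames are related if a step of the first one from related results can be answered. -/
theorem StackRel.push (h : StackRel n K₁ K₂) {F F' : Frame} (hF : F.fv = ∅) (hF' : F'.fv = ∅)
    (hv : ∀ m < n, ∀ vs vs', List.Forall₂ (ValRel (m + 1)) vs vs' → ∀ K r,
      Step (F :: K₁) (.vals vs) K r → TermIn K r m → Terminates (F' :: K₂) (.vals vs'))
    (hx : ∀ m < n, ∀ x y, ExcRel (m + 1) x y → ∀ K r,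
      Step (F :: K₁) (.exc x) K r → TermIn K r m → Terminates (F' :: K₂) (.exc y))
    (hb : ∀ m < n, ∀ K r,
      Step (F :: K₁) .box K r → TermIn K r m → Terminates (F' :: K₂) .box) :
    StackRel n (F :: K₁) (F' :: K₂) := by
  refine ⟨List.forall_mem_cons.2 ⟨hF, h.1⟩, List.forall_mem_cons.2 ⟨hF', h.2.1⟩, ?_, ?_, ?_⟩
  · intro m hm vs vs' hvs ht
    obtain ⟨k, K, r, rfl, hs, ht⟩ := ht.exists_step (by simp)
    -- Here `hm : k + 1 ≤ n` is by definition `k < n`. The values are related at `k + 1`, while the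
    -- remaining run has only `k` steps.
    exact hv k hm vs vs' hvs K r hs ht
  · intro m hm x y hxy ht
    obtain ⟨k, K, r, rfl, hs, ht⟩ := ht.exists_step (by simp)
    exact hx k hm x y hxy K r hs ht
  · intro m hm ht
    obtain ⟨k, K, r, rfl, hs, ht⟩ := ht.exists_step (by simp)
    exact hb k hm K r hs ht

/-- A frame that is not a `try` frame propagates exceptions. -/
theorem StackRel.exc_propagate (h : StackRel n K₁ K₂) {F F' : Frame} (hF : ¬ F.IsTry)
    (hF' : ¬ F'.IsTry) : ∀ m < n, ∀ x y, ExcRel (m + 1) x y → ∀ K r,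
      Step (F :: K₁) (.exc x) K r → TermIn K r m → Terminates (F' :: K₂) (.exc y) := by
  intro m hm x y hxy K r hs ht
  cases hs with
  | excTry => exact (hF trivial).elim
  | excProp =>
    exact (Step.excProp _ _ _ hF').terminates ((h.mono hm.le).exc (hxy.mono m.le_succ) ht)

/-- An expression is never a result, even on the empty stack, so every terminating run has a first
step. After it only stacks related at the smaller index are needed. -/
theorem ExpRel.of_step {e e' : Exp} (he : e.Closed) (he' : e'.Closed)
    (h : ∀ m < n, ∀ K₁ K₂, StackRel m K₁ K₂ → ∀ K r, Step K₁ (.exp e) K r →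
      TermIn K r m → Terminates K₂ (.exp e')) : ExpRel n e e' := by
  refine ⟨he, he', fun m hm K₁ K₂ hK ht => ?_⟩
  -- That an expression is a result reduces to `False`, so `id` refutes it.
  obtain ⟨k, K, r, rfl, hs, ht⟩ := ht.exists_step (fun _ => id)
  exact h k hm K₁ K₂ (StackRel.mono hK k.le_succ) K r hs ht

theorem expsRel_closed {es es' : List Exp} (h : List.Forall₂ (ExpRel n) es es') :
    Exp.fvList es = ∅ ∧ Exp.fvList es' = ∅ := by
  induction h with
  | nil => exact ⟨rfl, rfl⟩
  | cons h _ ih =>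
    simp only [Exp.fvList, Set.union_empty_iff]
    exact ⟨⟨h.1, ih.1⟩, h.2.1, ih.2⟩

theorem valsRel_closed {vs vs' : List Val} (h : List.Forall₂ (ValRel n) vs vs') :
    Val.fvList vs = ∅ ∧ Val.fvList vs' = ∅ :=
  ⟨(forall₂_valRel_iff.1 h).1, (forall₂_valRel_iff.1 h).2.1⟩

/-! ### Values, list cells and sequencing -/

theorem ExpRel.val {v v' : Val} (h : ValRel n v v') : ExpRel n (.val v) (.val v') := by
  refine .of_step h.closed_left
    h.closed_right ?_
  intro m hm K₁ K₂ hK K r hs ht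
  cases hs
  exact (Step.pValue _ _).terminates (hK.vals (.cons (h.mono hm.le) .nil) ht)

theorem StackRel.consHead (h : StackRel n K₁ K₂) {v v' : Val} (hv : ValRel n v v') :
    StackRel n (.consHead v :: K₁) (.consHead v' :: K₂) := by
  -- The two `id`s show that neither frame is a `try` frame. No rule takes the hole on this frame,
  -- so the last condition of `push` is vacuous. The same pattern serves for the other frames.
  refine h.push hv.closed_left hv.closed_right ?_ (h.exc_propagate id id) (by rintro _ _ _ _ ⟨⟩)
  intro m hm vs vs' hvs K r hs ht
  cases hs
  cases hvs with | cons hw hnil =>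
  cases hnil
  exact (Step.pCons _ _ _).terminates ((h.mono hm.le).vals
    (.cons (.cons (hw.mono m.le_succ) (hv.mono hm.le)) .nil) ht)

theorem StackRel.consTail (h : StackRel n K₁ K₂) {e e' : Exp} (he : ExpRel n e e') :
    StackRel n (.consTail e :: K₁) (.consTail e' :: K₂) := by
  refine h.push he.1 he.2.1 ?_ (h.exc_propagate id id) (by rintro _ _ _ _ ⟨⟩)
  intro m hm vs vs' hvs K r hs ht
  cases hs
  cases hvs with | cons hw hnil =>
  cases hnil
  exact (Step.sConsHead _ _ _).terminates
    (((h.mono hm.le).consHead (hw.mono m.le_succ)).exp (he.mono hm.le) ht)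

theorem ExpRel.cons {e₁ e₁' e₂ e₂' : Exp} (h₁ : ExpRel n e₁ e₁') (h₂ : ExpRel n e₂ e₂') :
    ExpRel n (.nonval (.cons e₁ e₂)) (.nonval (.cons e₁' e₂')) := by
  refine .of_step ?_ ?_ ?_
  · simp only [Exp.Closed, Exp.fv, NonVal.fv, Set.union_empty_iff]
    exact ⟨h₁.1, h₂.1⟩
  · simp only [Exp.Closed, Exp.fv, NonVal.fv, Set.union_empty_iff]
    exact ⟨h₁.2.1, h₂.2.1⟩
  · intro m hm K₁ K₂ hK K r hs ht
    cases hs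
    exact (Step.sConsTail _ _ _).terminates
      ((hK.consTail (h₁.mono hm.le)).exp (h₂.mono hm.le) ht)

theorem StackRel.seq (h : StackRel n K₁ K₂) {e e' : Exp} (he : ExpRel n e e') :
    StackRel n (.seq e :: K₁) (.seq e' :: K₂) := by
  refine h.push he.1 he.2.1 ?_ (h.exc_propagate id id) (by rintro _ _ _ _ ⟨⟩)
  intro m hm vs vs' hvs K r hs ht
  cases hs
  cases hvs with | cons hw hnil =>
  cases hnil
  exact (Step.pSeq _ _ _).terminates ((h.mono hm.le).exp (he.mono hm.le) ht)

theorem ExpRel.seq {e₁ e₁' e₂ e₂' : Exp} (h₁ : ExpRel n e₁ e₁') (h₂ : ExpRel n e₂ e₂') :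
    ExpRel n (.nonval (.seq e₁ e₂)) (.nonval (.seq e₁' e₂')) := by
  refine .of_step ?_ ?_ ?_
  · simp only [Exp.Closed, Exp.fv, NonVal.fv, Set.union_empty_iff]
    exact ⟨h₁.1, h₂.1⟩
  · simp only [Exp.Closed, Exp.fv, NonVal.fv, Set.union_empty_iff]
    exact ⟨h₁.2.1, h₂.2.1⟩
  · intro m hm K₁ K₂ hK K r hs ht
    cases hs
    exact (Step.sSeq _ _ _).terminates ((hK.seq (h₂.mono hm.le)).exp (h₁.mono hm.le) ht)

/-! ### Parameter lists -/

/-- Induction on the expressions still to be evaluated. The index, the evaluated values and both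
stacks vary: each evaluated parameter lowers the index and lengthens the value list. With no
expression left, `FrameIdRel.eval` takes over. -/
theorem StackRel.params {es es' : List Exp} (he : List.Forall₂ (ExpRel n) es es')
    (h : StackRel n K₁ K₂) {id id' : FrameId} (hid : FrameIdRel n id id') {vs vs' : List Val}
    (hvs : List.Forall₂ (ValRel n) vs vs') :
    StackRel n (.params id vs es :: K₁) (.params id' vs' es' :: K₂) := by
  induction es generalizing n es' vs vs' with
  | nil =>
    cases he
    refine h.push ?_ ?_ ?_ (h.exc_propagate (fun h => h) (fun h => h)) ?_
    · simp only [Frame.fv, Exp.fvList, Set.union_empty_iff]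
      exact ⟨⟨hid.closed.1, (valsRel_closed hvs).1⟩, trivial⟩
    · simp only [Frame.fv, Exp.fvList, Set.union_empty_iff]
      exact ⟨⟨hid.closed.2, (valsRel_closed hvs).2⟩, trivial⟩
    · intro m hm ws ws' hws K r hs ht
      cases hs with
      | pParams _ _ _ v r hr =>
      cases hws with | cons hw hnil =>
      cases hnil
      -- Since `m < n`, the identifier and all values are available at `m + 1`, and evaluation
      -- returns outcomes related at `m`, just enough for the `m` remaining steps.
      obtain ⟨r', hr', hrel⟩ :=
        (hid.mono hm).eval (List.rel_append (valsRel_mono hvs hm) (.cons hw .nil)) hr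
      exact (Step.pParams _ _ _ _ _ hr').terminates ((h.mono hm.le).outcome hrel ht)
    · intro m hm K r hs ht
      cases hs with
      | pParams₀ _ _ _ r hne hr =>
      obtain ⟨r', hr', hrel⟩ := (hid.mono hm).eval (valsRel_mono hvs hm) hr
      exact (Step.pParams₀ _ _ _ _ (hid.ne_map hne) hr').terminates
        ((h.mono hm.le).outcome hrel ht)
  | cons e es ih =>
    cases he with | cons he hes =>
    have hes' := expsRel_closed hes
    refine h.push ?_ ?_ ?_ (h.exc_propagate (fun h => h) (fun h => h)) ?_
    · simp only [Frame.fv, Exp.fvList, Set.union_empty_iff]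
      exact ⟨⟨hid.closed.1, (valsRel_closed hvs).1⟩, he.1, hes'.1⟩
    · simp only [Frame.fv, Exp.fvList, Set.union_empty_iff]
      exact ⟨⟨hid.closed.2, (valsRel_closed hvs).2⟩, he.2.1, hes'.2⟩
    · intro m hm ws ws' hws K r hs ht
      cases hs
      cases hws with | cons hw hnil =>
      cases hnil
      exact (Step.sParams _ _ _ _ _ _).terminates
        ((ih (expsRel_mono hes hm.le) (h.mono hm.le) (hid.mono hm.le)
          (List.rel_append (valsRel_mono hvs hm.le)
            (.cons (hw.mono m.le_succ) .nil))).exp (he.mono hm.le) ht)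
    · intro m hm K r hs ht
      cases hs with
      | sParams₀ _ _ _ _ hne =>
      -- The hole starts the evaluation only while no value has been collected, so both value lists
      -- are empty.
      cases hvs
      exact (Step.sParams₀ _ _ _ _ (hid.ne_map hne)).terminates
        ((ih (expsRel_mono hes hm.le) (h.mono hm.le) (hid.mono hm.le) .nil).exp
          (he.mono hm.le) ht)

theorem ExpRel.values {es es' : List Exp} (h : List.Forall₂ (ExpRel n) es es') :
    ExpRel n (.nonval (.values es)) (.nonval (.values es')) := by
  refine .of_step (by simpa only [Exp.Closed, Exp.fv, NonVal.fv] using (expsRel_closed h).1)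
    (by simpa only [Exp.Closed, Exp.fv, NonVal.fv] using (expsRel_closed h).2) ?_
  intro m hm K₁ K₂ hK K r hs ht
  cases hs
  exact (Step.sVals _ _).terminates
    ((StackRel.params (expsRel_mono h hm.le) hK .values .nil).box ht)

theorem ExpRel.tuple {es es' : List Exp} (h : List.Forall₂ (ExpRel n) es es') :
    ExpRel n (.nonval (.tuple es)) (.nonval (.tuple es')) := by
  refine .of_step (by simpa only [Exp.Closed, Exp.fv, NonVal.fv] using (expsRel_closed h).1)
    (by simpa only [Exp.Closed, Exp.fv, NonVal.fv] using (expsRel_closed h).2) ?_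
  intro m hm K₁ K₂ hK K r hs ht
  cases hs
  exact (Step.sTuple _ _).terminates
    ((StackRel.params (expsRel_mono h hm.le) hK .tuple .nil).box ht)

theorem ExpRel.primop (a : Atom) {es es' : List Exp} (h : List.Forall₂ (ExpRel n) es es') :
    ExpRel n (.nonval (.primop a es)) (.nonval (.primop a es')) := by
  refine .of_step (by simpa only [Exp.Closed, Exp.fv, NonVal.fv] using (expsRel_closed h).1)
    (by simpa only [Exp.Closed, Exp.fv, NonVal.fv] using (expsRel_closed h).2) ?_
  intro m hm K₁ K₂ hK K r hs ht
  cases hs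
  exact (Step.sPrimOp _ _ _).terminates
    ((StackRel.params (expsRel_mono h hm.le) hK (.primop a) .nil).box ht)

/-- Pairs of related expressions. -/
abbrev ExpItemsRel (n : ℕ) : List (Exp × Exp) → List (Exp × Exp) → Prop :=
  List.Forall₂ fun p q => ExpRel n p.1 q.1 ∧ ExpRel n p.2 q.2

theorem ExpItemsRel.flatMap {l l' : List (Exp × Exp)} (h : ExpItemsRel n l l') :
    List.Forall₂ (ExpRel n) (l.flatMap fun p => [p.1, p.2]) (l'.flatMap fun p => [p.1, p.2]) := by
  induction h with
  | nil => exact .nil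
  | cons h _ ih => exact .cons h.1 (.cons h.2 ih)

theorem ExpItemsRel.closed {l l' : List (Exp × Exp)} (h : ExpItemsRel n l l') :
    Exp.fvItems l = ∅ ∧ Exp.fvItems l' = ∅ := by
  induction h with
  | nil => exact ⟨rfl, rfl⟩
  | cons h _ ih =>
    simp only [Exp.fvItems, Set.union_empty_iff]
    exact ⟨⟨⟨h.1.1, h.2.1⟩, ih.1⟩, ⟨h.1.2.1, h.2.2.1⟩, ih.2⟩

/-- Keys and values are evaluated alternately, as one flat parameter list. A non-empty map starts
with its first key instead of the hole; the empty map reduces in place. -/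
theorem ExpRel.map {l l' : List (Exp × Exp)} (h : ExpItemsRel n l l') :
    ExpRel n (.nonval (.map l)) (.nonval (.map l')) := by
  refine .of_step (by simpa only [Exp.Closed, Exp.fv, NonVal.fv] using h.closed.1)
    (by simpa only [Exp.Closed, Exp.fv, NonVal.fv] using h.closed.2) ?_
  intro m hm K₁ K₂ hK K r hs ht
  cases hs with
  | pMap₀ =>
    cases h
    exact (Step.pMap₀ _).terminates (hK.vals (.cons (.map .nil) .nil) ht)
  | sMap =>
    cases h with | cons h₁ h₂ =>
    have hes := expsRel_mono (.cons h₁.2 (ExpItemsRel.flatMap h₂)) hm.le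
    have hK' := StackRel.params hes hK .map .nil
    exact (Step.sMap _ _ _ _).terminates (hK'.exp (h₁.1.mono hm.le) ht)

theorem StackRel.app (h : StackRel n K₁ K₂) {es es' : List Exp}
    (he : List.Forall₂ (ExpRel n) es es') : StackRel n (.app es :: K₁) (.app es' :: K₂) := by
  refine h.push (expsRel_closed he).1 (expsRel_closed he).2 ?_ (h.exc_propagate id id)
    (by rintro _ _ _ _ ⟨⟩)
  intro m hm vs vs' hvs K r hs ht
  cases hs
  cases hvs with | cons hw hnil =>
  cases hnil
  exact (Step.sAppParam _ _ _).terminates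
    ((StackRel.params (expsRel_mono he hm.le) (h.mono hm.le) (.app (hw.mono m.le_succ)) .nil).box
      ht)

theorem ExpRel.app {e e' : Exp} {es es' : List Exp} (h : ExpRel n e e')
    (he : List.Forall₂ (ExpRel n) es es') :
    ExpRel n (.nonval (.app e es)) (.nonval (.app e' es')) := by
  refine .of_step ?_ ?_ ?_
  · simp only [Exp.Closed, Exp.fv, NonVal.fv, Set.union_empty_iff]
    exact ⟨h.1, (expsRel_closed he).1⟩
  · simp only [Exp.Closed, Exp.fv, NonVal.fv, Set.union_empty_iff]
    exact ⟨h.2.1, (expsRel_closed he).2⟩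
  · intro m hm K₁ K₂ hK K r hs ht
    cases hs
    exact (Step.sApp _ _ _).terminates
      ((hK.app (expsRel_mono he hm.le)).exp (h.mono hm.le) ht)

theorem StackRel.callFun (h : StackRel n K₁ K₂) {v v' : Val} (hv : ValRel n v v')
    {es es' : List Exp} (he : List.Forall₂ (ExpRel n) es es') :
    StackRel n (.callFun v es :: K₁) (.callFun v' es' :: K₂) := by
  refine h.push ?_ ?_ ?_ (h.exc_propagate id id) (by rintro _ _ _ _ ⟨⟩)
  · simp only [Frame.fv, Set.union_empty_iff]
    exact ⟨hv.closed_left, (expsRel_closed he).1⟩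
  · simp only [Frame.fv, Set.union_empty_iff]
    exact ⟨hv.closed_right, (expsRel_closed he).2⟩
  · intro m hm vs vs' hvs K r hs ht
    cases hs
    cases hvs with | cons hw hnil =>
    cases hnil
    exact (Step.sCallParam _ _ _ _).terminates
      ((StackRel.params (expsRel_mono he hm.le) (h.mono hm.le)
        (.call (hv.mono hm.le) (hw.mono m.le_succ)) .nil).box ht)

theorem StackRel.callMod (h : StackRel n K₁ K₂) {e e' : Exp} (h' : ExpRel n e e')
    {es es' : List Exp} (he : List.Forall₂ (ExpRel n) es es') :
    StackRel n (.callMod e es :: K₁) (.callMod e' es' :: K₂) := by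
  refine h.push ?_ ?_ ?_ (h.exc_propagate id id) (by rintro _ _ _ _ ⟨⟩)
  · simp only [Frame.fv, Set.union_empty_iff]
    exact ⟨h'.1, (expsRel_closed he).1⟩
  · simp only [Frame.fv, Set.union_empty_iff]
    exact ⟨h'.2.1, (expsRel_closed he).2⟩
  · intro m hm vs vs' hvs K r hs ht
    cases hs
    cases hvs with | cons hw hnil =>
    cases hnil
    exact (Step.sCallFun _ _ _ _).terminates
      (((h.mono hm.le).callFun (hw.mono m.le_succ) (expsRel_mono he hm.le)).exp
        (h'.mono hm.le) ht)

theorem ExpRel.call {em em' ef ef' : Exp} {es es' : List Exp} (hm : ExpRel n em em')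
    (hf : ExpRel n ef ef') (he : List.Forall₂ (ExpRel n) es es') :
    ExpRel n (.nonval (.call em ef es)) (.nonval (.call em' ef' es')) := by
  refine .of_step ?_ ?_ ?_
  · simp only [Exp.Closed, Exp.fv, NonVal.fv, Set.union_empty_iff]
    exact ⟨⟨hm.1, hf.1⟩, (expsRel_closed he).1⟩
  · simp only [Exp.Closed, Exp.fv, NonVal.fv, Set.union_empty_iff]
    exact ⟨⟨hm.2.1, hf.2.1⟩, (expsRel_closed he).2⟩
  · intro m hm' K₁ K₂ hK K r hs ht
    cases hs
    exact (Step.sCallMod _ _ _ _).terminates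
      ((hK.callMod (hf.mono hm'.le) (expsRel_mono he hm'.le)).exp (hm.mono hm'.le) ht)

/-! ### Bodies of binders -/

/-- The free names of `e` and `e'` are in `B`, and they are related whenever the names in `B` are
bound to related values. -/
def BodyRel (n : ℕ) (B : Set Name) (e e' : Exp) : Prop :=
  e.fv ⊆ B ∧ e'.fv ⊆ B ∧ ∀ m ≤ n, ∀ l l', BindRel m l l' → boundNames l = B →
    ExpRel m (e.subst (.ofList l)) (e'.subst (.ofList l'))

theorem BodyRel.mono {m n : ℕ} {B : Set Name} {e e' : Exp} (h : BodyRel n B e e') (hm : m ≤ n) :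
    BodyRel m B e e' :=
  ⟨h.1, h.2.1, fun k hk => h.2.2 k (hk.trans hm)⟩

/-- No length condition is needed, for `zip` truncates both sides at the same place. -/
theorem bindVars_rel {xs : List Var} {vs vs' : List Val} (h : List.Forall₂ (ValRel n) vs vs') :
    BindRel n (bindVars xs vs) (bindVars xs vs') := by
  induction h generalizing xs with
  | nil => simp [bindVars]
  | cons h _ ih =>
    cases xs with
    | nil => exact .nil
    | cons x xs => exact .cons ⟨rfl, h⟩ ih

theorem BodyRel.bindVars {m : ℕ} {xs : List Var} {e e' : Exp}
    (h : BodyRel n (varNames xs) e e') (hm : m ≤ n) {vs vs' : List Val}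
    (hv : List.Forall₂ (ValRel m) vs vs') (hl : xs.length = vs.length) :
    ExpRel m (e.subst (.ofList (bindVars xs vs))) (e'.subst (.ofList (bindVars xs vs'))) :=
  h.2.2 m hm _ _ (bindVars_rel hv) (boundNames_bindVars hl)

theorem StackRel.elet (h : StackRel n K₁ K₂) {xs : List Var} {e e' : Exp}
    (he : BodyRel n (varNames xs) e e') : StackRel n (.elet xs e :: K₁) (.elet xs e' :: K₂) := by
  refine h.push (Set.sdiff_eq_empty.2 he.1) (Set.sdiff_eq_empty.2 he.2.1) ?_
    (h.exc_propagate id id) (by rintro _ _ _ _ ⟨⟩)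
  intro m hm vs vs' hvs K r hs ht
  cases hs with
  | pLet _ _ _ _ hl =>
  exact (Step.pLet _ _ _ _ (hl.trans hvs.length_eq)).terminates
    ((h.mono hm.le).exp (he.bindVars hm.le (valsRel_mono hvs m.le_succ) hl) ht)

theorem ExpRel.elet {xs : List Var} {e₁ e₁' e₂ e₂' : Exp} (h₁ : ExpRel n e₁ e₁')
    (h₂ : BodyRel n (varNames xs) e₂ e₂') :
    ExpRel n (.nonval (.elet xs e₁ e₂)) (.nonval (.elet xs e₁' e₂')) := by
  refine .of_step ?_ ?_ ?_
  · simp only [Exp.Closed, Exp.fv, NonVal.fv, Set.union_empty_iff, Set.sdiff_eq_empty]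
    exact ⟨h₁.1, h₂.1⟩
  · simp only [Exp.Closed, Exp.fv, NonVal.fv, Set.union_empty_iff, Set.sdiff_eq_empty]
    exact ⟨h₁.2.1, h₂.2.1⟩
  · intro m hm K₁ K₂ hK K r hs ht
    cases hs
    exact (Step.sLet _ _ _ _).terminates ((hK.elet (h₂.mono hm.le)).exp (h₁.mono hm.le) ht)

theorem StackRel.etry (h : StackRel n K₁ K₂) {xs ys : List Var} {e₂ e₂' e₃ e₃' : Exp}
    (h₂ : BodyRel n (varNames xs) e₂ e₂') (h₃ : BodyRel n (varNames ys) e₃ e₃') :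
    StackRel n (.etry xs e₂ ys e₃ :: K₁) (.etry xs e₂' ys e₃' :: K₂) := by
  refine h.push ?_ ?_ ?_ ?_ (by rintro _ _ _ _ ⟨⟩)
  · simp only [Frame.fv, Set.union_empty_iff, Set.sdiff_eq_empty]
    exact ⟨h₂.1, h₃.1⟩
  · simp only [Frame.fv, Set.union_empty_iff, Set.sdiff_eq_empty]
    exact ⟨h₂.2.1, h₃.2.1⟩
  · intro m hm vs vs' hvs K r hs ht
    cases hs with
    | pTry _ _ _ _ _ _ hl =>
    exact (Step.pTry _ _ _ _ _ _ (hl.trans hvs.length_eq)).terminates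
      ((h.mono hm.le).exp (h₂.bindVars hm.le (valsRel_mono hvs m.le_succ) hl) ht)
  · intro m hm x y hxy K r hs ht
    have hxy := hxy.mono m.le_succ
    cases hs with
    -- The rule forces exactly three catch variables, which makes the length condition `rfl`. With
    -- another number of variables no step exists, because propagation does not apply to `try`
    -- frames.
    | excTry =>
      refine (Step.excTry _ _ _ _ _ _ _ _).terminates
        ((h.mono hm.le).exp (h₃.bindVars hm.le ?_ rfl) ht)
      -- Related exceptions have the same class, so the first handler variable receives the same
      -- atom on both sides.
      exact .cons (hxy.1 ▸ .atom _) (.cons hxy.2.1 (.cons hxy.2.2 .nil))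
    | excProp _ _ _ hF => exact (hF trivial).elim

theorem ExpRel.etry {xs ys : List Var} {e₁ e₁' e₂ e₂' e₃ e₃' : Exp} (h₁ : ExpRel n e₁ e₁')
    (h₂ : BodyRel n (varNames xs) e₂ e₂') (h₃ : BodyRel n (varNames ys) e₃ e₃') :
    ExpRel n (.nonval (.etry e₁ xs e₂ ys e₃)) (.nonval (.etry e₁' xs e₂' ys e₃')) := by
  refine .of_step ?_ ?_ ?_
  · simp only [Exp.Closed, Exp.fv, NonVal.fv, Set.union_empty_iff, Set.sdiff_eq_empty]
    exact ⟨⟨h₁.1, h₂.1⟩, h₃.1⟩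
  · simp only [Exp.Closed, Exp.fv, NonVal.fv, Set.union_empty_iff, Set.sdiff_eq_empty]
    exact ⟨⟨h₁.2.1, h₂.2.1⟩, h₃.2.1⟩
  · intro m hm K₁ K₂ hK K r hs ht
    cases hs
    exact (Step.sTry _ _ _ _ _ _).terminates
      ((hK.etry (h₂.mono hm.le) (h₃.mono hm.le)).exp (h₁.mono hm.le) ht)

/-! ### Clauses -/

/-- Clauses with the same patterns and related guards and bodies. -/
def ClauseRel (n : ℕ) (c c' : Clause) : Prop :=
  c.pats = c'.pats ∧ BodyRel n (Pat.varsList c.pats) c.guard c'.guard ∧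
    BodyRel n (Pat.varsList c.pats) c.body c'.body

theorem ClauseRel.mono {m n : ℕ} {c c' : Clause} (h : ClauseRel n c c') (hm : m ≤ n) :
    ClauseRel m c c' :=
  ⟨h.1, h.2.1.mono hm, h.2.2.mono hm⟩

theorem clausesRel_mono {m n : ℕ} {cls cls' : List Clause}
    (h : List.Forall₂ (ClauseRel n) cls cls') (hm : m ≤ n) :
    List.Forall₂ (ClauseRel m) cls cls' :=
  h.imp fun _ _ h => h.mono hm

theorem clausesRel_closed {cls cls' : List Clause} (h : List.Forall₂ (ClauseRel n) cls cls') :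
    Clause.fvList cls = ∅ ∧ Clause.fvList cls' = ∅ := by
  induction h with
  | nil => exact ⟨rfl, rfl⟩
  | @cons c c' _ _ h _ ih =>
    obtain ⟨ps, g, b⟩ := c
    obtain ⟨ps', g', b'⟩ := c'
    obtain ⟨rfl, hg, hb⟩ : ps = ps' ∧ _ := h
    simp only [Clause.fvList, Clause.fv, Set.union_empty_iff, Set.sdiff_eq_empty,
      Set.union_subset_iff]
    exact ⟨⟨⟨hg.1, hb.1⟩, ih.1⟩, ⟨hg.2.1, hb.2.1⟩, ih.2⟩

/-- A false guard resumes matching with the remaining clauses, one step later. Relatedness of those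
`case` frames at smaller indices is therefore a hypothesis, to be supplied by the induction on the
clauses. -/
theorem StackRel.guard (h : StackRel n K₁ K₂) {vs vs' : List Val}
    (hvs : List.Forall₂ (ValRel n) vs vs') (ps : List Pat) {b b' : Exp} (hb : ExpRel n b b')
    {cls cls' : List Clause} (hcls : Clause.fvList cls = ∅) (hcls' : Clause.fvList cls' = ∅)
    (hK : ∀ m < n, StackRel m (.case cls :: K₁) (.case cls' :: K₂)) :
    StackRel n (.guard vs ps b cls :: K₁) (.guard vs' ps b' cls' :: K₂) := by
  refine h.push ?_ ?_ ?_ (h.exc_propagate id id) (by rintro _ _ _ _ ⟨⟩)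
  · simp only [Frame.fv, Set.union_empty_iff]
    exact ⟨⟨(valsRel_closed hvs).1, hb.1⟩, hcls⟩
  · simp only [Frame.fv, Set.union_empty_iff]
    exact ⟨⟨(valsRel_closed hvs).2, hb.2.1⟩, hcls'⟩
  · intro m hm ws ws' hws K r hs ht
    cases hs with
    | sCaseFalse =>
      cases hws with | cons hw hnil =>
      cases hnil
      -- Only an equal atom is related to an atom, so the right guard yields the same truth value.
      obtain rfl := valRel_atom.1 hw
      exact (Step.sCaseFalse _ _ _ _ _).terminates
        ((hK m hm).vals (valsRel_mono hvs hm.le) ht)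
    | pCaseTrue =>
      cases hws with | cons hw hnil =>
      cases hnil
      obtain rfl := valRel_atom.1 hw
      exact (Step.pCaseTrue _ _ _ _ _).terminates ((h.mono hm.le).exp (hb.mono hm.le) ht)

/-- Induction on the clauses for all indices: both a failed match and a false guard lead to the
stacks for the remaining clauses at a smaller index. With no clause left, both sides raise the same
error. -/
theorem StackRel.case {cls cls' : List Clause} (hcls : List.Forall₂ (ClauseRel n) cls cls')
    (h : StackRel n K₁ K₂) : StackRel n (.case cls :: K₁) (.case cls' :: K₂) := by
  induction cls generalizing n cls' with
  | nil =>
    cases hcls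
    refine h.push rfl rfl ?_ (h.exc_propagate (fun h => h) (fun h => h)) (by rintro _ _ _ _ ⟨⟩)
    intro m hm vs vs' hvs K r hs ht
    cases hs
    exact (Step.excCase _ _).terminates
      ((h.mono hm.le).exc (.errorExc _ (.tuple .nil)) ht)
  | cons c cls ih =>
    have hc := clausesRel_closed hcls
    cases hcls with | @cons _ c' _ cls' hcl hcls =>
    refine h.push hc.1 hc.2 ?_ (h.exc_propagate (fun h => h) (fun h => h))
      (by rintro _ _ _ _ ⟨⟩)
    obtain ⟨ps, g, b⟩ := c
    obtain ⟨ps', g', b'⟩ := c'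
    obtain ⟨rfl, hg, hb⟩ : ps = ps' ∧ _ := hcl
    intro m hm vs vs' hvs K r hs ht
    have hvs := valsRel_mono hvs m.le_succ
    have hK : ∀ k ≤ m, StackRel k (.case cls :: K₁) (.case cls' :: K₂) := fun k hk =>
      ih (clausesRel_mono hcls (hk.trans hm.le)) (h.mono (hk.trans hm.le))
    -- The patterns are the same and the values related, so the first clause is dropped on both
    -- sides or selected on both.
    have hbind := Pat.bindingsList_rel ps hvs
    cases hs with
    | sCaseFail _ _ _ _ _ _ hp =>
      rw [hp] at hbind
      refine (Step.sCaseFail _ _ _ _ _ _ ?_).terminates ((hK m le_rfl).vals hvs ht)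
      generalize Pat.bindingsList ps vs' = o at hbind ⊢
      cases hbind
      rfl
    | sCaseSuccess _ _ _ _ _ _ l hp =>
      rw [hp] at hbind
      generalize ho : Pat.bindingsList ps vs' = o at hbind
      cases hbind with | @some _ l' hl =>
      have hB := Pat.boundNames_bindingsList ps hp
      have hc := clausesRel_closed hcls
      exact (Step.sCaseSuccess _ _ _ _ _ _ _ ho).terminates
        (((h.mono hm.le).guard hvs ps (hb.2.2 m hm.le l l' hl hB) hc.1 hc.2
          fun k hk => hK k hk.le).exp (hg.2.2 m hm.le l l' hl hB) ht)

theorem ExpRel.case {e e' : Exp} {cls cls' : List Clause} (h : ExpRel n e e')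
    (hcls : List.Forall₂ (ClauseRel n) cls cls') :
    ExpRel n (.nonval (.case e cls)) (.nonval (.case e' cls')) := by
  refine .of_step ?_ ?_ ?_
  · simp only [Exp.Closed, Exp.fv, NonVal.fv, Set.union_empty_iff]
    exact ⟨h.1, (clausesRel_closed hcls).1⟩
  · simp only [Exp.Closed, Exp.fv, NonVal.fv, Set.union_empty_iff]
    exact ⟨h.2.1, (clausesRel_closed hcls).2⟩
  · intro m hm K₁ K₂ hK K r hs ht
    cases hs
    exact (Step.sCase _ _ _).terminates
      ((StackRel.case (clausesRel_mono hcls hm.le) hK).exp (h.mono hm.le) ht)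

/-! ### Functions -/

/-- Collections of functions with the same names and parameters, and related bodies. -/
def ExtRel (n : ℕ) (ext ext' : List ClosItem) : Prop :=
  List.Forall₂ (fun c c' => c.name = c'.name ∧ c.params = c'.params ∧
    BodyRel n (namesOf ext ∪ varNames c.params) c.body c'.body) ext ext'

theorem ExtRel.mono {m n : ℕ} {ext ext' : List ClosItem} (h : ExtRel n ext ext') (hm : m ≤ n) :
    ExtRel m ext ext' :=
  List.Forall₂.imp (fun _ _ h => ⟨h.1, h.2.1, h.2.2.mono hm⟩) h

theorem ExtRel.namesOf_eq {ext ext' : List ClosItem} (h : ExtRel n ext ext') :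
    namesOf ext = namesOf ext' := by
  have : ext.map ClosItem.name = ext'.map ClosItem.name := by
    rw [← List.forall₂_eq_eq_eq, List.forall₂_map_left_iff, List.forall₂_map_right_iff]
    exact List.Forall₂.imp (fun _ _ h => h.1) h
  rw [CoreErlang.namesOf_eq, CoreErlang.namesOf_eq, this]

theorem ExtRel.fvList_subset {ext ext' : List ClosItem} (h : ExtRel n ext ext') :
    ClosItem.fvList ext ⊆ namesOf ext ∧ ClosItem.fvList ext' ⊆ namesOf ext := by
  rw [ExtRel] at h
  -- The bound names remain those of the whole collection while the induction runs through its
  -- tails.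
  generalize namesOf ext = B at h
  induction h with
  | nil => simp [ClosItem.fvList]
  | @cons c c' _ _ h _ ih =>
    obtain ⟨f, xs, e⟩ := c
    obtain ⟨f', xs', e'⟩ := c'
    obtain ⟨-, rfl, he⟩ : _ ∧ xs = xs' ∧ _ := h
    simp only [ClosItem.fvList, ClosItem.fv, Set.union_subset_iff, Set.sdiff_subset_iff,
      Set.union_comm (varNames _)]
    exact ⟨⟨he.1, ih.1⟩, he.2.1, ih.2⟩

/-- Relatedness of the individual closures is left as a hypothesis, so that the lemma can be used
both within the induction that proves it and afterwards. -/
theorem ExtRel.mkClosList {ext ext' : List ClosItem} (h : ExtRel n ext ext')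
    (hc : ∀ xs e e', BodyRel n (namesOf ext ∪ varNames xs) e e' →
      ValRel n (.clos ext xs e) (.clos ext' xs e')) :
    BindRel n (mkClosList ext) (mkClosList ext') := by
  rw [BindRel, CoreErlang.mkClosList, CoreErlang.mkClosList, List.forall₂_map_left_iff,
    List.forall₂_map_right_iff]
  exact List.Forall₂.imp (fun c c' h => ⟨h.1, h.2.1 ▸ hc _ _ _ h.2.2⟩) h

/-- When the body is entered, the function identifiers are replaced by closures over the same
collection, so the claim refers to itself. The closure relation at `n` asks for related bodies only
at `m < n`, and there the inserted closures are related by induction. The claim is proved for all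
parameters and bodies at once, as any function of the collection may be called. -/
theorem ValRel.clos {ext ext' : List ClosItem} (hext : ExtRel n ext ext') {xs : List Var}
    {e e' : Exp} (he : BodyRel n (namesOf ext ∪ varNames xs) e e') :
    ValRel n (.clos ext xs e) (.clos ext' xs e') := by
  induction n using Nat.strong_induction_on generalizing xs e e' with
  | _ n ih =>
  refine valRel_clos.2 ⟨_, _, _, rfl, ?_, ?_, rfl, ?_⟩
  · simp only [Val.Closed, Val.fv, Set.sdiff_eq_empty, Set.union_subset_iff, Set.sdiff_subset_iff,
      Set.union_comm (varNames _)]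
    exact ⟨hext.fvList_subset.1, he.1⟩
  · simp only [Val.Closed, Val.fv, Set.sdiff_eq_empty, Set.union_subset_iff, Set.sdiff_subset_iff,
      Set.union_comm (varNames _), ← hext.namesOf_eq]
    exact ⟨hext.fvList_subset.2, he.2.1⟩
  · intro m hm vs vs' hl hvs
    refine he.2.2 m hm.le _ _ (.append ?_ (bindVars_rel hvs)) ?_
    -- The induction hypothesis at `m` applies to each function of the collection; the body at hand
    -- plays no role here.
    · exact (hext.mono hm.le).mkClosList fun xs e e' he => ih m hm (hext.mono hm.le) he
    · rw [boundNames_append, boundNames_mkClosList, boundNames_bindVars hl.symm]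

theorem ExpRel.lam {xs : List Var} {e e' : Exp} (h : BodyRel n (varNames xs) e e') :
    ExpRel n (.nonval (.lam xs e)) (.nonval (.lam xs e')) := by
  refine .of_step ?_ ?_ ?_
  · simpa only [Exp.Closed, Exp.fv, NonVal.fv, Set.sdiff_eq_empty] using h.1
  · simpa only [Exp.Closed, Exp.fv, NonVal.fv, Set.sdiff_eq_empty] using h.2.1
  · intro m hm K₁ K₂ hK K r hs ht
    cases hs
    -- A plain function becomes a closure over the empty collection, which binds no identifiers.
    have h' : BodyRel m (namesOf [] ∪ varNames xs) e e' := by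
      have h0 : namesOf [] = ∅ := by simp [namesOf]
      rw [h0, Set.empty_union]
      exact h.mono hm.le
    exact (Step.pFun _ _ _).terminates (hK.vals (.cons (.clos .nil h') .nil) ht)

theorem ExpRel.letrec {ext ext' : List ClosItem} (hext : ExtRel n ext ext') {e e' : Exp}
    (h : BodyRel n (namesOf ext) e e') :
    ExpRel n (.nonval (.letrec ext e)) (.nonval (.letrec ext' e')) := by
  refine .of_step ?_ ?_ ?_
  · simp only [Exp.Closed, Exp.fv, NonVal.fv, Set.sdiff_eq_empty, Set.union_subset_iff]
    exact ⟨hext.fvList_subset.1, h.1⟩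
  · simp only [Exp.Closed, Exp.fv, NonVal.fv, Set.sdiff_eq_empty, Set.union_subset_iff,
      ← hext.namesOf_eq]
    exact ⟨hext.fvList_subset.2, h.2.1⟩
  · intro m hm K₁ K₂ hK K r hs ht
    cases hs
    have hext := hext.mono hm.le
    exact (Step.pLetRec _ _ _).terminates (hK.exp (h.2.2 m hm.le _ _
      (hext.mkClosList fun xs e e' he => .clos hext he) (boundNames_mkClosList ext)) ht)

end Closed

/-! ## Related open terms -/

section Open
variable {Γ B : Set Name} {n : ℕ} {σ σ' : Subst}

open Classical in
/-- The substitution that closes the names in `Γ` only. -/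
noncomputable def Subst.close (Γ : Set Name) : Subst := fun y => if y ∈ Γ then .int 0 else y.toVal

theorem Subst.close_tame (F : Set Name) : (Subst.close Γ).Tame F := by
  intro y _
  unfold Subst.close
  split_ifs
  · exact Or.inr rfl
  · exact Or.inl rfl

theorem substRel_close : SubstRel Γ n (Subst.close Γ) (Subst.close Γ) := by
  have h : ∀ x ∈ Γ, ValRel n (Subst.close Γ x) (Subst.close Γ x) := fun x hx => by
    simp only [Subst.close, hx, if_true]
    -- The choice of `0` is immaterial: any closed value that is related to itself at every index
    -- would do.
    exact .int 0
  exact ⟨fun x hx => (h x hx).closed_left, fun x hx => (h x hx).closed_right, h⟩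

/-- A free name outside `Γ` is untouched by this substitution and would remain free in the instance.
-/
theorem fv_subset_of_closed_subst_close {e : Exp} (h : (e.subst (Subst.close Γ)).Closed) :
    e.fv ⊆ Γ := by
  rw [Exp.Closed, Exp.fv_subst e (Subst.close_tame _)] at h
  intro y hy
  by_contra hyΓ
  have : y ∈ (Subst.close Γ).keep e.fv := ⟨hy, by simp [Subst.close, hyΓ, Val.Closed]⟩
  rw [h] at this
  exact this

/-- Only names in `Γ` are free in expressions that are related under `Γ`. -/
theorem OpenExpRel.fv_subset {e e' : Exp} (h : OpenExpRel Γ e e') : e.fv ⊆ Γ ∧ e'.fv ⊆ Γ :=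
  -- Closedness is part of the relation at every index, so index `0` is enough.
  have h := h 0 _ _ substRel_close
  ⟨fv_subset_of_closed_subst_close h.1, fv_subset_of_closed_subst_close h.2.1⟩

theorem SubstRel.mono {m : ℕ} (h : SubstRel Γ n σ σ') (hm : m ≤ n) : SubstRel Γ m σ σ' :=
  ⟨h.1, h.2.1, fun x hx => (h.2.2 x hx).mono hm⟩

/-- Related substitutions may do anything outside `Γ`, so tameness can be claimed only for names
that are free below the binder and not bound by it; these lie in `Γ`. -/
theorem SubstRel.tame (h : SubstRel Γ n σ σ') {F : Set Name} (hF : F ⊆ Γ ∪ B) :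
    σ.Tame (F \ B) ∧ σ'.Tame (F \ B) :=
  ⟨fun y hy => Or.inr (h.1 y ((hF hy.1).resolve_right hy.2)),
    fun y hy => Or.inr (h.2.1 y ((hF hy.1).resolve_right hy.2))⟩

/-- Both lists bind the same names in the same order, so the lookups stop at the same position, also
when a name is bound repeatedly. -/
theorem BindRel.ofList {l l' : List (Name × Val)} (h : BindRel n l l') {y : Name}
    (hy : y ∈ boundNames l) : ValRel n (Subst.ofList l y) (Subst.ofList l' y) := by
  induction h with
  | nil => simp [boundNames] at hy
  | @cons p q l l' hpq _ ih =>
    obtain ⟨x, v⟩ := p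
    obtain ⟨x', v'⟩ := q
    obtain ⟨rfl, hv⟩ : x = x' ∧ ValRel n v v' := hpq
    by_cases hxy : y = x
    · subst hxy
      simpa [Subst.ofList, List.lookup] using hv
    · have hb : (y == x) = false := by simpa using hxy
      simp only [Subst.ofList, List.lookup, hb] at ih ⊢
      exact ih (by simpa [boundNames, hxy] using hy)

theorem keep_mask_subset {F : Set Name} (hσ : ∀ y ∈ Γ, (σ y).Closed) (hF : F ⊆ Γ ∪ B) :
    (σ.mask B).keep F ⊆ B := by
  rintro y ⟨hy, hc⟩
  by_contra hB
  rw [mask_of_notMem hB] at hc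
  exact hc (hσ y ((hF hy).resolve_right hB))

open Classical in
/-- The substitution `σ`, overridden on `B` by `τ`. -/
noncomputable def Subst.override (σ : Subst) (B : Set Name) (τ : Subst) : Subst :=
  fun y => if y ∈ B then τ y else σ y

/-- Names in `B` pass the mask and are replaced by `τ`; all others have received closed values from
`σ`, which `τ` cannot change. Two successive substitutions thus become a parallel one. -/
theorem composes_override {F : Set Name} {τ : Subst} (hσ : ∀ y ∈ Γ, (σ y).Closed)
    (hτ : ∀ y ∈ B, (τ y).Closed) (hF : F ⊆ Γ ∪ B) :
    Composes (σ.mask B) τ (σ.override B τ) F := by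
  intro y hy
  by_cases hB : y ∈ B
  · rw [mask_of_mem hB, Subst.override, if_pos hB]
    exact Or.inl ⟨rfl, rfl, Or.inr (hτ y hB)⟩
  · rw [mask_of_notMem hB, Subst.override, if_neg hB]
    exact Or.inr ⟨hσ y ((hF hy).resolve_right hB), rfl⟩

theorem SubstRel.override (h : SubstRel Γ n σ σ') {τ τ' : Subst}
    (hτ : ∀ y ∈ B, ValRel n (τ y) (τ' y)) :
    SubstRel (Γ ∪ B) n (σ.override B τ) (σ'.override B τ') := by
  have h : ∀ y ∈ Γ ∪ B, ValRel n (σ.override B τ y) (σ'.override B τ' y) := by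
    intro y hy
    unfold Subst.override
    split_ifs with hB
    · exact hτ y hB
    · exact h.2.2 y (hy.resolve_right hB)
  exact ⟨fun y hy => (h y hy).closed_left, fun y hy => (h y hy).closed_right, h⟩

/-- The link between open relations and binders of closed terms: closing substitution and later
bindings combine to substitutions related on `Γ ∪ B`, to which the hypothesis applies. The free
names that remain are in `B`, as `σ` and `σ'` close those in `Γ`. -/
theorem OpenExpRel.body {e e' : Exp} (h : OpenExpRel (Γ ∪ B) e e') (hσ : SubstRel Γ n σ σ') :
    BodyRel n B (e.subst (σ.mask B)) (e'.subst (σ'.mask B)) := by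
  have hF := h.fv_subset
  refine ⟨?_, ?_, ?_⟩
  · rw [Exp.fv_subst _ (hσ.tame hF.1).1.mask]
    exact keep_mask_subset hσ.1 hF.1
  · rw [Exp.fv_subst _ (hσ.tame hF.2).2.mask]
    exact keep_mask_subset hσ.2.1 hF.2
  · intro m hm l l' hl hB
    have hτ : ∀ y ∈ B, ValRel m (Subst.ofList l y) (Subst.ofList l' y) :=
      fun y hy => hl.ofList (hB ▸ hy)
    -- Related values are closed, which is what composition demands of the bindings.
    rw [Exp.subst_subst _ (composes_override hσ.1 (fun y hy => (hτ y hy).closed_left) hF.1),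
      Exp.subst_subst _ (composes_override hσ.2.1 (fun y hy => (hτ y hy).closed_right) hF.2)]
    exact h m _ _ ((hσ.mono hm).override hτ)

-- Instances of lists, associations and clauses

theorem OpenExpsRel.subst {es es' : List Exp} (h : OpenExpsRel Γ es es')
    (hσ : SubstRel Γ n σ σ') :
    List.Forall₂ (ExpRel n) (Exp.substList σ es) (Exp.substList σ' es') := by
  induction h with
  | nil => exact .nil
  | cons h _ ih => exact .cons (h n _ _ hσ) ih

theorem OpenValsRel.subst {vs vs' : List Val} (h : OpenValsRel Γ vs vs')
    (hσ : SubstRel Γ n σ σ') :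
    List.Forall₂ (ValRel n) (Val.substList σ vs) (Val.substList σ' vs') := by
  induction h with
  | nil => exact .nil
  | cons h _ ih => exact .cons (h n _ _ hσ) ih

theorem expItemsRel_subst {l l' : List (Exp × Exp)}
    (h : List.Forall₂ (fun p p' => OpenExpRel Γ p.1 p'.1 ∧ OpenExpRel Γ p.2 p'.2) l l')
    (hσ : SubstRel Γ n σ σ') : ExpItemsRel n (Exp.substItems σ l) (Exp.substItems σ' l') := by
  induction h with
  | nil => exact .nil
  | cons h _ ih => exact .cons ⟨h.1 n _ _ hσ, h.2 n _ _ hσ⟩ ih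

theorem itemsRel_subst {l l' : List (Val × Val)}
    (h : List.Forall₂ (fun p p' => OpenValRel Γ p.1 p'.1 ∧ OpenValRel Γ p.2 p'.2) l l')
    (hσ : SubstRel Γ n σ σ') :
    List.Forall₂ (ItemRel n) (Val.substItems σ l) (Val.substItems σ' l') := by
  induction h with
  | nil => exact .nil
  | cons h _ ih => exact .cons ⟨h.1 n _ _ hσ, h.2 n _ _ hσ⟩ ih

theorem clausesRel_subst {cls cls' : List Clause}
    (h : List.Forall₂ (fun cl cl' => cl.pats = cl'.pats ∧
      OpenExpRel (Γ ∪ Pat.varsList cl.pats) cl.guard cl'.guard ∧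
      OpenExpRel (Γ ∪ Pat.varsList cl.pats) cl.body cl'.body) cls cls')
    (hσ : SubstRel Γ n σ σ') :
    List.Forall₂ (ClauseRel n) (Clause.substList σ cls) (Clause.substList σ' cls') := by
  induction h with
  | nil => exact .nil
  | @cons c c' _ _ h _ ih =>
    obtain ⟨ps, g, b⟩ := c
    obtain ⟨ps', g', b'⟩ := c'
    obtain ⟨rfl, hg, hb⟩ : ps = ps' ∧ OpenExpRel (Γ ∪ Pat.varsList ps) g g' ∧
      OpenExpRel (Γ ∪ Pat.varsList ps) b b' := h
    refine .cons ?_ ih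
    rw [Clause.subst_mk (hσ.tame (Set.union_subset hg.fv_subset.1 hb.fv_subset.1)).1,
      Clause.subst_mk (hσ.tame (Set.union_subset hg.fv_subset.2 hb.fv_subset.2)).2]
    exact ⟨rfl, hg.body hσ, hb.body hσ⟩

/-! ### Collections of functions -/

theorem EquivExt.namesOf_eq {ext ext' : List ClosItem} (h : EquivExt Γ ext ext') :
    namesOf ext' = namesOf ext := by
  have : ext'.map ClosItem.name = ext.map ClosItem.name := by
    rw [← List.forall₂_eq_eq_eq, List.forall₂_map_left_iff, List.forall₂_map_right_iff]
    exact List.Forall₂.flip (List.Forall₂.imp (fun _ _ h => h.1.symm) h)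
  rw [CoreErlang.namesOf_eq, CoreErlang.namesOf_eq, this]

theorem EquivExt.fvList_subset {ext ext' : List ClosItem} (h : EquivExt Γ ext ext') :
    ClosItem.fvList ext ⊆ Γ ∪ namesOf ext ∧ ClosItem.fvList ext' ⊆ Γ ∪ namesOf ext := by
  rw [EquivExt] at h
  generalize namesOf ext = B at h
  induction h with
  | nil => simp [ClosItem.fvList]
  | @cons c c' _ _ h _ ih =>
    obtain ⟨f, xs, e⟩ := c
    obtain ⟨f', xs', e'⟩ := c'
    obtain ⟨-, rfl, he⟩ : _ ∧ xs = xs' ∧ OpenExpRel (Γ ∪ B ∪ varNames xs) e e' := h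
    simp only [ClosItem.fvList, ClosItem.fv, Set.union_subset_iff, Set.sdiff_subset_iff,
      Set.union_comm (varNames _)]
    exact ⟨⟨he.fv_subset.1, ih.1⟩, he.fv_subset.2, ih.2⟩

/-- A definition sits below two binders, the identifiers of the collection and its own parameters.
The two masks merge into one on the union, where `OpenExpRel.body` applies. -/
theorem EquivExt.subst {ext ext' : List ClosItem} (h : EquivExt Γ ext ext')
    (hσ : SubstRel Γ n σ σ') :
    ExtRel n (ClosItem.substList Renaming.id (σ.mask (namesOf ext)) ext)
      (ClosItem.substList Renaming.id (σ'.mask (namesOf ext)) ext') := by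
  rw [ExtRel, namesOf_substList_id]
  rw [EquivExt] at h
  generalize namesOf ext = B at h ⊢
  induction h with
  | nil => exact .nil
  | @cons c c' _ _ h _ ih =>
    obtain ⟨f, xs, e⟩ := c
    obtain ⟨f', xs', e'⟩ := c'
    obtain ⟨hn, rfl, he⟩ : ClosItem.name _ = ClosItem.name _ ∧ xs = xs' ∧
      OpenExpRel (Γ ∪ B ∪ varNames xs) e e' := h
    refine .cons ⟨?_, ?_⟩ ih
    · rw [ClosItem.name_subst_id, ClosItem.name_subst_id, hn]
    · have hF := he.fv_subset
      rw [Set.union_assoc] at he hF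
      -- Tameness at the inner binder is needed for the substitution that is already masked on `B`;
      -- removing both sets in turn leaves names of `Γ` only.
      have hmask : ∀ {F : Set Name}, F ⊆ Γ ∪ (B ∪ varNames xs) →
          (σ.mask B).Tame (F \ varNames xs) ∧ (σ'.mask B).Tame (F \ varNames xs) := by
        intro F hF
        have := hσ.tame hF
        have hsub : (F \ varNames xs) \ B ⊆ F \ (B ∪ varNames xs) :=
          fun y hy => ⟨hy.1.1, not_or.2 ⟨hy.2, hy.1.2⟩⟩
        exact ⟨(this.1.mono hsub).mask, (this.2.mono hsub).mask⟩
      rw [ClosItem.subst_mk (hmask hF.1).1, ClosItem.subst_mk (hmask hF.2).2, mask_mask, mask_mask]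
      exact ⟨rfl, he.body hσ⟩

/-! ### Compatibility of the binding constructors -/

theorem OpenExpRel.lam {xs : List Var} {e e' : Exp} (h : OpenExpRel (Γ ∪ varNames xs) e e') :
    OpenExpRel Γ (.nonval (.lam xs e)) (.nonval (.lam xs e')) := by
  intro n σ σ' hσ
  rw [Exp.subst, Exp.subst, NonVal.subst_lam (hσ.tame h.fv_subset.1).1,
    NonVal.subst_lam (hσ.tame h.fv_subset.2).2]
  exact .lam (h.body hσ)

theorem OpenExpRel.letrec {ext ext' : List ClosItem} {e e' : Exp}
    (h : OpenExpRel (Γ ∪ namesOf ext) e e') (hext : EquivExt Γ ext ext') :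
    OpenExpRel Γ (.nonval (.letrec ext e)) (.nonval (.letrec ext' e')) := by
  intro n σ σ' hσ
  have hF := hσ.tame (Set.union_subset hext.fvList_subset.1 h.fv_subset.1)
  have hF' := hσ.tame (Set.union_subset hext.fvList_subset.2 h.fv_subset.2)
  -- Substitution in the second `letrec` masks the identifiers of `ext'`; these form the same set.
  rw [← hext.namesOf_eq] at hF'
  rw [Exp.subst, Exp.subst, NonVal.subst_letrec hF.1, NonVal.subst_letrec hF'.2, hext.namesOf_eq]
  refine .letrec (hext.subst hσ) ?_
  rw [namesOf_substList_id]
  exact h.body hσ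

theorem OpenExpRel.elet {xs : List Var} {e₁ e₁' e₂ e₂' : Exp} (h₁ : OpenExpRel Γ e₁ e₁')
    (h₂ : OpenExpRel (Γ ∪ varNames xs) e₂ e₂') :
    OpenExpRel Γ (.nonval (.elet xs e₁ e₂)) (.nonval (.elet xs e₁' e₂')) := by
  intro n σ σ' hσ
  rw [Exp.subst, Exp.subst, NonVal.subst_elet (hσ.tame h₂.fv_subset.1).1,
    NonVal.subst_elet (hσ.tame h₂.fv_subset.2).2]
  exact .elet (h₁ n _ _ hσ) (h₂.body hσ)

theorem OpenExpRel.etry {xs ys : List Var} {e₁ e₁' e₂ e₂' e₃ e₃' : Exp}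
    (h₁ : OpenExpRel Γ e₁ e₁') (h₂ : OpenExpRel (Γ ∪ varNames xs) e₂ e₂')
    (h₃ : OpenExpRel (Γ ∪ varNames ys) e₃ e₃') :
    OpenExpRel Γ (.nonval (.etry e₁ xs e₂ ys e₃)) (.nonval (.etry e₁' xs e₂' ys e₃')) := by
  intro n σ σ' hσ
  rw [Exp.subst, Exp.subst,
    NonVal.subst_etry (hσ.tame h₂.fv_subset.1).1 (hσ.tame h₃.fv_subset.1).1,
    NonVal.subst_etry (hσ.tame h₂.fv_subset.2).2 (hσ.tame h₃.fv_subset.2).2]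
  exact .etry (h₁ n _ _ hσ) (h₂.body hσ) (h₃.body hσ)

theorem OpenValRel.clos {ext ext' : List ClosItem} {xs : List Var} {e e' : Exp}
    (h : OpenExpRel (Γ ∪ namesOf ext ∪ varNames xs) e e') (hext : EquivExt Γ ext ext') :
    OpenValRel Γ (.clos ext xs e) (.clos ext' xs e') := by
  intro n σ σ' hσ
  have hsub : ∀ {F : Set Name}, F ⊆ Γ ∪ namesOf ext ∪ varNames xs →
      F \ varNames xs ⊆ Γ ∪ namesOf ext := fun hF => by
    rwa [Set.sdiff_subset_iff, Set.union_comm]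
  have hF := hσ.tame (Set.union_subset hext.fvList_subset.1 (hsub h.fv_subset.1))
  have hF' := hσ.tame (Set.union_subset hext.fvList_subset.2 (hsub h.fv_subset.2))
  rw [← hext.namesOf_eq] at hF'
  -- As for definitions, the masks for identifiers and parameters merge into one on their union.
  rw [Val.subst_clos hF.1, Val.subst_clos hF'.2, hext.namesOf_eq, mask_mask, mask_mask]
  refine .clos (hext.subst hσ) ?_
  rw [namesOf_substList_id]
  rw [Set.union_assoc] at h
  exact h.body hσ

end Open

end CoreErlang

-- The compatibility rules

theorem mainTheorem5 (Γ : Set Name) :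
    -- compatibility of the expression constructors
    -- functions
    (∀ (xs : List Var) (e₁ e₂ : Exp),
      OpenExpRel (Γ ∪ varNames xs) e₁ e₂ →
        OpenExpRel Γ (.nonval (.lam xs e₁)) (.nonval (.lam xs e₂))) ∧
    -- list cells
    (∀ e₁ e₁' e₂ e₂' : Exp,
      OpenExpRel Γ e₁ e₁' → OpenExpRel Γ e₂ e₂' →
        OpenExpRel Γ (.nonval (.cons e₁ e₂)) (.nonval (.cons e₁' e₂'))) ∧
    -- applications
    (∀ (e e' : Exp) (es es' : List Exp),
      OpenExpRel Γ e e' → OpenExpsRel Γ es es' →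
        OpenExpRel Γ (.nonval (.app e es)) (.nonval (.app e' es'))) ∧
    -- calls
    (∀ (em em' ef ef' : Exp) (es es' : List Exp),
      OpenExpRel Γ em em' → OpenExpRel Γ ef ef' → OpenExpsRel Γ es es' →
        OpenExpRel Γ (.nonval (.call em ef es)) (.nonval (.call em' ef' es'))) ∧
    -- maps
    (∀ items items' : List (Exp × Exp),
      List.Forall₂ (fun p p' => OpenExpRel Γ p.1 p'.1 ∧ OpenExpRel Γ p.2 p'.2) items items' →
        OpenExpRel Γ (.nonval (.map items)) (.nonval (.map items'))) ∧
    -- tuples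
    (∀ es es' : List Exp,
      OpenExpsRel Γ es es' →
        OpenExpRel Γ (.nonval (.tuple es)) (.nonval (.tuple es'))) ∧
    -- primitive operations
    (∀ (a a' : Atom) (es es' : List Exp),
      OpenExpsRel Γ es es' → a = a' →
        OpenExpRel Γ (.nonval (.primop a es)) (.nonval (.primop a' es'))) ∧
    -- recursive functions
    (∀ (ext ext' : List ClosItem) (e e' : Exp),
      OpenExpRel (Γ ∪ namesOf ext) e e' → EquivExt Γ ext ext' →
        OpenExpRel Γ (.nonval (.letrec ext e)) (.nonval (.letrec ext' e'))) ∧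
    -- value lists
    (∀ es es' : List Exp,
      OpenExpsRel Γ es es' →
        OpenExpRel Γ (.nonval (.values es)) (.nonval (.values es'))) ∧
    -- bindings
    (∀ (xs : List Var) (e₁ e₁' e₂ e₂' : Exp),
      OpenExpRel Γ e₁ e₁' → OpenExpRel (Γ ∪ varNames xs) e₂ e₂' →
        OpenExpRel Γ (.nonval (.elet xs e₁ e₂)) (.nonval (.elet xs e₁' e₂'))) ∧
    -- sequencing
    (∀ e₁ e₁' e₂ e₂' : Exp,
      OpenExpRel Γ e₁ e₁' → OpenExpRel Γ e₂ e₂' →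
        OpenExpRel Γ (.nonval (.seq e₁ e₂)) (.nonval (.seq e₁' e₂'))) ∧
    -- case
    (∀ (e e' : Exp) (cls cls' : List Clause),
      OpenExpRel Γ e e' →
      List.Forall₂ (fun cl cl' => cl.pats = cl'.pats ∧
        OpenExpRel (Γ ∪ Pat.varsList cl.pats) cl.guard cl'.guard ∧
        OpenExpRel (Γ ∪ Pat.varsList cl.pats) cl.body cl'.body) cls cls' →
        OpenExpRel Γ (.nonval (.case e cls)) (.nonval (.case e' cls'))) ∧
    -- exception handlers
    (∀ (xs ys : List Var) (e₁ e₁' e₂ e₂' e₃ e₃' : Exp),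
      OpenExpRel Γ e₁ e₁' → OpenExpRel (Γ ∪ varNames xs) e₂ e₂' →
      OpenExpRel (Γ ∪ varNames ys) e₃ e₃' →
        OpenExpRel Γ (.nonval (.etry e₁ xs e₂ ys e₃)) (.nonval (.etry e₁' xs e₂' ys e₃'))) ∧
    -- compatibility of the value constructors
    (∀ x : Var, Name.var x ∈ Γ → OpenValRel Γ (.var x) (.var x)) ∧
    (∀ (f : Atom) (k : ℕ), Name.fid f k ∈ Γ → OpenValRel Γ (.fid f k) (.fid f k)) ∧
    (∀ a : Atom, OpenValRel Γ (.atom a) (.atom a)) ∧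
    (∀ i : ℤ, OpenValRel Γ (.int i) (.int i)) ∧
    OpenValRel Γ .nil .nil ∧
    (∀ v₁ v₁' v₂ v₂' : Val,
      OpenValRel Γ v₁ v₁' → OpenValRel Γ v₂ v₂' →
        OpenValRel Γ (.cons v₁ v₂) (.cons v₁' v₂')) ∧
    (∀ vs vs' : List Val,
      OpenValsRel Γ vs vs' → OpenValRel Γ (.tuple vs) (.tuple vs')) ∧
    (∀ items items' : List (Val × Val),
      List.Forall₂ (fun p p' => OpenValRel Γ p.1 p'.1 ∧ OpenValRel Γ p.2 p'.2) items items' →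
        OpenValRel Γ (.map items) (.map items')) ∧
    (∀ (ext ext' : List ClosItem) (xs : List Var) (e e' : Exp),
      OpenExpRel (Γ ∪ namesOf ext ∪ varNames xs) e e' → EquivExt Γ ext ext' →
        OpenValRel Γ (.clos ext xs e) (.clos ext' xs e')) ∧
    -- value sequences and exceptions
    (∀ vs vs' : List Val,
      OpenValsRel Γ vs vs' → OpenRedexRel Γ (.vals vs) (.vals vs')) ∧
    (∀ (c : ExcClass) (vr vr' vd vd' : Val),
      OpenValRel Γ vr vr' → OpenValRel Γ vd vd' →
        OpenRedexRel Γ (.exc ⟨c, vr, vd⟩) (.exc ⟨c, vr', vd'⟩)) ∧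
    -- values as expressions, expressions as redexes
    (∀ v v' : Val, OpenValRel Γ v v' → OpenExpRel Γ (.val v) (.val v')) ∧
    (∀ e e' : Exp, OpenRedexRel Γ (.exp e) (.exp e') → OpenExpRel Γ e e') ∧
    (∀ e e' : Exp, OpenExpRel Γ e e' → OpenRedexRel Γ (.exp e) (.exp e')) := by
  -- Most constructors with binders are settled beforehand. Elsewhere substitution distributes over
  -- the constructor, and the closed rule applies to the instances; in `case` the binders are
  -- handled clause by clause.
  refine ⟨fun xs e₁ e₂ h => h.lam, ?_, ?_, ?_, ?_, ?_, ?_, fun ext ext' e e' h hext =>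
    h.letrec hext, ?_, fun xs e₁ e₁' e₂ e₂' h₁ h₂ => h₁.elet h₂, ?_, ?_,
    fun xs ys e₁ e₁' e₂ e₂' e₃ e₃' h₁ h₂ h₃ => h₁.etry h₂ h₃, ?_, ?_, ?_, ?_, ?_, ?_, ?_, ?_,
    fun ext ext' xs e e' h hext => OpenValRel.clos h hext, ?_, ?_, ?_, ?_, ?_⟩
  · intro e₁ e₁' e₂ e₂' h₁ h₂ n σ σ' hσ
    simp only [Exp.subst, NonVal.subst]
    exact .cons (h₁ n _ _ hσ) (h₂ n _ _ hσ)
  · intro e e' es es' h hes n σ σ' hσ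
    simp only [Exp.subst, NonVal.subst]
    exact .app (h n _ _ hσ) (OpenExpsRel.subst hes hσ)
  · intro em em' ef ef' es es' hm hf hes n σ σ' hσ
    simp only [Exp.subst, NonVal.subst]
    exact .call (hm n _ _ hσ) (hf n _ _ hσ) (OpenExpsRel.subst hes hσ)
  · intro l l' h n σ σ' hσ
    simp only [Exp.subst, NonVal.subst]
    exact .map (expItemsRel_subst h hσ)
  · intro es es' h n σ σ' hσ
    simp only [Exp.subst, NonVal.subst]
    exact .tuple (OpenExpsRel.subst h hσ)
  · rintro a _ es es' h rfl n σ σ' hσ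
    simp only [Exp.subst, NonVal.subst]
    exact .primop a (OpenExpsRel.subst h hσ)
  · intro es es' h n σ σ' hσ
    simp only [Exp.subst, NonVal.subst]
    exact .values (OpenExpsRel.subst h hσ)
  · intro e₁ e₁' e₂ e₂' h₁ h₂ n σ σ' hσ
    simp only [Exp.subst, NonVal.subst]
    exact .seq (h₁ n _ _ hσ) (h₂ n _ _ hσ)
  · intro e e' cls cls' h hcls n σ σ' hσ
    simp only [Exp.subst, NonVal.subst]
    exact .case (h n _ _ hσ) (clausesRel_subst hcls hσ)
  · intro x hx n σ σ' hσ
    simp only [Val.subst]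
    exact hσ.2.2 _ hx
  · intro f k hf n σ σ' hσ
    simp only [Val.subst]
    exact hσ.2.2 _ hf
  · intro a n σ σ' _
    simp only [Val.subst]
    exact .atom a
  · intro i n σ σ' _
    simp only [Val.subst]
    exact .int i
  · intro n σ σ' _
    simp only [Val.subst]
    exact .nil
  · intro v₁ v₁' v₂ v₂' h₁ h₂ n σ σ' hσ
    simp only [Val.subst]
    exact .cons (h₁ n _ _ hσ) (h₂ n _ _ hσ)
  · intro vs vs' h n σ σ' hσ
    simp only [Val.subst]
    exact .tuple (OpenValsRel.subst h hσ)
  · intro l l' h n σ σ' hσ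
    simp only [Val.subst]
    exact .map (itemsRel_subst h hσ)
  · intro vs vs' h n σ σ' hσ
    have hvs := OpenValsRel.subst h hσ
    exact ⟨(valsRel_closed hvs).1, (valsRel_closed hvs).2,
      fun m hm K₁ K₂ hK => hK.vals (valsRel_mono hvs hm)⟩
  · intro c vr vr' vd vd' hr hd n σ σ' hσ
    have hr := hr n _ _ hσ
    have hd := hd n _ _ hσ
    exact ⟨Set.union_empty_iff.2 ⟨hr.closed_left, hd.closed_left⟩,
      Set.union_empty_iff.2 ⟨hr.closed_right, hd.closed_right⟩,
      fun m hm K₁ K₂ hK => hK.exc ((ExcRel.mk hr hd).mono hm)⟩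
  · intro v v' h n σ σ' hσ
    simp only [Exp.subst]
    exact .val (h n _ _ hσ)
  · intro e e' h n σ σ' hσ
    -- On expressions the redex relation unfolds to the same conditions as the expression relation,
    -- so both inclusions hold by definition.
    exact h n _ _ hσ
  · intro e e' h n σ σ' hσ
    exact h n _ _ hσ
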